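/- Let $\mathbb F_r$ be a finite field of characteristic $p$ with $r$ elements, ${\mathbf A}=\mathbb F_r[T]$, and let $v$ be a prime of ${\mathbf A}$ of degree $1$. Let ${\mathbf k}_v$ be the completion of $\mathbb F_r(T)$ at $v$, and let ${\mathbf C}_v$ be the completion of an algebraic closure of ${\mathbf k}_v$, with its canonical absolute value. Put $S_v=\mathbb Z/(r^{\deg v}-1)\times\mathbb Z_p=\mathbb Z/(r-1)\times\mathbb Z_p$, a topological ring in which the natural numbers are dense. For $n\in{\mathbf A}$ prime to $v$ and $s\in S_v$, let $n^{s}\in{\mathbf k}_v$ be the limit of $n^{e}$ as the natural number $e$ tends to $s$ in $S_v$. For $x\in{\mathbf C}_v^\ast$ and $s\in S_v$ put $$\zeta_{A,v}(x,s)=\sum_{d=0}^\infty x^{-d}\Bigl(\sum_{\substack{n\in{\mathbf A}\text{ monic},\ \deg n=d\\ n\text{ prime to }v}} n^{-s}\Bigr).$$ Let $j$ be an element of the ideal $(r-1)S_v$. Then the series $\zeta_{A,v}(x,j)$ converges for every $x\in{\mathbf C}_v^\ast$, and: 1. every zero $x\in{\mathbf C}_v^\ast$ of $\zeta_{A,v}(x,j)$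 is simple and lies in ${\mathbf k}_v$; 2. the zeros are uniquely determined by their absolute values: if $x,y\in{\mathbf C}_v^\ast$ are zeros of $\zeta_{A,v}(\cdot,j)$ with $|x|=|y|$, then $x=y$. -/

import Mathlib

open Filter Topology Polynomial IsDedekindDomain

noncomputable section

namespace GossZeta

/-! ### The local field at a finite place of the rational function field -/

/-- The degree of a prime `v` of `F[T]`: the dimension of the residue field over `F`. -/
def degree {F : Type*} [Field F] (v : HeightOneSpectrum F[X]) : ℕ :=
  Module.finrank F (F[X] ⧸ v.asIdeal)

theorem degree_pos {F : Type*} [Field F] (v : HeightOneSpectrum F[X]) : 0 < degree v := by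
  obtain ⟨g, hg⟩ := (IsPrincipalIdealRing.principal v.asIdeal).principal
  have hg0 : g ≠ 0 := by
    rintro rfl
    exact v.ne_bot (by simpa using hg)
  have hg' : v.asIdeal = Ideal.span {g} := hg
  have : Module.Finite F (F[X] ⧸ v.asIdeal) := by
    rw [hg']
    exact (AdjoinRoot.powerBasis hg0).finite
  have : Nontrivial (F[X] ⧸ v.asIdeal) :=
    Ideal.Quotient.nontrivial_iff.mpr v.isPrime.ne_top
  exact Module.finrank_pos

/-- The completion `k_v` of `F(T)` at the prime `v` of `F[T]`. -/
abbrev LocalField {F : Type*} [Field F] (v : HeightOneSpectrum F[X]) : Type _ :=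
  v.adicCompletion (RatFunc F)

section Norm

variable {F : Type*} [Field F] [Finite F] (v : HeightOneSpectrum F[X])

theorem one_lt_base : 1 < (Nat.card F : NNReal) ^ degree v :=
  one_lt_pow₀ (by exact_mod_cast Finite.one_lt_card) (degree_pos v).ne'

/-- The valuation of `k_v` has rank one; it is normalized so that a uniformizer has absolute
value `r ^ (-deg v)`, where `r` is the number of elements of `F`. -/
instance : (Valued.v : Valuation (LocalField v) (WithZero (Multiplicative ℤ))).RankOne :=
  Valuation.IsRankOneDiscrete.rankOne Valued.v (one_lt_base v)

/-- The `v`-adic absolute value on `k_v`. -/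
instance : NontriviallyNormedField (LocalField v) :=
  Valued.toNontriviallyNormedField (LocalField v) (WithZero (Multiplicative ℤ))

instance : IsUltrametricDist (LocalField v) := inferInstance

/-- A fixed algebraic closure of `k_v`. -/
abbrev AlgClosure : Type _ := AlgebraicClosure (LocalField v)

/-- The absolute value of `k_v`, extended to the algebraic closure. -/
instance : NontriviallyNormedField (AlgClosure v) :=
  spectralNorm.nontriviallyNormedField (LocalField v) (AlgClosure v)

instance : NormedAlgebra (LocalField v) (AlgClosure v) :=
  spectralNorm.normedAlgebra (LocalField v) (AlgClosure v)

/-- `C_v`: the completion of an algebraic closure of `k_v`. -/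
abbrev CompletedClosure : Type _ := UniformSpace.Completion (AlgClosure v)

instance : NontriviallyNormedField (CompletedClosure v) where
  non_trivial := by
    obtain ⟨x, hx⟩ := NontriviallyNormedField.non_trivial (α := AlgClosure v)
    exact ⟨x, by simpa using hx⟩

end Norm

/-! ### The exponent space and the `v`-adic powers -/

/-- The exponent space `S_v = ℤ/(r ^ deg v - 1) × ℤ_p`, a topological ring (the first factor is
discrete), where `r` is the number of elements of `F`. -/
abbrev Exponent {F : Type*} [Field F] (p : ℕ) [Fact p.Prime] (v : HeightOneSpectrum F[X]) : Type :=
  ZMod (Nat.card F ^ degree v - 1) × ℤ_[p]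

section Zeta

variable {F : Type*} [Field F] [Finite F] (p : ℕ) [Fact p.Prime] (v : HeightOneSpectrum F[X])

/-- `n ^ s ∈ k_v` for a polynomial `n` prime to `v` and `s ∈ S_v`: the limit of the ordinary powers
`n ^ e`, as the natural number `e` tends to `s` in `S_v`. The limit exists for `n` prime to `v`, as
the natural numbers are dense in `S_v` and `n ^ (r ^ deg v - 1)` is a `1`-unit in characteristic
`p`. -/
def vadicPow (n : F[X]) (s : Exponent p v) : LocalField v :=
  limUnder (comap (fun e : ℕ => (e : Exponent p v)) (𝓝 s))
    (fun e => (algebraMap F[X] (LocalField v) n) ^ e)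

theorem finite_monic_natDegree_eq (d : ℕ) :
    {n : F[X] | n.Monic ∧ n.natDegree = d ∧ n ∉ v.asIdeal}.Finite := by
  refine Set.Finite.subset (Set.Finite.of_injOn (f := fun n : F[X] => fun i : Fin (d + 1) =>
    n.coeff i) (t := Set.univ) (s := {n : F[X] | n.natDegree ≤ d}) (fun _ _ => Set.mem_univ _)
    ?_ Set.finite_univ) (fun n hn => hn.2.1.le)
  intro a ha b hb hab
  ext i
  by_cases hi : i < d + 1
  · exact congrFun hab ⟨i, hi⟩
  · rw [coeff_eq_zero_of_natDegree_lt, coeff_eq_zero_of_natDegree_lt]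
    · exact lt_of_le_of_lt hb (by omega)
    · exact lt_of_le_of_lt ha (by omega)

/-- The coefficient of `x ^ (-d)` in the `v`-adic zeta function: the sum of `n ^ (-s)` over the
monic polynomials `n` of degree `d` that are prime to `v`. -/
def zetaCoeff (s : Exponent p v) (d : ℕ) : LocalField v :=
  ∑ n ∈ (finite_monic_natDegree_eq v d).toFinset, vadicPow p v n (-s)

/-- The `d`-th term of the series defining the `v`-adic zeta function at `(x, s)`. -/
def zetaTerm (x : CompletedClosure v) (s : Exponent p v) (d : ℕ) : CompletedClosure v :=
  x⁻¹ ^ d * algebraMap (LocalField v) (CompletedClosure v) (zetaCoeff p v s d)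

/-- The `v`-adic zeta function of `F[T]` on `C_v^* × S_v`. -/
def zeta (x : CompletedClosure v) (s : Exponent p v) : CompletedClosure v :=
  ∑' d : ℕ, zetaTerm p v x s d

end Zeta

end GossZeta

end

/-!
Let `v = (X - α)` and `t = X - α`, let `F` have `q = p ^ f` elements, and let `z d` be the
coefficient of `x ^ (-d)` in the zeta function at `j`. Everything follows from the estimate

  `‖z 0‖ = ‖z 1‖ = 1` and `‖z (d + 2)‖ ≤ ‖t‖ * ‖z (d + 1)‖ ^ 2`,

which is `isQuadDecreasing_zetaCoeff`. It makes the power series in `X = 1 / x` entire and the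
norms of its terms strictly log-concave on every circle. So on a circle containing a zero exactly
two terms, consecutive ones with indices `n` and `n + 1`, have maximal norm
(`IsQuadDecreasing.exists_isCritical`), and all zeros on the circle are close to
`a = -z n / z (n + 1)`, an element of `k_v`. Near `a` the divided difference of the series has
constant nonzero norm (`IsCritical.norm_dividedDifference`). Hence there is at most one zero on
the circle, it is simple, and Newton's iteration with constant slope, started at `a`, stays in the
complete field `k_v` and converges to the zero (`IsQuadDecreasing.mem_range_of_zero`).

The estimate is a closed condition, so it may be checked for `z d` replaced by the sum of the
`n ^ e` over the monic `n` of degree `d` prime to `v`, where `e` is a natural number divisible by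
`q - 1` that approximates `-j`. As `c ^ e = 1` for the constants `c ≠ 0`, this sum is
`W d - W (d - 1)`, where `W d` is the sum of the powers `(1 + t w) ^ e` over all `w` of degree
less than `d` (`sum_pow_monic`), and it remains to see that the order of `W (d + 1)` at `t = 0` is
more than twice that of `W d` (`unitPowerSum_order`).

Expand `W d` by the binomial theorem, and sum over the coefficients of `w` one after the other. By
Lucas's theorem, the terms correspond to the digit chains of length `d` below `e`: the sequences
`0 < N₁ < ⋯ < N_d` of multiples of `q - 1` such that the base `p` digits of each member are
bounded by those of the next, and those of `N_d` by those of `e`. Such a term has the order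
`N₁ + ⋯ + N_d`, its cost. Two facts about chains finish the argument. A cheapest chain ends in the
least number that ends any chain of its length (`IsDigitChain.top_le`); this makes the cheapest
chain unique, so that its term does not cancel. And the last member of a chain exceeds the cost of
some chain of length one less (`IsDigitChain.exists_lt`).

Both facts are proved by encoding a multiple `N` of `q - 1` as an integral vector `l` indexed by
the places modulo `f`, with `p * l (j + 1) - l j` equal to the sum of the digits of `N` at the
places in the class `j`. Digit chains become chains of vectors which increase strictly in all
coordinates, and the value of the cheapest number with a given vector is a submodular function
`cost` of the vector. The nesting of the digits may be forgotten: a chain of least cost, and among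
these with the least sum of squares of digit counts, is automatically nested
(`IsStrictChain.exists_nested`). For the first fact let `h` be the cheapest vector with all
coordinates at least `d`. A chain ending in another vector can be truncated by shifts of `h` so
that it ends in `h`, and this makes it cheaper (`IsStrictChain.exists_cheaper`): the gain in the
last member outweighs the losses in all others, because lowering a vector by `s` divides its cost
by `q ^ s` at least (`IsPool.pow_mul_partialCost_le`).
-/

noncomputable section

namespace GossZeta

/-! ### Convex functions of an integer and cyclic exchange -/

/-- The increments over a step of length `n` of a convex function of an integer increase. Convexity
is expressed by the monotonicity of the increments over steps of length one. -/
theorem convex_increment {e : ℤ → ℤ} (he : Monotone fun m => e (m + 1) - e m) (n : ℕ) {m m' : ℤ}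
    (h : m ≤ m') : e (m + n) - e m ≤ e (m' + n) - e m' := by
  induction n with
  | zero => simp
  | succ n ih =>
    have h2 := he (show m + n ≤ m' + n by omega)
    simp only at h2
    push_cast
    rw [← add_assoc, ← add_assoc]
    linarith

/-- Moving two arguments of a convex function towards each other does not increase the sum of the
values. -/
theorem convex_exchange {e : ℤ → ℤ} (he : Monotone fun m => e (m + 1) - e m) {s m m' : ℤ}
    (h0 : 0 ≤ s) (h : s ≤ m' - m) : e (m + s) + e (m' - s) ≤ e m + e m' := by
  lift s to ℕ using h0
  have := convex_increment he s (show m ≤ m' - s by omega)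
  rw [sub_add_cancel] at this
  linarith

theorem convex_submodular {e : ℤ → ℤ} (he : Monotone fun m => e (m + 1) - e m) {p : ℤ} (hp : 0 ≤ p)
    (x z x' z' : ℤ) :
    e (p * min x x' - min z z') + e (p * max x x' - max z z') ≤ e (p * x - z) + e (p * x' - z') := by
  rcases le_total x x' with hx | hx <;> rcases le_total z z' with hz | hz <;>
    simp only [min_eq_left, min_eq_right, max_eq_left, max_eq_right, hx, hz]
  · exact le_rfl
  · have := convex_exchange he (s := z - z') (m := p * x - z) (m' := p * x' - z') (by omega)
      (by nlinarith)
    convert this using 3 <;> ring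
  · have := convex_exchange he (s := z' - z) (m := p * x' - z') (m' := p * x - z) (by omega) (by nlinarith)
    have h1 : p * x' - z' + (z' - z) = p * x' - z := by ring
    have h2 : p * x - z - (z' - z) = p * x - z' := by ring
    rw [h1, h2] at this
    linarith
  · linarith

section Cyclic

variable {f : ℕ}

/-- The digit count in the class `j` belonging to the vector of carries `l`. A multiple `N` of
`p ^ f - 1` whose base `p` digits at the places congruent to `j` modulo `f` add up to `c j` determines
a vector `l` with `p * l (j + 1) - l j = c j` for all `j`. -/
def mult (p : ℕ) (l : ZMod f → ℤ) (j : ZMod f) : ℤ := p * l (j + 1) - l j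

theorem mult_add (p : ℕ) (l l' : ZMod f → ℤ) (j : ZMod f) :
    mult p (l + l') j = mult p l j + mult p l' j := by
  simp only [mult, Pi.add_apply]; ring

theorem mult_sub (p : ℕ) (l l' : ZMod f → ℤ) (j : ZMod f) :
    mult p (l - l') j = mult p l j - mult p l' j := by
  simp only [mult, Pi.sub_apply]; ring

variable [NeZero f]

theorem zmod_val_sub_eq {i j : ZMod f} (h : i ≠ j) : (i - j).val = (i - (j + 1)).val + 1 := by
  have h0 : (i - j).val ≠ 0 := by
    intro h'
    exact h (sub_eq_zero.1 ((ZMod.val_eq_zero _).1 h'))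
  have hf : 1 < f := by
    have := ZMod.val_lt (i - j)
    omega
  have : Fact (1 < f) := ⟨hf⟩
  have h1 : i - (j + 1) = i - j - 1 := by ring
  rw [h1, ZMod.val_sub (a := i - j) (by rw [ZMod.val_one]; omega), ZMod.val_one]
  omega

/-- Induction backwards around the cycle `ZMod f`, starting from `j`. -/
theorem zmod_cycle_induction {P : ZMod f → Prop} (j : ZMod f) (h0 : P j)
    (hs : ∀ i, i ≠ j → P (i + 1) → P i) (i : ZMod f) : P i := by
  have key : ∀ t : ℕ, ∀ i : ZMod f, (j - i).val = t → P i := by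
    intro t
    induction t with
    | zero =>
      intro i hi
      have : j - i = 0 := (ZMod.val_eq_zero _).1 hi
      rwa [← sub_eq_zero.1 this]
    | succ t ih =>
      intro i hi
      have hij : i ≠ j := by
        rintro rfl
        simp at hi
      refine hs i hij (ih _ ?_)
      have := zmod_val_sub_eq (Ne.symm hij)
      omega
  exact key _ i rfl

/-- A nonnegative vector `D` that drops from `j` to `j + 1` by a factor of at least `p` dominates a
vector `δ` which takes one digit away from the class `j` and, in the other classes, adds at most the
digits that `D` adds. -/
theorem exists_cyclic_exchange {p : ℕ} (hp : 2 ≤ p) {D : ZMod f → ℤ} (hD : ∀ i, 0 ≤ D i)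
    {j : ZMod f} (hj : 1 ≤ D j) (hj' : p * D (j + 1) ≤ D j) :
    ∃ δ : ZMod f → ℤ, (∀ i, 0 ≤ δ i) ∧ δ j = 1 ∧ δ (j + 1) = 0 ∧ (∀ i, D j * δ i ≤ D i) ∧
      ∀ i, i ≠ j → 0 ≤ mult p δ i ∧ mult p δ i ≤ max (mult p D i) 0 := by
  -- going backwards from `j`, the value of `δ` is as small as the bounds on the digits allow
  let g : ℕ → ℤ := fun t => Nat.rec 1 (fun t x => max 0 (p * x - max (mult p D (j - (t + 1 : ℕ))) 0)) t
  have hg : ∀ t, g (t + 1) = max 0 (p * g t - max (mult p D (j - (t + 1 : ℕ))) 0) := fun t => rfl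
  let δ : ZMod f → ℤ := fun i => g (j - i).val
  have hδj : δ j = 1 := by simp [δ, g]
  have hδ : ∀ i, i ≠ j → δ i = max 0 (p * δ (i + 1) - max (mult p D i) 0) := by
    intro i hi
    have h2 := zmod_val_sub_eq (Ne.symm hi)
    show g (j - i).val = _
    rw [h2, hg]
    have h3 : j - (((j - (i + 1)).val + 1 : ℕ) : ZMod f) = i := by
      rw [← h2, ZMod.natCast_zmod_val]; ring
    rw [h3]
  have hpos : ∀ i, 0 ≤ δ i := by
    intro i
    by_cases hi : i = j
    · rw [hi, hδj]; norm_num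
    · rw [hδ i hi]; exact le_max_left _ _
  have hle : ∀ i, D j * δ i ≤ D i := by
    refine fun i => zmod_cycle_induction (P := fun i => D j * δ i ≤ D i) j ?_ ?_ i
    · rw [hδj]; simp
    · intro i hi ih
      rw [hδ i hi]
      rcases le_total (p * δ (i + 1) - max (mult p D i) 0) 0 with h | h
      · rw [max_eq_left h]; simpa using hD i
      · rw [max_eq_right h]
        have h1 : mult p D i ≤ max (mult p D i) 0 := le_max_left _ _
        have h2 : 0 ≤ max (mult p D i) 0 := le_max_right _ _
        set c := max (mult p D i) 0
        have h3 : mult p D i = p * D (i + 1) - D i := rfl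
        have h4 : (p : ℤ) * (D j * δ (i + 1)) ≤ p * D (i + 1) := by gcongr
        nlinarith
  refine ⟨δ, hpos, hδj, ?_, hle, ?_⟩
  · have h1 := hle (j + 1)
    have h2 := hpos (j + 1)
    refine le_antisymm (not_lt.1 fun h3 => ?_) h2
    have h4 : 1 ≤ δ (j + 1) := h3
    have h5 : (2 : ℤ) ≤ p := by exact_mod_cast hp
    have h6 : D j ≤ D (j + 1) := by nlinarith
    nlinarith [mul_le_mul_of_nonneg_right h5 (hD (j + 1))]
  · intro i hi
    have h1 := hpos (i + 1)
    have h2 : (0 : ℤ) ≤ p * δ (i + 1) := by positivity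
    have h3 : 0 ≤ max (mult p D i) 0 := le_max_right _ _
    have := hδ i hi
    simp only [mult] at *
    omega

end Cyclic

/-! ### Pools of powers and chains of vectors of carries -/

section Chains

variable {f p : ℕ}

/-- A pool of powers of `p`, sorted into residue classes of exponents modulo `f`: `ε j r` is the
exponent of the `r`-th smallest power in the class `j`. The last condition says that no power is
repeated more than `p - 1` times. -/
structure IsPool (p : ℕ) (ε : ZMod f → ℕ → ℕ) : Prop where
  mono : ∀ j, Monotone (ε j)
  cls : ∀ j r, ((ε j r : ℕ) : ZMod f) = j
  jump : ∀ j r, ε j r < ε j (r + (p - 1))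

/-- The sum of the `m` smallest powers of `p` in the class `j` of the pool (`0` for `m ≤ 0`). -/
def partialCost (p : ℕ) (ε : ZMod f → ℕ → ℕ) (j : ZMod f) (m : ℤ) : ℤ :=
  ∑ r ∈ Finset.range m.toNat, (p : ℤ) ^ ε j r

theorem partialCost_nonneg (ε : ZMod f → ℕ → ℕ) (j : ZMod f) (m : ℤ) :
    0 ≤ partialCost p ε j m := Finset.sum_nonneg fun _ _ => by positivity

theorem partialCost_mono (ε : ZMod f → ℕ → ℕ) (j : ZMod f) : Monotone (partialCost p ε j) := by
  intro m m' h
  refine Finset.sum_le_sum_of_subset_of_nonneg ?_ fun _ _ _ => by positivity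
  exact Finset.range_mono (Int.toNat_le_toNat h)

theorem partialCost_of_nonpos (ε : ZMod f → ℕ → ℕ) (j : ZMod f) {m : ℤ} (h : m ≤ 0) :
    partialCost p ε j m = 0 := by
  simp [partialCost, Int.toNat_of_nonpos h]

theorem partialCost_succ (ε : ZMod f → ℕ → ℕ) (j : ZMod f) {m : ℤ} (h : 0 ≤ m) :
    partialCost p ε j (m + 1) = partialCost p ε j m + (p : ℤ) ^ ε j m.toNat := by
  have : (m + 1).toNat = m.toNat + 1 := by omega
  rw [partialCost, partialCost, this, Finset.sum_range_succ]

theorem partialCost_convex (hp : 2 ≤ p) {ε : ZMod f → ℕ → ℕ} (hε : IsPool p ε) (j : ZMod f) :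
    Monotone fun m => partialCost p ε j (m + 1) - partialCost p ε j m := by
  intro m m' h
  simp only
  rcases lt_or_ge m 0 with h0 | h0
  · rw [partialCost_of_nonpos ε j (show m + 1 ≤ 0 by omega), partialCost_of_nonpos ε j h0.le,
      sub_self]
    exact sub_nonneg.2 (partialCost_mono ε j (by omega))
  · rw [partialCost_succ ε j h0, partialCost_succ ε j (h0.trans h), add_sub_cancel_left,
      add_sub_cancel_left]
    exact pow_le_pow_right₀ (by exact_mod_cast (by omega : 1 ≤ p))
      (hε.mono j (Int.toNat_le_toNat h))

/-- `r 0, …, r (d - 1)` is a strictly increasing chain of positive vectors, for the strict order in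
which all coordinates increase. -/
def IsStrictChain (d : ℕ) (r : ℕ → ZMod f → ℤ) : Prop :=
  (∀ i, 1 ≤ r 0 i) ∧ ∀ a, a + 1 < d → ∀ i, r a i + 1 ≤ r (a + 1) i

/-- A strict chain along which the digit counts are nonnegative and weakly increasing. -/
def IsNestedChain (p d : ℕ) (r : ℕ → ZMod f → ℤ) : Prop :=
  IsStrictChain d r ∧ (0 < d → ∀ j, 0 ≤ mult p (r 0) j) ∧
    ∀ a, a + 1 < d → ∀ j, mult p (r a) j ≤ mult p (r (a + 1)) j

theorem IsStrictChain.le {d : ℕ} {r : ℕ → ZMod f → ℤ} (h : IsStrictChain d r) :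
    ∀ a, a < d → ∀ i, (a : ℤ) + 1 ≤ r a i := by
  intro a
  induction a with
  | zero => intro _ i; simpa using h.1 i
  | succ a ih =>
    intro ha i
    have h1 := ih (by omega) i
    have h2 := h.2 a ha i
    push_cast
    omega

theorem IsStrictChain.add_le {d : ℕ} {r : ℕ → ZMod f → ℤ} (h : IsStrictChain d r) (a b : ℕ)
    (hb : a + b < d) (i : ZMod f) : r a i + b ≤ r (a + b) i := by
  induction b with
  | zero => simp
  | succ b ih =>
    have h1 := ih (by omega)
    have h2 := h.2 (a + b) (by omega) i
    rw [← add_assoc]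
    push_cast
    omega

theorem sum_range_update_two (F : (ZMod f → ℤ) → ℤ) {d a : ℕ} (ha : a + 1 < d)
    (r : ℕ → ZMod f → ℤ) (x y : ZMod f → ℤ) :
    ∑ b ∈ Finset.range d, F (Function.update (Function.update r a x) (a + 1) y b) =
      ∑ b ∈ Finset.range d, F (r b) + (F x + F y - (F (r a) + F (r (a + 1)))) := by
  rw [← sub_eq_iff_eq_add', ← Finset.sum_sub_distrib,
    ← Finset.sum_subset (s₁ := {a, a + 1}) (s₂ := Finset.range d)]
  · rw [Finset.sum_pair (by omega)]
    simp
    ring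
  · intro b hb
    simp only [Finset.mem_insert, Finset.mem_singleton] at hb
    simp only [Finset.mem_range]
    omega
  · intro b _ hb
    simp only [Finset.mem_insert, Finset.mem_singleton, not_or] at hb
    simp [Function.update_of_ne hb.1, Function.update_of_ne hb.2]

theorem sum_range_update_one (F : (ZMod f → ℤ) → ℤ) {d a : ℕ} (ha : a < d)
    (r : ℕ → ZMod f → ℤ) (x : ZMod f → ℤ) :
    ∑ b ∈ Finset.range d, F (Function.update r a x b) =
      ∑ b ∈ Finset.range d, F (r b) + (F x - F (r a)) := by
  rw [← sub_eq_iff_eq_add', ← Finset.sum_sub_distrib, Finset.sum_eq_single a]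
  · simp
  · intro b _ hb
    simp [Function.update_of_ne hb]
  · intro h
    simp [ha] at h

variable [NeZero f]

/-- The value of the cheapest selection from the pool having the vector of carries `l`. -/
def cost (p : ℕ) (ε : ZMod f → ℕ → ℕ) (l : ZMod f → ℤ) : ℤ :=
  ∑ j, partialCost p ε j (mult p l j)

theorem cost_nonneg (ε : ZMod f → ℕ → ℕ) (l : ZMod f → ℤ) : 0 ≤ cost p ε l :=
  Finset.sum_nonneg fun _ _ => partialCost_nonneg ε _ _

/-- The cost is a submodular function of the vector of carries. -/
theorem cost_inf_add_cost_sup_le (hp : 2 ≤ p) {ε : ZMod f → ℕ → ℕ} (hε : IsPool p ε)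
    (l l' : ZMod f → ℤ) : cost p ε (l ⊓ l') + cost p ε (l ⊔ l') ≤ cost p ε l + cost p ε l' := by
  rw [cost, cost, cost, cost, ← Finset.sum_add_distrib, ← Finset.sum_add_distrib]
  refine Finset.sum_le_sum fun j _ => ?_
  exact convex_submodular (partialCost_convex hp hε j) (by positivity) _ _ _ _

/-- The total cost of the first `d` vectors of a chain. -/
def chainCost (p : ℕ) (ε : ZMod f → ℕ → ℕ) (d : ℕ) (r : ℕ → ZMod f → ℤ) : ℤ :=
  ∑ a ∈ Finset.range d, cost p ε (r a)

/-- The sum of the squares of all digit counts in a chain. -/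
def chainSq (p d : ℕ) (r : ℕ → ZMod f → ℤ) : ℤ :=
  ∑ a ∈ Finset.range d, ∑ j, mult p (r a) j ^ 2

/-- The exchange step for two consecutive vectors of a strict chain whose digit counts are not
nested. It increases neither the cost nor the sum of squares; if the latter does not drop, the new
chain has a violation of size at least two. -/
theorem IsStrictChain.exchange (hp : 2 ≤ p) {ε : ZMod f → ℕ → ℕ} (hε : IsPool p ε) {d : ℕ}
    {r : ℕ → ZMod f → ℤ} (h : IsStrictChain d r) {a : ℕ} (ha : a + 1 < d) {j : ZMod f}
    (hj : mult p (r (a + 1)) j < mult p (r a) j) :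
    ∃ r', IsStrictChain d r' ∧ chainCost p ε d r' ≤ chainCost p ε d r ∧
      chainSq p d r' ≤ chainSq p d r ∧
      (mult p (r (a + 1)) j + 2 ≤ mult p (r a) j → chainSq p d r' < chainSq p d r) ∧
      (chainSq p d r' = chainSq p d r →
        ∃ t, mult p (r' (a + 1)) t + 2 ≤ mult p (r' a) t) := by
  set D : ZMod f → ℤ := r (a + 1) - r a with hDdef
  have hp' : (2 : ℤ) ≤ p := by exact_mod_cast hp
  have hc : ∀ i, mult p D i = mult p (r (a + 1)) i - mult p (r a) i := fun i => mult_sub p _ _ i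
  have hD1 : ∀ i, 1 ≤ D i := fun i => by
    have := h.2 a ha i
    simp only [hDdef, Pi.sub_apply]; omega
  have hDj : mult p D j < 0 := by rw [hc]; omega
  have hDj' : p * D (j + 1) < D j := by simp only [mult] at hDj; omega
  have hD3 : 3 ≤ D j := by nlinarith [hD1 (j + 1)]
  obtain ⟨δ, hδ0, hδj, hδj', hδD, hδ⟩ :=
    exists_cyclic_exchange hp (fun i => by linarith [hD1 i]) (hD1 j) hDj'.le
  have hsj : mult p δ j = -1 := by simp [mult, hδj, hδj']
  have h2δ : ∀ i, 2 * δ i + 1 ≤ D i := by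
    intro i
    rcases (hδ0 i).eq_or_lt with h0 | h0
    · rw [← h0]; simpa using hD1 i
    · nlinarith [hδD i]
  let r' : ℕ → ZMod f → ℤ := Function.update (Function.update r a (r a + δ)) (a + 1) (r (a + 1) - δ)
  have hr'a : r' a = r a + δ := by simp [r']
  have hr'a1 : r' (a + 1) = r (a + 1) - δ := by simp [r']
  have hr' : ∀ b, b ≠ a → b ≠ a + 1 → r' b = r b := fun b h1 h2 => by
    simp [r', Function.update_of_ne h1, Function.update_of_ne h2]
  -- the shift in each class is between zero and the difference of the two counts
  have hs : ∀ i, i ≠ j → 0 ≤ mult p δ i ∧ (mult p δ i ≤ mult p D i ∨ mult p δ i = 0) := by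
    intro i hi
    obtain ⟨h1, h2⟩ := hδ i hi
    refine ⟨h1, ?_⟩
    rcases le_total (mult p D i) 0 with h3 | h3
    · rw [max_eq_right h3] at h2
      exact Or.inr (le_antisymm h2 h1)
    · rw [max_eq_left h3] at h2
      exact Or.inl h2
  have hcost : chainCost p ε d r' ≤ chainCost p ε d r := by
    have : chainCost p ε d r' = _ := sum_range_update_two (cost p ε) ha r _ _
    rw [this, chainCost]
    have : cost p ε (r a + δ) + cost p ε (r (a + 1) - δ) ≤
        cost p ε (r a) + cost p ε (r (a + 1)) := by
      rw [cost, cost, cost, cost, ← Finset.sum_add_distrib, ← Finset.sum_add_distrib]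
      refine Finset.sum_le_sum fun i _ => ?_
      rw [mult_add, mult_sub]
      by_cases hi : i = j
      · subst hi
        have := convex_exchange (partialCost_convex hp hε i) (s := 1) (m := mult p (r (a + 1)) i)
          (m' := mult p (r a) i) (by norm_num) (by omega)
        rw [hsj, sub_neg_eq_add, ← sub_eq_add_neg]
        linarith
      · obtain ⟨h1, h2⟩ := hs i hi
        rcases h2 with h2 | h2
        · exact convex_exchange (partialCost_convex hp hε i) h1 (by rw [← hc]; exact h2)
        · rw [h2]; simp
    linarith
  -- the change of the sum of squares
  have hsq : chainSq p d r' =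
      chainSq p d r - 2 * ∑ i, mult p δ i * (mult p D i - mult p δ i) := by
    have : chainSq p d r' = _ :=
      sum_range_update_two (fun l => ∑ i, mult p l i ^ 2) ha r (r a + δ) (r (a + 1) - δ)
    rw [this, chainSq, Finset.mul_sum, sub_eq_add_neg (∑ a ∈ Finset.range d, _),
      ← Finset.sum_neg_distrib, ← Finset.sum_add_distrib, ← Finset.sum_add_distrib,
      ← Finset.sum_sub_distrib]
    congr 1
    refine Finset.sum_congr rfl fun i _ => ?_
    rw [mult_add, mult_sub, hc]
    ring
  have hterm : ∀ i, 0 ≤ mult p δ i * (mult p D i - mult p δ i) := by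
    intro i
    by_cases hi : i = j
    · subst hi
      rw [hsj]; nlinarith
    · obtain ⟨h1, h2⟩ := hs i hi
      rcases h2 with h2 | h2
      · exact mul_nonneg h1 (by linarith)
      · rw [h2]; simp
  have hsum := Finset.sum_nonneg fun i (_ : i ∈ Finset.univ) => hterm i
  refine ⟨r', ⟨?_, ?_⟩, hcost, by rw [hsq]; linarith, ?_, ?_⟩
  · intro i
    rcases Nat.eq_zero_or_pos a with h0 | h0
    · subst h0
      rw [hr'a, Pi.add_apply]
      linarith [h.1 i, hδ0 i]
    · rw [hr' 0 (by omega) (by omega)]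
      exact h.1 i
  · intro b hb i
    by_cases h1 : b = a
    · subst h1
      rw [hr'a, hr'a1, Pi.add_apply, Pi.sub_apply]
      have := h2δ i
      simp only [hDdef, Pi.sub_apply] at this
      omega
    by_cases h2 : b = a + 1
    · subst h2
      rw [hr'a1, hr' _ (by omega) (by omega), Pi.sub_apply]
      have := h.2 _ hb i
      linarith [hδ0 i]
    by_cases h3 : b + 1 = a
    · subst h3
      rw [hr'a, hr' _ (by omega) (by omega), Pi.add_apply]
      have := h.2 _ hb i
      linarith [hδ0 i]
    · rw [hr' _ h1 h2, hr' _ h3 (by omega)]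
      exact h.2 _ hb i
  · intro h2
    have : 0 < ∑ i, mult p δ i * (mult p D i - mult p δ i) := by
      refine Finset.sum_pos' (fun i _ => hterm i) ⟨j, Finset.mem_univ _, ?_⟩
      rw [hsj, hc]; linarith
    rw [hsq]; linarith
  · intro h2
    have h0 : ∑ i, mult p δ i * (mult p D i - mult p δ i) = 0 := by rw [hsq] at h2; linarith
    have h0' := (Finset.sum_eq_zero_iff_of_nonneg fun i _ => hterm i).1 h0
    -- the class where `δ` drops to zero
    obtain ⟨t, ht, ht1, ht0⟩ : ∃ t, t ≠ j ∧ 0 < δ (t + 1) ∧ δ t = 0 := by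
      by_contra hcon
      push Not at hcon
      have := zmod_cycle_induction (P := fun i => 0 < δ i) j (by rw [hδj]; norm_num)
        (fun i hi h1 => (hδ0 i).lt_of_ne (hcon i hi h1).symm) (j + 1)
      rw [hδj'] at this
      exact lt_irrefl _ this
    have hst : 2 ≤ mult p δ t := by
      simp only [mult, ht0]
      nlinarith
    have hct : mult p D t = mult p δ t := by
      rcases mul_eq_zero.1 (h0' t (Finset.mem_univ _)) with h | h
      · omega
      · omega
    refine ⟨t, ?_⟩
    rw [hr'a, hr'a1, mult_add, mult_sub]
    rw [hc] at hct
    omega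

/-- The exchange step that makes the digit counts of the first vector of a chain nonnegative. -/
theorem IsStrictChain.exchange_zero (hp : 2 ≤ p) (ε : ZMod f → ℕ → ℕ) {d : ℕ}
    {r : ℕ → ZMod f → ℤ} (h : IsStrictChain d r) (hd : 0 < d) {j : ZMod f}
    (hj : mult p (r 0) j < 0) :
    ∃ r', IsStrictChain d r' ∧ chainCost p ε d r' ≤ chainCost p ε d r ∧
      chainSq p d r' < chainSq p d r := by
  have hp' : (2 : ℤ) ≤ p := by exact_mod_cast hp
  have hDj' : p * r 0 (j + 1) < r 0 j := by simp only [mult] at hj; omega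
  have hD3 : 2 ≤ r 0 j := by nlinarith [h.1 (j + 1)]
  obtain ⟨δ, hδ0, hδj, hδj', hδD, hδ⟩ :=
    exists_cyclic_exchange hp (fun i => by linarith [h.1 i]) (h.1 j) hDj'.le
  have hsj : mult p δ j = -1 := by simp [mult, hδj, hδj']
  have h2δ : ∀ i, δ i + 1 ≤ r 0 i := by
    intro i
    rcases (hδ0 i).eq_or_lt with h0 | h0
    · rw [← h0]; simpa using h.1 i
    · nlinarith [hδD i]
  let r' : ℕ → ZMod f → ℤ := Function.update r 0 (r 0 - δ)
  have hr'0 : r' 0 = r 0 - δ := by simp [r']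
  have hr' : ∀ b, b ≠ 0 → r' b = r b := fun b h1 => by simp [r', Function.update_of_ne h1]
  refine ⟨r', ⟨?_, ?_⟩, ?_, ?_⟩
  · intro i
    rw [hr'0, Pi.sub_apply]
    linarith [h2δ i]
  · intro b hb i
    rw [hr' (b + 1) (by omega)]
    have := h.2 b hb i
    by_cases hb0 : b = 0
    · subst hb0
      rw [hr'0, Pi.sub_apply]
      linarith [hδ0 i]
    · rwa [hr' b hb0]
  · have h1 : chainCost p ε d r' = _ := sum_range_update_one (cost p ε) hd r _
    have h2 : cost p ε (r 0 - δ) ≤ cost p ε (r 0) := by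
      refine Finset.sum_le_sum fun i _ => ?_
      rw [mult_sub]
      by_cases hi : i = j
      · subst hi
        rw [partialCost_of_nonpos ε i (by omega)]
        exact partialCost_nonneg _ _ _
      · exact partialCost_mono ε i (by linarith [(hδ i hi).1])
    rw [h1, chainCost]; linarith
  · have h1 : chainSq p d r' = _ := sum_range_update_one (fun l => ∑ i, mult p l i ^ 2) hd r (r 0 - δ)
    have h2 : ∑ i, mult p (r 0 - δ) i ^ 2 < ∑ i, mult p (r 0) i ^ 2 := by
      refine Finset.sum_lt_sum (fun i _ => ?_) ⟨j, Finset.mem_univ _, ?_⟩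
      · rw [mult_sub]
        by_cases hi : i = j
        · subst hi
          rw [hsj]; nlinarith
        · obtain ⟨h3, h4⟩ := hδ i hi
          rcases le_total (mult p (r 0) i) 0 with h5 | h5
          · rw [max_eq_right h5] at h4
            rw [le_antisymm h4 h3, sub_zero]
          · rw [max_eq_left h5] at h4
            nlinarith
      · rw [mult_sub, hsj]; nlinarith
    rw [h1, chainSq]; linarith

theorem chainCost_nonneg (ε : ZMod f → ℕ → ℕ) (d : ℕ) (r : ℕ → ZMod f → ℤ) :
    0 ≤ chainCost p ε d r := Finset.sum_nonneg fun _ _ => cost_nonneg ε _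

theorem chainSq_nonneg (d : ℕ) (r : ℕ → ZMod f → ℤ) : 0 ≤ chainSq p d r :=
  Finset.sum_nonneg fun _ _ => Finset.sum_nonneg fun _ _ => sq_nonneg _

/-- Every strict chain may be replaced by a nested one without increasing the cost: among the
chains of least cost, one with the least sum of squares is nested. -/
theorem IsStrictChain.exists_nested (hp : 2 ≤ p) {ε : ZMod f → ℕ → ℕ} (hε : IsPool p ε) {d : ℕ}
    {r : ℕ → ZMod f → ℤ} (h : IsStrictChain d r) :
    ∃ r', IsNestedChain p d r' ∧ chainCost p ε d r' ≤ chainCost p ε d r := by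
  obtain ⟨r₁, hr₁, hmin⟩ := WellFounded.has_min
    (InvImage.wf (fun r : ℕ → ZMod f → ℤ => toLex ((chainCost p ε d r).toNat, (chainSq p d r).toNat))
      (wellFounded_lt (α := ℕ ×ₗ ℕ)))
    {r' | IsStrictChain d r' ∧ chainCost p ε d r' ≤ chainCost p ε d r} ⟨r, h, le_rfl⟩
  have hmin' : ∀ r', IsStrictChain d r' → chainCost p ε d r' ≤ chainCost p ε d r₁ →
      chainSq p d r₁ ≤ chainSq p d r' := by
    intro r' h' hc
    by_contra hlt
    push Not at hlt
    refine hmin r' ⟨h', hc.trans hr₁.2⟩ ?_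
    have h1 := chainSq_nonneg (p := p) d r'
    have h2 := chainCost_nonneg (p := p) ε d r'
    show toLex _ < toLex _
    rw [Prod.Lex.toLex_lt_toLex]
    simp only
    omega
  refine ⟨r₁, ⟨hr₁.1, ?_, ?_⟩, hr₁.2⟩
  · intro hd j
    by_contra hj
    push Not at hj
    obtain ⟨r', h1, h2, h3⟩ := hr₁.1.exchange_zero hp ε hd hj
    exact absurd (hmin' r' h1 h2) (not_le.2 h3)
  · intro a ha j
    by_contra hj
    push Not at hj
    obtain ⟨r', h1, h2, h3, -, h4⟩ := hr₁.1.exchange hp hε ha hj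
    obtain ⟨t, ht⟩ := h4 (le_antisymm h3 (hmin' r' h1 h2))
    obtain ⟨r'', h1', h2', h3', h4', -⟩ := h1.exchange hp hε ha (j := t) (by omega)
    exact absurd (hmin' r'' h1' (h2'.trans h2)) (not_le.2 ((h4' ht).trans_le h3))

end Chains

/-! ### Comparison of selections from a pool -/

section Elements

variable {f p : ℕ}

theorem IsPool.add_le {ε : ZMod f → ℕ → ℕ} (hε : IsPool p ε) (j : ZMod f) (r : ℕ) :
    ε j r + f ≤ ε j (r + (p - 1)) := by
  have h1 := hε.jump j r
  have h2 : ((ε j (r + (p - 1)) : ℕ) : ZMod f) = (ε j r : ℕ) := by rw [hε.cls, hε.cls]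
  have h3 := (ZMod.natCast_eq_natCast_iff _ _ _).1 h2
  have h4 : f ∣ ε j (r + (p - 1)) - ε j r := (Nat.modEq_iff_dvd' h1.le).1 h3.symm
  have := Nat.le_of_dvd (by omega) h4
  omega

/-- Dropping `s (p - 1)` powers from the top of a class divides the cost by at least `q ^ s`. -/
theorem IsPool.pow_mul_partialCost_le (hp : 2 ≤ p) {ε : ZMod f → ℕ → ℕ} (hε : IsPool p ε)
    (j : ZMod f) (s : ℕ) (m : ℤ) :
    ((p : ℤ) ^ f) ^ s * partialCost p ε j (m - s * (p - 1)) ≤ partialCost p ε j m := by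
  induction s generalizing m with
  | zero => simp
  | succ s ih =>
    have step : (p : ℤ) ^ f * partialCost p ε j (m - (p - 1)) ≤ partialCost p ε j m := by
      rcases le_or_gt (m - (p - 1)) 0 with h | h
      · rw [partialCost_of_nonpos ε j h, mul_zero]
        exact partialCost_nonneg _ _ _
      · obtain ⟨n, hn⟩ : ∃ n : ℕ, (m - (p - 1)) = n := ⟨(m - (p - 1)).toNat, by omega⟩
        have hm : m = ((n + (p - 1) : ℕ) : ℤ) := by push_cast [show 1 ≤ p by omega]; omega
        rw [hn, hm, partialCost, partialCost, Int.toNat_natCast, Int.toNat_natCast, add_comm n,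
          Finset.sum_range_add, Finset.mul_sum]
        refine le_add_of_nonneg_of_le (Finset.sum_nonneg fun _ _ => by positivity) ?_
        refine Finset.sum_le_sum fun r _ => ?_
        rw [← pow_add, add_comm (p - 1)]
        refine pow_le_pow_right₀ (by exact_mod_cast (by omega : 1 ≤ p)) ?_
        have := hε.add_le j r
        omega
    have h1 := ih (m - (p - 1))
    have h2 : m - ((s + 1 : ℕ) : ℤ) * (p - 1) = m - (p - 1) - s * (p - 1) := by push_cast; ring
    rw [h2, pow_succ', mul_assoc]
    exact (mul_le_mul_of_nonneg_left h1 (by positivity)).trans step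

/-- The sum of the powers of `p` in a finite part of the pool. -/
def weight (p : ℕ) (ε : ZMod f → ℕ → ℕ) (S : Finset (Σ _ : ZMod f, ℕ)) : ℤ :=
  ∑ x ∈ S, (p : ℤ) ^ ε x.1 x.2

theorem pow_le_weight {ε : ZMod f → ℕ → ℕ} {S : Finset (Σ _ : ZMod f, ℕ)} {x : Σ _ : ZMod f, ℕ}
    (hx : x ∈ S) : (p : ℤ) ^ ε x.1 x.2 ≤ weight p ε S :=
  Finset.single_le_sum (f := fun x : Σ _ : ZMod f, ℕ => (p : ℤ) ^ ε x.1 x.2)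
    (fun _ _ => by positivity) hx

theorem IsPool.card_filter_le {ε : ZMod f → ℕ → ℕ} (hε : IsPool p ε)
    (S : Finset (Σ _ : ZMod f, ℕ)) (e : ℕ) :
    (S.filter fun x => ε x.1 x.2 = e).card ≤ p - 1 := by
  classical
  set T := S.filter fun x => ε x.1 x.2 = e
  have hT : ∀ x ∈ T, ε x.1 x.2 = e := fun x hx => (Finset.mem_filter.1 hx).2
  have hcls : ∀ x ∈ T, x.1 = (e : ZMod f) := fun x hx => by rw [← hT x hx, hε.cls]
  rcases T.eq_empty_or_nonempty with h0 | h0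
  · simp [h0]
  obtain ⟨x₀, hx₀, hmin⟩ := T.exists_min_image (fun x => x.2) h0
  have : T.card ≤ (Finset.Ico x₀.2 (x₀.2 + (p - 1))).card := by
    refine Finset.card_le_card_of_injOn (fun x => x.2) (fun x hx => ?_) ?_
    · simp only [Finset.coe_Ico, Set.mem_Ico]
      refine ⟨hmin x hx, not_le.1 fun hle => ?_⟩
      have h1 := hε.mono x.1 hle
      have h2 := hε.jump x.1 x₀.2
      have h3 := hT x hx
      have h4 := hT x₀ hx₀
      rw [hcls x₀ hx₀] at h4
      rw [hcls x hx] at h1 h2 h3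
      omega
    · intro x hx y hy hxy
      have h1 := (hcls x hx).trans (hcls y hy).symm
      obtain ⟨x1, x2⟩ := x
      obtain ⟨y1, y2⟩ := y
      simp only at h1 hxy
      rw [h1, hxy]
  simpa using this

theorem IsPool.weight_le_sum (hp : 2 ≤ p) {ε : ZMod f → ℕ → ℕ} (hε : IsPool p ε)
    {S : Finset (Σ _ : ZMod f, ℕ)} {T : Finset ℕ} (h : ∀ x ∈ S, ε x.1 x.2 ∈ T) :
    weight p ε S ≤ ∑ e ∈ T, ((p : ℤ) - 1) * (p : ℤ) ^ e := by
  rw [weight, ← Finset.sum_fiberwise_of_maps_to h]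
  refine Finset.sum_le_sum fun e _ => ?_
  rw [Finset.sum_congr rfl fun x hx => by rw [(Finset.mem_filter.1 hx).2], Finset.sum_const,
    nsmul_eq_mul]
  have := hε.card_filter_le S e
  have h2 : ((S.filter fun x => ε x.1 x.2 = e).card : ℤ) ≤ p - 1 := by omega
  exact mul_le_mul_of_nonneg_right h2 (by positivity)

theorem IsPool.weight_lt (hp : 2 ≤ p) {ε : ZMod f → ℕ → ℕ} (hε : IsPool p ε)
    {S : Finset (Σ _ : ZMod f, ℕ)} {n : ℕ} (h : ∀ x ∈ S, ε x.1 x.2 < n) :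
    weight p ε S < (p : ℤ) ^ n := by
  have h1 := hε.weight_le_sum hp (T := Finset.range n) fun x hx => Finset.mem_range.2 (h x hx)
  rw [← Finset.mul_sum, mul_comm, geom_sum_mul] at h1
  omega

/-- Powers with exponents below `E` and not congruent to `E` modulo `f`, each repeated at most
`p - 1` times, add up to at most `p ^ E (q - p) / (q - 1)`. -/
theorem IsPool.weight_mul_le (hp : 2 ≤ p) {ε : ZMod f → ℕ → ℕ} (hε : IsPool p ε) (hf : 0 < f)
    {S : Finset (Σ _ : ZMod f, ℕ)} {E : ℕ} (h : ∀ x ∈ S, ε x.1 x.2 < E)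
    (h' : ∀ x ∈ S, x.1 ≠ (E : ZMod f)) :
    ((p : ℤ) ^ f - 1) * weight p ε S ≤ ((p : ℤ) ^ f - p) * (p : ℤ) ^ E := by
  classical
  let P : ℕ → Prop := fun e => (e : ZMod f) ≠ (E : ZMod f)
  have hP : ∀ e, P (e + f) ↔ P e := fun e => by simp [P]
  let a : ℕ → ℤ := fun e => if P e then (p : ℤ) ^ e else 0
  have ha0 : ∀ e, 0 ≤ a e := fun e => by
    simp only [a]; split_ifs <;> positivity
  have hshift : ∀ e, (p : ℤ) ^ f * a e = a (e + f) := fun e => by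
    simp only [a, hP]
    split_ifs
    · rw [pow_add, mul_comm]
    · simp
  have h1 := hε.weight_le_sum hp (T := (Finset.range E).filter P) fun x hx =>
    Finset.mem_filter.2 ⟨Finset.mem_range.2 (h x hx), by
      simp only [P]; rw [hε.cls]; exact h' x hx⟩
  rw [← Finset.mul_sum, Finset.sum_filter] at h1
  have hq : (1 : ℤ) ≤ (p : ℤ) ^ f := one_le_pow₀ (by exact_mod_cast (by omega : 1 ≤ p))
  have hp1 : (2 : ℤ) ≤ p := by exact_mod_cast hp
  have h2 : ((p : ℤ) ^ f - 1) * ∑ e ∈ Finset.range E, a e =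
      ∑ e ∈ Finset.range f, a (E + e) - ∑ e ∈ Finset.range f, a e := by
    have h3 : (p : ℤ) ^ f * ∑ e ∈ Finset.range E, a e = ∑ e ∈ Finset.range E, a (f + e) := by
      rw [Finset.mul_sum]
      exact Finset.sum_congr rfl fun e _ => by rw [hshift, add_comm]
    have h4 := Finset.sum_range_add a f E
    have h5 := Finset.sum_range_add a E f
    rw [add_comm E f] at h5
    rw [sub_mul, h3, one_mul]
    linarith
  have h6 : ((p : ℤ) - 1) * ∑ e ∈ Finset.range f, a (E + e) ≤ ((p : ℤ) ^ f - p) * (p : ℤ) ^ E := by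
    obtain ⟨g, rfl⟩ : ∃ g, f = g + 1 := ⟨f - 1, by omega⟩
    rw [Finset.sum_range_succ']
    have h7 : a (E + 0) = 0 := by simp [a, P]
    have h8 : ∑ e ∈ Finset.range g, a (E + (e + 1)) ≤
        ∑ e ∈ Finset.range g, (p : ℤ) ^ (E + 1) * (p : ℤ) ^ e := by
      refine Finset.sum_le_sum fun e _ => ?_
      simp only [a]
      split_ifs
      · rw [← pow_add]; exact le_of_eq (by ring)
      · positivity
    rw [h7, add_zero]
    refine (mul_le_mul_of_nonneg_left h8 (by linarith)).trans (le_of_eq ?_)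
    rw [← Finset.mul_sum, mul_left_comm, mul_comm ((p : ℤ) - 1), geom_sum_mul]
    ring
  have h9 : 0 ≤ ∑ e ∈ Finset.range f, a e := Finset.sum_nonneg fun e _ => ha0 e
  calc ((p : ℤ) ^ f - 1) * weight p ε S
      ≤ ((p : ℤ) ^ f - 1) * (((p : ℤ) - 1) * ∑ e ∈ Finset.range E, a e) :=
        mul_le_mul_of_nonneg_left h1 (by linarith)
    _ = ((p : ℤ) - 1) * (((p : ℤ) ^ f - 1) * ∑ e ∈ Finset.range E, a e) := by ring
    _ ≤ ((p : ℤ) - 1) * ∑ e ∈ Finset.range f, a (E + e) := by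
        rw [h2]
        exact mul_le_mul_of_nonneg_left (by linarith) (by linarith)
    _ ≤ _ := h6

variable [NeZero f]

/-- The cheapest selection from the pool having the vector of carries `l`, as a set of pairs
(class, rank). -/
def selection (p : ℕ) (l : ZMod f → ℤ) : Finset (Σ _ : ZMod f, ℕ) :=
  Finset.univ.sigma fun j => Finset.range (mult p l j).toNat

theorem mem_selection {l : ZMod f → ℤ} {x : Σ _ : ZMod f, ℕ} :
    x ∈ selection p l ↔ (x.2 : ℤ) < mult p l x.1 := by
  simp only [selection, Finset.mem_sigma, Finset.mem_univ, true_and, Finset.mem_range]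
  omega

theorem cost_eq_weight (ε : ZMod f → ℕ → ℕ) (l : ZMod f → ℤ) :
    cost p ε l = weight p ε (selection p l) := by
  rw [cost, weight, selection, Finset.sum_sigma]
  rfl

/-- The difference of two costs, after cancelling the common part of the selections. -/
theorem cost_sub_cost (ε : ZMod f → ℕ → ℕ) (k h : ZMod f → ℤ) :
    cost p ε k - cost p ε h =
      weight p ε (selection p k \ selection p h) - weight p ε (selection p h \ selection p k) := by
  rw [cost_eq_weight, cost_eq_weight]
  exact (Finset.sum_sdiff_sub_sum_sdiff ..).symm

/-- In every class one of two selections contains the other. -/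
theorem class_ne_of_mem_sdiff {k h : ZMod f → ℤ} {x y : Σ _ : ZMod f, ℕ}
    (hx : x ∈ selection p k \ selection p h) (hy : y ∈ selection p h \ selection p k) :
    x.1 ≠ y.1 := by
  rw [Finset.mem_sdiff, mem_selection, mem_selection] at hx hy
  intro hxy
  rw [hxy] at hx
  omega

/-- If two selections differ and the first is not more expensive, then the largest exponent at
which they differ occurs on the side of the second one only. -/
theorem IsPool.exists_top_exponent (hp : 2 ≤ p) {ε : ZMod f → ℕ → ℕ} (hε : IsPool p ε)
    {k h : ZMod f → ℤ} (hne : selection p h ≠ selection p k) (hle : cost p ε h ≤ cost p ε k) :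
    ∃ x₀ ∈ selection p k \ selection p h,
      (∀ x ∈ selection p k \ selection p h, ε x.1 x.2 ≤ ε x₀.1 x₀.2) ∧
      (∀ x ∈ selection p h \ selection p k, ε x.1 x.2 < ε x₀.1 x₀.2) := by
  have key : ∀ u w : ZMod f → ℤ, ∀ x₀ ∈ selection p u \ selection p w,
      (∀ x ∈ selection p w \ selection p u, ε x.1 x.2 ≤ ε x₀.1 x₀.2) →
      ∀ x ∈ selection p w \ selection p u, ε x.1 x.2 < ε x₀.1 x₀.2 := by
    intro u w x₀ hx₀ hle x hx
    refine (hle x hx).lt_of_ne fun heq => class_ne_of_mem_sdiff hx₀ hx ?_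
    rw [← hε.cls x₀.1 x₀.2, ← hε.cls x.1 x.2, heq]
  have hne' : ((selection p k \ selection p h) ∪ (selection p h \ selection p k)).Nonempty := by
    rw [Finset.nonempty_iff_ne_empty]
    intro h0
    rw [Finset.union_eq_empty, Finset.sdiff_eq_empty_iff_subset, Finset.sdiff_eq_empty_iff_subset]
      at h0
    exact hne (h0.2.antisymm h0.1)
  obtain ⟨x₀, hx₀, hmax⟩ := Finset.exists_max_image _ (fun x => ε x.1 x.2) hne'
  rcases Finset.mem_union.1 hx₀ with h1 | h1
  · exact ⟨x₀, h1, fun x hx => hmax x (Finset.mem_union_left _ hx),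
      key k h x₀ h1 fun x hx => hmax x (Finset.mem_union_right _ hx)⟩
  · exfalso
    have h2 := hε.weight_lt hp (key h k x₀ h1 fun x hx => hmax x (Finset.mem_union_left _ hx))
    have h3 := pow_le_weight (p := p) (ε := ε) h1
    have h4 := cost_sub_cost (p := p) ε k h
    linarith

theorem eq_of_selection_eq (hp : 2 ≤ p) {h k : ZMod f → ℤ} (hle : h ≤ k)
    (hh : ∀ j, 0 ≤ mult p h j) (hk : ∀ j, 0 ≤ mult p k j)
    (heq : selection p h = selection p k) : h = k := by
  have hm : ∀ j, mult p h j = mult p k j := by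
    intro j
    have h1 : ∀ r : ℕ, (r : ℤ) < mult p h j ↔ (r : ℤ) < mult p k j := fun r => by
      have := Finset.ext_iff.1 heq ⟨j, r⟩
      rwa [mem_selection, mem_selection] at this
    have h2 := h1 (mult p h j).toNat
    have h3 := h1 (mult p k j).toNat
    have := hh j
    have := hk j
    omega
  have h4 : ∑ j, (p : ℤ) * (k (j + 1) - h (j + 1)) = ∑ j, (k j - h j) := by
    refine Finset.sum_congr rfl fun j _ => ?_
    have := hm j
    simp only [mult] at this
    linarith
  have h4' : ∑ j, (k (j + 1) - h (j + 1)) = ∑ j, (k j - h j) :=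
    Equiv.sum_comp (Equiv.addRight (1 : ZMod f)) fun j => k j - h j
  rw [← Finset.mul_sum, h4'] at h4
  have h5 : ∀ j ∈ Finset.univ, 0 ≤ k j - h j := fun j _ => sub_nonneg.2 (hle j)
  have h6 := Finset.sum_nonneg h5
  have h7 : ∑ j, (k j - h j) = 0 := by
    have : (2 : ℤ) ≤ p := by exact_mod_cast hp
    nlinarith
  funext j
  have := (Finset.sum_eq_zero_iff_of_nonneg h5).1 h7 j (Finset.mem_univ j)
  linarith

/-- If `x s` is at most `η / q ^ (s + 1)`, then the sum of the `x s` is at most the corresponding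
geometric sum; this is stated without denominators. -/
theorem pow_mul_geom_sum_le {q η : ℤ} (hq : 2 ≤ q) {x : ℕ → ℤ} (n : ℕ)
    (hx : ∀ s < n, q ^ (s + 1) * x s ≤ η) :
    q ^ n * ((q - 1) * ∑ s ∈ Finset.range n, x s) ≤ η * (q ^ n - 1) := by
  induction n with
  | zero => simp
  | succ n ih =>
    have h1 := ih fun s hs => hx s (by omega)
    have h2 := hx n (by omega)
    rw [Finset.sum_range_succ]
    have h3 : q ^ (n + 1) * ((q - 1) * (∑ s ∈ Finset.range n, x s + x n)) =
        q * (q ^ n * ((q - 1) * ∑ s ∈ Finset.range n, x s)) + (q - 1) * (q ^ (n + 1) * x n) := by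
      ring
    rw [h3]
    have h4 := mul_le_mul_of_nonneg_left h1 (show 0 ≤ q by omega)
    have h5 := mul_le_mul_of_nonneg_left h2 (show 0 ≤ q - 1 by omega)
    have h6 : q * (η * (q ^ n - 1)) + (q - 1) * η = η * (q ^ (n + 1) - 1) := by ring
    linarith

theorem mul_geom_sum_le {q η : ℤ} (hq : 2 ≤ q) (hη : 0 ≤ η) {x : ℕ → ℤ} (n : ℕ)
    (hx : ∀ s < n, q ^ (s + 1) * x s ≤ η) : (q - 1) * ∑ s ∈ Finset.range n, x s ≤ η := by
  have h0 : 0 < q ^ n := by positivity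
  refine le_of_mul_le_mul_left ((pow_mul_geom_sum_le hq n hx).trans ?_) h0
  nlinarith

theorem mul_geom_sum_lt {q η : ℤ} (hq : 2 ≤ q) (hη : 0 < η) {x : ℕ → ℤ} (n : ℕ)
    (hx : ∀ s < n, q ^ (s + 1) * x s ≤ η) : (q - 1) * ∑ s ∈ Finset.range n, x s < η := by
  have h0 : 0 < q ^ n := by positivity
  refine lt_of_mul_lt_mul_left ((pow_mul_geom_sum_le hq n hx).trans_lt ?_) h0.le
  nlinarith

end Elements

/-! ### The optimal last vector of a chain -/

section Top

variable {f p : ℕ}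

theorem mult_inf_nonneg {l l' : ZMod f → ℤ} (h : ∀ j, 0 ≤ mult p l j) (h' : ∀ j, 0 ≤ mult p l' j)
    (j : ZMod f) : 0 ≤ mult p (l ⊓ l') j := by
  have h1 := h j
  have h2 := h' j
  simp only [mult, Pi.inf_apply] at *
  rcases le_total (l (j + 1)) (l' (j + 1)) with h3 | h3
  · rw [inf_of_le_left h3]
    exact h1.trans (sub_le_sub_left inf_le_left _)
  · rw [inf_of_le_right h3]
    exact h2.trans (sub_le_sub_left inf_le_right _)

theorem mult_sup_nonneg {l l' : ZMod f → ℤ} (h : ∀ j, 0 ≤ mult p l j) (h' : ∀ j, 0 ≤ mult p l' j)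
    (j : ZMod f) : 0 ≤ mult p (l ⊔ l') j := by
  have h1 := h j
  have h2 := h' j
  simp only [mult, Pi.sup_apply] at *
  have hp : (0 : ℤ) ≤ p := by positivity
  have h3 : (p : ℤ) * l (j + 1) ≤ p * (l (j + 1) ⊔ l' (j + 1)) :=
    mul_le_mul_of_nonneg_left le_sup_left hp
  have h4 : (p : ℤ) * l' (j + 1) ≤ p * (l (j + 1) ⊔ l' (j + 1)) :=
    mul_le_mul_of_nonneg_left le_sup_right hp
  rcases le_total (l j) (l' j) with h5 | h5
  · rw [sup_of_le_right h5]; linarith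
  · rw [sup_of_le_left h5]; linarith

theorem mult_sub_const (l : ZMod f → ℤ) (s : ℤ) (j : ZMod f) :
    mult p (fun i => l i - s) j = mult p l j - s * (p - 1) := by
  simp only [mult]; ring

theorem IsStrictChain.update_top {n : ℕ} {r : ℕ → ZMod f → ℤ} (h : IsStrictChain (n + 1) r)
    {k : ZMod f → ℤ} (hk : r n ≤ k) : IsStrictChain (n + 1) (Function.update r n k) := by
  have hle : ∀ a i, r a i ≤ Function.update r n k a i := by
    intro a i
    by_cases ha : a = n
    · subst ha; simpa using hk i
    · rw [Function.update_of_ne ha]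
  refine ⟨fun i => (h.1 i).trans (hle 0 i), fun a ha i => ?_⟩
  rw [Function.update_of_ne (show a ≠ n by omega)]
  exact (h.2 a ha i).trans (hle _ i)

variable [NeZero f]

/-- The cheapest vector with all coordinates at least `d` and nonnegative digit counts; among the
cheapest ones it is minimal. -/
def IsOptimalTop (p : ℕ) (ε : ZMod f → ℕ → ℕ) (d : ℤ) (h : ZMod f → ℤ) : Prop :=
  (∀ j, 0 ≤ mult p h j) ∧ (∀ i, d ≤ h i) ∧
    ∀ u : ZMod f → ℤ, (∀ j, 0 ≤ mult p u j) → (∀ i, d ≤ u i) →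
      cost p ε h ≤ cost p ε u ∧ (u ≤ h → u ≠ h → cost p ε h < cost p ε u)

theorem exists_isOptimalTop (hp : 2 ≤ p) (ε : ZMod f → ℕ → ℕ) {d : ℤ} (hd : 0 ≤ d) :
    ∃ h, IsOptimalTop p ε d h := by
  obtain ⟨h, hh, hmin⟩ := WellFounded.has_min
    (InvImage.wf (fun u : ZMod f → ℤ => toLex ((cost p ε u).toNat, (∑ i, u i).toNat))
      (wellFounded_lt (α := ℕ ×ₗ ℕ)))
    {u : ZMod f → ℤ | (∀ j, 0 ≤ mult p u j) ∧ ∀ i, d ≤ u i} ⟨fun _ => d, fun j => by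
      have : (2 : ℤ) ≤ p := by exact_mod_cast hp
      simp only [mult]; nlinarith, fun _ => le_rfl⟩
  refine ⟨h, hh.1, hh.2, fun u hu hu' => ?_⟩
  have h1 := hmin u ⟨hu, hu'⟩
  change ¬ (toLex _ < toLex _) at h1
  rw [Prod.Lex.toLex_lt_toLex] at h1
  simp only at h1
  have h2 := cost_nonneg (p := p) ε u
  have h3 := cost_nonneg (p := p) ε h
  refine ⟨by omega, fun hle hne => ?_⟩
  have h4 : ∑ i, u i < ∑ i, h i := by
    refine Finset.sum_lt_sum (fun i _ => hle i) ?_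
    by_contra hcon
    push Not at hcon
    exact hne (funext fun i => le_antisymm (hle i) (hcon i (Finset.mem_univ _)))
  have h5 : 0 ≤ ∑ i, u i := Finset.sum_nonneg fun i _ => hd.trans (hu' i)
  omega

/-- The largest power of `p` that `h` takes from the class `j` exceeds `p ^ E`. -/
def IsLarge (p : ℕ) (ε : ZMod f → ℕ → ℕ) (h : ZMod f → ℤ) (E : ℕ) (j : ZMod f) : Prop :=
  0 < mult p h j ∧ E < ε j (mult p h j - 1).toNat

/-- The comparison of the optimal top vector `h` with a larger vector `k`: the difference of the
costs dominates the part `η` of the cost of `h` on which they can differ. -/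
theorem IsOptimalTop.exists_bound (hp : 2 ≤ p) {ε : ZMod f → ℕ → ℕ} (hε : IsPool p ε) {d : ℤ}
    {h k : ZMod f → ℤ} (hh : IsOptimalTop p ε d h) (hk : ∀ j, 0 ≤ mult p k j) (hhk : h ≤ k)
    (hne : h ≠ k) :
    ∃ B : Finset (ZMod f), (∀ j ∈ B, k j = h j ∧ k (j + 1) = h (j + 1)) ∧
      ∑ j ∈ Bᶜ, partialCost p ε j (mult p h j) <
        ((p : ℤ) ^ f - 1) * (cost p ε k - cost p ε h) := by
  classical
  obtain ⟨hcone, hdh, hmin⟩ := hh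
  have hp' : (2 : ℤ) ≤ p := by exact_mod_cast hp
  obtain ⟨x₀, hx₀, hk₀, hh₀⟩ := hε.exists_top_exponent hp
    (fun heq => hne (eq_of_selection_eq hp hhk hcone hk heq))
    (hmin k hk fun i => (hdh i).trans (hhk i)).1
  set E := ε x₀.1 x₀.2 with hE
  have hmD := fun j => mult_sub p k h j
  -- the counts agree in the large classes
  have claim1 : ∀ j, IsLarge p ε h E j → mult p k j = mult p h j := by
    rintro j ⟨h1, h2⟩
    refine le_antisymm (not_lt.1 fun h3 => ?_) (not_lt.1 fun h3 => ?_)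
    · have h4 := hk₀ ⟨j, (mult p h j).toNat⟩ (by
        rw [Finset.mem_sdiff, mem_selection, mem_selection]; simp only; omega)
      have h5 := hε.mono j (show (mult p h j - 1).toNat ≤ (mult p h j).toNat by omega)
      simp only at h4
      omega
    · have h4 := hh₀ ⟨j, (mult p h j - 1).toNat⟩ (by
        rw [Finset.mem_sdiff, mem_selection, mem_selection]; simp only; omega)
      simp only at h4
      omega
  -- the vectors agree there, as otherwise a cyclic exchange would make `h` cheaper
  have claim2 : ∀ j, IsLarge p ε h E j → k j = h j := by
    intro j hj
    by_contra hkj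
    have hDj : 1 ≤ (k - h) j := by
      have : h j ≤ k j := hhk j
      simp only [Pi.sub_apply]; omega
    have hm0 : mult p (k - h) j = 0 := by rw [hmD, claim1 j hj, sub_self]
    obtain ⟨δ, hδ0, hδj, hδj', -, hδ⟩ := exists_cyclic_exchange hp (D := k - h) (j := j)
      (fun i => sub_nonneg.2 (hhk i)) hDj (by simp only [mult] at hm0; linarith)
    have hsj : mult p δ j = -1 := by simp [mult, hδj, hδj']
    have hu := (hmin (h + δ) (fun i => by
      rw [mult_add]
      by_cases hi : i = j
      · subst hi
        have := hj.1
        omega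
      · have := (hδ i hi).1
        have := hcone i
        omega) fun i => by
          have := hδ0 i
          have := hdh i
          simp only [Pi.add_apply]; omega).1
    have h1 := cost_sub_cost (p := p) ε (h + δ) h
    have h2 : weight p ε (selection p (h + δ) \ selection p h) < (p : ℤ) ^ (E + 1) := by
      refine hε.weight_lt hp fun x hx => Nat.lt_succ_of_le (hk₀ x ?_)
      rw [Finset.mem_sdiff, mem_selection, mem_selection, mult_add] at hx
      rw [Finset.mem_sdiff, mem_selection, mem_selection]
      have hxj : x.1 ≠ j := by
        intro h3
        rw [h3, hsj] at hx
        omega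
      have h3 := (hδ x.1 hxj).2
      rw [hmD] at h3
      omega
    have h3 : (p : ℤ) ^ (E + 1) ≤ weight p ε (selection p h \ selection p (h + δ)) := by
      have hj1 := hj.1
      have h4 := pow_le_weight (p := p) (ε := ε)
        (S := selection p h \ selection p (h + δ)) (x := ⟨j, (mult p h j - 1).toNat⟩) (by
          rw [Finset.mem_sdiff, mem_selection, mem_selection, mult_add]
          simp only [hsj]
          omega)
      exact (pow_le_pow_right₀ (by omega) hj.2).trans h4
    linarith
  let B : Finset (ZMod f) := Finset.univ.filter (IsLarge p ε h E)
  refine ⟨B, fun j hj => ?_, ?_⟩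
  · have hj' : IsLarge p ε h E j := (Finset.mem_filter.1 hj).2
    refine ⟨claim2 j hj', ?_⟩
    have h1 := claim1 j hj'
    simp only [mult, claim2 j hj'] at h1
    have h2 : (p : ℤ) * k (j + 1) = p * h (j + 1) := by linarith
    exact mul_left_cancel₀ (by omega) h2
  -- the small part of `h` together with `p ^ E` consists of powers at most `p ^ E`
  have hη : ∑ j ∈ Bᶜ, partialCost p ε j (mult p h j) + (p : ℤ) ^ E < (p : ℤ) ^ (E + 1) := by
    have hS : ∀ x ∈ (Bᶜ).sigma fun j => Finset.range (mult p h j).toNat,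
        x ∈ selection p h ∧ ε x.1 x.2 ≤ E := by
      intro x hx
      simp only [Finset.mem_sigma, Finset.mem_compl, Finset.mem_range] at hx
      refine ⟨mem_selection.2 (by omega), ?_⟩
      have h1 : ¬ IsLarge p ε h E x.1 := fun h2 => hx.1 (Finset.mem_filter.2 ⟨Finset.mem_univ _, h2⟩)
      simp only [IsLarge, not_and, not_lt] at h1
      exact (hε.mono _ (by omega)).trans (h1 (by omega))
    have h1 : x₀ ∉ (Bᶜ).sigma fun j => Finset.range (mult p h j).toNat := fun h2 =>
      (Finset.mem_sdiff.1 hx₀).2 (hS _ h2).1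
    have h2 := hε.weight_lt hp (S := insert x₀ ((Bᶜ).sigma fun j => Finset.range (mult p h j).toNat))
      (n := E + 1) (fun x hx => by
        rcases Finset.mem_insert.1 hx with rfl | hx
        · exact Nat.lt_succ_self _
        · exact Nat.lt_succ_of_le (hS x hx).2)
    rw [weight, Finset.sum_insert h1, Finset.sum_sigma] at h2
    rw [add_comm]
    exact h2
  have h1 := pow_le_weight (p := p) (ε := ε) hx₀
  have h2 := hε.weight_mul_le hp (NeZero.pos f) hh₀ fun x hx => by
    rw [hE, hε.cls]
    exact (class_ne_of_mem_sdiff hx₀ hx).symm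
  rw [cost_sub_cost, mul_sub]
  have hq : (1 : ℤ) ≤ (p : ℤ) ^ f := one_le_pow₀ (by omega)
  have h3 := mul_le_mul_of_nonneg_left h1 (show (0 : ℤ) ≤ (p : ℤ) ^ f - 1 by omega)
  rw [← hE] at h3
  have h4 : (p : ℤ) ^ (E + 1) = p * (p : ℤ) ^ E := pow_succ' _ _
  nlinarith

/-- A strict chain whose last vector has nonnegative digit counts but is not the optimal top vector
can be made cheaper. -/
theorem IsStrictChain.exists_cheaper (hp : 2 ≤ p) {ε : ZMod f → ℕ → ℕ} (hε : IsPool p ε) {n : ℕ}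
    {h : ZMod f → ℤ} (hh : IsOptimalTop p ε (n + 1) h) {r : ℕ → ZMod f → ℤ}
    (hr : IsStrictChain (n + 1) r) (hcone : ∀ j, 0 ≤ mult p (r n) j) (hne : r n ≠ h) :
    ∃ g, IsStrictChain (n + 1) g ∧ chainCost p ε (n + 1) g < chainCost p ε (n + 1) r := by
  have hdr : ∀ i, (n : ℤ) + 1 ≤ r n i := hr.le n (by omega)
  -- the last vector may be replaced by its supremum with `h`, as `h` is optimal
  set k := h ⊔ r n with hkdef
  have hhk : h ≤ k := le_sup_left
  have hk0 := mult_sup_nonneg hh.1 hcone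
  have hck : cost p ε k ≤ cost p ε (r n) := by
    have h1 := cost_inf_add_cost_sup_le hp hε h (r n)
    have h2 := (hh.2.2 _ (mult_inf_nonneg hh.1 hcone) fun i => le_inf (hh.2.1 i) (hdr i)).1
    linarith
  have hr1 := hr.update_top (k := k) le_sup_right
  set r₁ := Function.update r n k with hr₁
  have hr₁n : r₁ n = k := by simp [hr₁]
  have hc1 : chainCost p ε (n + 1) r₁ = chainCost p ε (n + 1) r + (cost p ε k - cost p ε (r n)) :=
    sum_range_update_one (cost p ε) (Nat.lt_succ_self n) r k
  rcases eq_or_ne h k with hk | hk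
  · refine ⟨r₁, hr1, ?_⟩
    have h1 : r n ≤ h := by rw [hk]; exact le_sup_right
    have h2 := (hh.2.2 _ hcone hdr).2 h1 hne
    rw [hc1, ← hk]
    linarith
  obtain ⟨B, hB, hη⟩ := hh.exists_bound hp hε hk0 hhk hk
  set η := ∑ j ∈ Bᶜ, partialCost p ε j (mult p h j) with hηdef
  have hη0 : 0 ≤ η := Finset.sum_nonneg fun j _ => partialCost_nonneg ε j _
  have hq : (2 : ℤ) ≤ (p : ℤ) ^ f := by
    have h1 : (p : ℤ) ^ 1 ≤ (p : ℤ) ^ f :=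
      pow_le_pow_right₀ (by exact_mod_cast (by omega : 1 ≤ p)) (NeZero.pos f)
    have : (2 : ℤ) ≤ p := by exact_mod_cast hp
    linarith
  -- truncate the chain so that it ends in `h`
  let g : ℕ → ZMod f → ℤ := fun a => r₁ a ⊓ fun i => h i - ((n : ℤ) - a)
  have hg : IsStrictChain (n + 1) g := by
    refine ⟨fun i => ?_, fun a ha i => ?_⟩
    · have h1 := hr1.1 i
      have h2 := hh.2.1 i
      simp only [g, Pi.inf_apply, Nat.cast_zero]
      exact le_inf h1 (by omega)
    · have h1 := hr1.2 a ha i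
      simp only [g, Pi.inf_apply]
      push_cast
      omega
  refine ⟨g, hg, ?_⟩
  -- by submodularity, truncating the vector `s + 1` steps below the top loses at most the difference
  -- between the costs of `h - (s + 1)` and `u - (s + 1)` for some `u` between `h` and `k`, and the
  -- classes in `B` do not contribute to it
  have hpen : ∀ s < n, ((p : ℤ) ^ f) ^ (s + 1) *
      (cost p ε (g (n - 1 - s)) - cost p ε (r₁ (n - 1 - s))) ≤ η := by
    intro s hs
    set a := n - 1 - s with ha
    have has : ((n : ℤ) - a) = ((s + 1 : ℕ) : ℤ) := by omega
    set u : ZMod f → ℤ := (fun i => r₁ a i + (s + 1 : ℕ)) ⊔ h with hu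
    have h1 := cost_inf_add_cost_sup_le hp hε (r₁ a) fun i => h i - ((n : ℤ) - a)
    have h2 : (r₁ a ⊔ fun i => h i - ((n : ℤ) - a)) = fun i => u i - (s + 1 : ℕ) := by
      funext i
      simp only [hu, Pi.sup_apply, has]
      omega
    rw [h2] at h1
    have huk : u ≤ k := by
      refine sup_le (fun i => ?_) hhk
      have := hr1.add_le a (s + 1) (by omega) i
      rwa [show a + (s + 1) = n by omega, hr₁n] at this
    have hhu : h ≤ u := le_sup_right
    have h3 : cost p ε (g a) - cost p ε (r₁ a) ≤
        cost p ε (fun i => h i - (s + 1 : ℕ)) - cost p ε (fun i => u i - (s + 1 : ℕ)) := by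
      have : g a = r₁ a ⊓ fun i => h i - ((n : ℤ) - a) := rfl
      rw [this]
      rw [has] at h1 ⊢
      linarith
    refine (mul_le_mul_of_nonneg_left h3 (by positivity)).trans ?_
    have h4 : cost p ε (fun i => h i - (s + 1 : ℕ)) - cost p ε (fun i => u i - (s + 1 : ℕ)) ≤
        ∑ j ∈ Bᶜ, partialCost p ε j (mult p h j - (s + 1 : ℕ) * (p - 1)) := by
      rw [cost, cost, ← Finset.sum_sub_distrib, ← Finset.sum_add_sum_compl B]
      have h5 : ∑ j ∈ B, (partialCost p ε j (mult p (fun i => h i - (s + 1 : ℕ)) j) -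
          partialCost p ε j (mult p (fun i => u i - (s + 1 : ℕ)) j)) = 0 := by
        refine Finset.sum_eq_zero fun j hj => ?_
        obtain ⟨h6, h7⟩ := hB j hj
        have h8 : u j = h j := le_antisymm (h6 ▸ huk j) (hhu j)
        have h9 : u (j + 1) = h (j + 1) := le_antisymm (h7 ▸ huk (j + 1)) (hhu (j + 1))
        simp only [mult, h8, h9, sub_self]
      rw [h5, zero_add]
      refine Finset.sum_le_sum fun j _ => ?_
      rw [mult_sub_const]
      exact sub_le_self _ (partialCost_nonneg _ _ _)
    refine (mul_le_mul_of_nonneg_left h4 (by positivity)).trans ?_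
    rw [hηdef, Finset.mul_sum]
    exact Finset.sum_le_sum fun j _ => hε.pow_mul_partialCost_le hp j (s + 1) _
  have hsum := mul_geom_sum_le hq hη0 n hpen
  rw [Finset.sum_range_reflect (fun a => cost p ε (g a) - cost p ε (r₁ a)) n] at hsum
  have hgn : g n = h := by
    funext i
    simp only [g, hr₁n, Pi.inf_apply, sub_self, sub_zero]
    exact inf_of_le_right (hhk i)
  have hfin : chainCost p ε (n + 1) g - chainCost p ε (n + 1) r₁ =
      ∑ a ∈ Finset.range n, (cost p ε (g a) - cost p ε (r₁ a)) + (cost p ε h - cost p ε k) := by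
    rw [chainCost, chainCost, ← Finset.sum_sub_distrib, Finset.sum_range_succ, hgn, hr₁n]
  have : ((p : ℤ) ^ f - 1) * (chainCost p ε (n + 1) g - chainCost p ε (n + 1) r₁) < 0 := by
    rw [hfin, mul_add]
    linarith
  have := neg_of_mul_neg_right this (by omega)
  linarith

end Top

/-! ### Digits in base `p` -/

section Digits

variable {p : ℕ}

/-- The digit of `N` in base `p` at the place `e`. -/
def digit (p N e : ℕ) : ℕ := N / p ^ e % p

/-- Every digit of `N` is at most the corresponding digit of `M`. -/
def DigitLE (p N M : ℕ) : Prop := ∀ e, digit p N e ≤ digit p M e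

theorem digit_lt (hp : 2 ≤ p) (N e : ℕ) : digit p N e < p := Nat.mod_lt _ (by omega)

theorem digit_zero_left (e : ℕ) : digit p 0 e = 0 := by simp [digit]

theorem digit_eq_zero {N e : ℕ} (h : N < p ^ e) : digit p N e = 0 := by
  rw [digit, Nat.div_eq_of_lt h, Nat.zero_mod]

theorem sum_digit_add (N K : ℕ) :
    ∑ e ∈ Finset.range K, digit p N e * p ^ e + p ^ K * (N / p ^ K) = N := by
  induction K with
  | zero => simp
  | succ K ih =>
    rw [Finset.sum_range_succ]
    have h1 : N / p ^ (K + 1) = N / p ^ K / p := by rw [pow_succ, Nat.div_div_eq_div_mul]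
    have h2 := Nat.mod_add_div (N / p ^ K) p
    conv_rhs => rw [← ih]
    conv_rhs => rw [← h2]
    rw [h1, digit, pow_succ]
    ring

theorem sum_digit {N K : ℕ} (h : N < p ^ K) :
    ∑ e ∈ Finset.range K, digit p N e * p ^ e = N := by
  have := sum_digit_add (p := p) N K
  rwa [Nat.div_eq_of_lt h, mul_zero, add_zero] at this

theorem digit_sum {K : ℕ} (e : ℕ) {d : ℕ → ℕ} (hd : ∀ e, d e < p) (hK : ∀ e, K ≤ e → d e = 0) :
    digit p (∑ e ∈ Finset.range K, d e * p ^ e) e = d e := by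
  induction e generalizing K d with
  | zero =>
    cases K with
    | zero => simp [digit, hK]
    | succ K =>
      rw [digit, Finset.sum_range_succ', pow_zero, Nat.div_one, mul_one]
      simp_rw [pow_succ, ← mul_assoc]
      rw [← Finset.sum_mul, Nat.mul_add_mod_self_right, Nat.mod_eq_of_lt (hd 0)]
  | succ e ih =>
    cases K with
    | zero => simp [digit, hK]
    | succ K =>
      have hp : 0 < p := (Nat.zero_le _).trans_lt (hd 0)
      have h1 := ih (K := K) (d := fun e => d (e + 1)) (fun e => hd _) fun e he => hK _ (by omega)
      have h2 : (∑ e ∈ Finset.range (K + 1), d e * p ^ e) / p =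
          ∑ e ∈ Finset.range K, d (e + 1) * p ^ e := by
        rw [Finset.sum_range_succ', pow_zero, mul_one]
        simp_rw [pow_succ, ← mul_assoc]
        rw [← Finset.sum_mul, mul_comm, Nat.mul_add_div hp, Nat.div_eq_of_lt (hd 0), add_zero]
      rw [digit, pow_succ', ← Nat.div_div_eq_div_mul, h2]
      exact h1

theorem DigitLE.le (hp : 2 ≤ p) {N M : ℕ} (h : DigitLE p N M) : N ≤ M := by
  have hN : N < p ^ (N + M) := (Nat.lt_pow_self hp).trans_le
    (Nat.pow_le_pow_right (by omega) (by omega))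
  have hM : M < p ^ (N + M) := (Nat.lt_pow_self hp).trans_le
    (Nat.pow_le_pow_right (by omega) (by omega))
  calc N = ∑ e ∈ Finset.range (N + M), digit p N e * p ^ e := (sum_digit hN).symm
    _ ≤ ∑ e ∈ Finset.range (N + M), digit p M e * p ^ e := ?_
    _ = M := sum_digit hM
  exact Finset.sum_le_sum fun e _ => Nat.mul_le_mul_right _ (h e)

theorem DigitLE.trans {N M L : ℕ} (h : DigitLE p N M) (h' : DigitLE p M L) : DigitLE p N L :=
  fun e => (h e).trans (h' e)

end Digits

/-! ### The pool of powers given by a sequence of digits -/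

section Pool

variable {f p : ℕ} {y : ℕ → ℕ} {M : ℕ}

/-- The sum of the digits `y e` with `e < E` in the class `j` modulo `f`. -/
def digitCount (y : ℕ → ℕ) (j : ZMod f) (E : ℕ) : ℕ :=
  ∑ e ∈ Finset.range E, if (e : ZMod f) = j then y e else 0

theorem digitCount_succ (y : ℕ → ℕ) (j : ZMod f) (E : ℕ) :
    digitCount y j (E + 1) = digitCount y j E + if (E : ZMod f) = j then y E else 0 :=
  Finset.sum_range_succ _ _

theorem digitCount_mono (y : ℕ → ℕ) (j : ZMod f) : Monotone (digitCount y j) :=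
  monotone_nat_of_le_succ fun E => by rw [digitCount_succ]; omega

theorem digitCount_le {n y : ℕ → ℕ} (h : ∀ e, n e ≤ y e) (j : ZMod f) (E : ℕ) :
    digitCount n j E ≤ digitCount y j E :=
  Finset.sum_le_sum fun e _ => by split_ifs <;> simp [h e]

/-- The pool containing `y e` copies of `p ^ e` for every `e`. -/
def digitPool (y : ℕ → ℕ) (j : ZMod f) (r : ℕ) : ℕ := sInf {e | r < digitCount y j (e + 1)}

/-- The digits of the value of the cheapest selection having the digit counts `m`. -/
def selectedDigit (y : ℕ → ℕ) (m : ZMod f → ℕ) (e : ℕ) : ℕ :=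
  min (m e) (digitCount y (e : ZMod f) (e + 1)) - min (m e) (digitCount y (e : ZMod f) e)

theorem selectedDigit_le (y : ℕ → ℕ) (m : ZMod f → ℕ) (e : ℕ) : selectedDigit y m e ≤ y e := by
  rw [selectedDigit, digitCount_succ, if_pos rfl]
  omega

theorem selectedDigit_mono (y : ℕ → ℕ) {m m' : ZMod f → ℕ} (h : ∀ j, m j ≤ m' j) (e : ℕ) :
    selectedDigit y m e ≤ selectedDigit y m' e := by
  have := h e
  have := digitCount_mono y (e : ZMod f) (Nat.le_succ e)
  simp only [selectedDigit, Nat.succ_eq_add_one] at *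
  omega

variable [NeZero f]

theorem exists_lt_digitCount (hp : 2 ≤ p) (hM : ∀ e, M ≤ e → y e = p - 1) (j : ZMod f) (r : ℕ) :
    ∃ e, r < digitCount y j (e + 1) := by
  have key : ∀ k : ℕ, k ≤ digitCount y j (j.val + f * (M + k)) := by
    intro k
    induction k with
    | zero => exact Nat.zero_le _
    | succ k ih =>
      have hf := NeZero.pos f
      have h1 : M ≤ j.val + f * (M + k) := by nlinarith
      have h2 : digitCount y j (j.val + f * (M + k) + 1) ≤
          digitCount y j (j.val + f * (M + (k + 1))) := digitCount_mono y j (by nlinarith)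
      rw [digitCount_succ, if_pos (by simp), hM _ h1] at h2
      omega
  exact ⟨_, lt_of_lt_of_le (key (r + 1)) (digitCount_mono y j (Nat.le_succ _))⟩

/-- The powers with exponent at most `e` in the class `j` have the ranks below
`digitCount y j (e + 1)`. -/
theorem digitPool_le_iff (hp : 2 ≤ p) (hM : ∀ e, M ≤ e → y e = p - 1) {j : ZMod f} {r e : ℕ} :
    digitPool y j r ≤ e ↔ r < digitCount y j (e + 1) := by
  refine ⟨fun h => ?_, fun h => Nat.sInf_le h⟩
  have h1 : r < digitCount y j (digitPool y j r + 1) :=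
    Nat.sInf_mem (exists_lt_digitCount hp hM j r)
  exact h1.trans_le (digitCount_mono y j (by omega))

theorem digitCount_digitPool_le (hp : 2 ≤ p) (hM : ∀ e, M ≤ e → y e = p - 1) (j : ZMod f) (r : ℕ) :
    digitCount y j (digitPool y j r) ≤ r := by
  rcases Nat.eq_zero_or_pos (digitPool y j r) with h | h
  · rw [h]; simp [digitCount]
  · obtain ⟨e, he⟩ : ∃ e, digitPool y j r = e + 1 := ⟨digitPool y j r - 1, by omega⟩
    have h1 := (digitPool_le_iff hp hM (j := j) (r := r) (e := e)).not.1 (by omega)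
    rw [he]; omega

theorem isPool_digitPool (hp : 2 ≤ p) (hy : ∀ e, y e < p) (hM : ∀ e, M ≤ e → y e = p - 1) :
    IsPool p (digitPool y : ZMod f → ℕ → ℕ) where
  mono j r r' h := by
    rw [digitPool_le_iff hp hM]
    exact h.trans_lt ((digitPool_le_iff hp hM).1 le_rfl)
  cls j r := by
    have h1 := digitCount_digitPool_le hp hM j r
    have h2 := (digitPool_le_iff hp hM (j := j) (r := r)).1 le_rfl
    rw [digitCount_succ] at h2
    by_contra h
    rw [if_neg h] at h2
    omega
  jump j r := by
    have h1 := digitCount_digitPool_le hp hM j r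
    refine not_le.1 fun h => ?_
    rw [digitPool_le_iff hp hM, digitCount_succ] at h
    have := hy (digitPool y j r)
    split_ifs at h <;> omega

theorem digitPool_eq (hp : 2 ≤ p) (hM : ∀ e, M ≤ e → y e = p - 1) {j : ZMod f} {r E : ℕ}
    (h : digitCount y j E ≤ r) (h' : r < digitCount y j (E + 1)) : digitPool y j r = E := by
  refine le_antisymm ((digitPool_le_iff hp hM).2 h') (not_lt.1 fun hlt => ?_)
  have h1 := (digitPool_le_iff hp hM).1 (le_refl (digitPool y j r))
  have h2 := digitCount_mono y j (show digitPool y j r + 1 ≤ E by omega)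
  omega

/-- A number whose digits are bounded by `y` is at least as expensive, class by class, as the
cheapest selection with the same digit counts. -/
theorem sum_digitPool_le (hp : 2 ≤ p) (hM : ∀ e, M ≤ e → y e = p - 1) {n : ℕ → ℕ}
    (hn : ∀ e, n e ≤ y e) (j : ZMod f) (E : ℕ) :
    ∑ r ∈ Finset.range (digitCount n j E), p ^ digitPool y j r ≤
      ∑ e ∈ Finset.range E, if (e : ZMod f) = j then n e * p ^ e else 0 := by
  induction E with
  | zero => simp [digitCount]
  | succ E ih =>
    rw [digitCount_succ, Finset.sum_range_add, Finset.sum_range_succ _ E]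
    refine add_le_add ih ?_
    split_ifs with h
    · rw [← smul_eq_mul (n E), ← Finset.card_range (n E), ← Finset.sum_const, Finset.card_range]
      refine Finset.sum_le_sum fun x hx => Nat.pow_le_pow_right (by omega) ?_
      rw [digitPool_le_iff hp hM]
      refine lt_of_lt_of_le ?_ (digitCount_le hn j (E + 1))
      rw [digitCount_succ, if_pos h]
      have := Finset.mem_range.1 hx
      omega
    · simp

theorem sum_selectedDigit (hp : 2 ≤ p) (hM : ∀ e, M ≤ e → y e = p - 1) (m : ZMod f → ℕ)
    (j : ZMod f) (E : ℕ) :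
    ∑ r ∈ Finset.range (min (m j) (digitCount y j E)), p ^ digitPool y j r =
      ∑ e ∈ Finset.range E, if (e : ZMod f) = j then selectedDigit y m e * p ^ e else 0 := by
  induction E with
  | zero => simp [digitCount]
  | succ E ih =>
    have hmono := digitCount_mono y j (Nat.le_succ E)
    have h1 : min (m j) (digitCount y j (E + 1)) = min (m j) (digitCount y j E) +
        (min (m j) (digitCount y j (E + 1)) - min (m j) (digitCount y j E)) := by
      simp only [Nat.succ_eq_add_one] at hmono
      omega
    rw [h1, Finset.sum_range_add, ih, Finset.sum_range_succ _ E]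
    congr 1
    split_ifs with h
    · subst h
      rw [← selectedDigit, ← smul_eq_mul (selectedDigit y m E),
        ← Finset.card_range (selectedDigit y m E), ← Finset.sum_const, Finset.card_range]
      refine Finset.sum_congr rfl fun x hx => ?_
      have := Finset.mem_range.1 hx
      rw [selectedDigit] at this
      rw [digitPool_eq hp hM (E := E)] <;> omega
    · have : digitCount y j (E + 1) = digitCount y j E := by
        rw [digitCount_succ, if_neg h, add_zero]
      simp [this]

theorem sum_class (F : ℕ → ℕ) (E : ℕ) :
    ∑ j : ZMod f, ∑ e ∈ Finset.range E, (if (e : ZMod f) = j then F e else 0) =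
      ∑ e ∈ Finset.range E, F e := by
  rw [Finset.sum_comm]
  simp

/-- The value of the cheapest selection having the vector of carries `l`, as a natural number. -/
def selectedValue (p : ℕ) (y : ℕ → ℕ) (l : ZMod f → ℤ) : ℕ :=
  ∑ j, ∑ r ∈ Finset.range (mult p l j).toNat, p ^ digitPool y j r

theorem natCast_selectedValue (y : ℕ → ℕ) (l : ZMod f → ℤ) :
    (selectedValue p y l : ℤ) = cost p (digitPool y) l := by
  simp [selectedValue, cost, partialCost]

theorem digit_selectedValue (hp : 2 ≤ p) (hy : ∀ e, y e < p) (hM : ∀ e, M ≤ e → y e = p - 1)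
    (l : ZMod f → ℤ) (e : ℕ) :
    digit p (selectedValue p y l) e = selectedDigit y (fun j => (mult p l j).toNat) e := by
  set m : ZMod f → ℕ := fun j => (mult p l j).toNat with hm
  obtain ⟨E, hE⟩ : ∃ E, ∀ j, m j ≤ digitCount y j E := by
    choose E hE using fun j => exists_lt_digitCount hp hM j (m j)
    refine ⟨Finset.univ.sup E + 1, fun j => (hE j).le.trans (digitCount_mono y j ?_)⟩
    have := Finset.le_sup (f := E) (Finset.mem_univ j)
    omega
  have h1 : selectedValue p y l = ∑ e ∈ Finset.range E, selectedDigit y m e * p ^ e := by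
    rw [← sum_class (f := f), selectedValue]
    refine Finset.sum_congr rfl fun j _ => ?_
    rw [← sum_selectedDigit hp hM m j E, min_eq_left (hE j)]
  rw [h1]
  refine digit_sum e (fun e => (selectedDigit_le y m e).trans_lt (hy e)) fun e he => ?_
  have h2 := (hE e).trans (digitCount_mono y (e : ZMod f) he)
  have h3 := digitCount_mono y (e : ZMod f) (Nat.le_succ e)
  simp only [selectedDigit, Nat.succ_eq_add_one] at *
  omega

end Pool

/-! ### Vectors of carries -/

section Carries

variable {f p : ℕ}

theorem pow_eq_pow_val (hp : 0 < p) (e : ℕ) :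
    (p : ZMod (p ^ f - 1)) ^ e = (p : ZMod (p ^ f - 1)) ^ (e : ZMod f).val := by
  rw [ZMod.val_natCast]
  refine pow_eq_pow_mod e ?_
  have h1 : p ^ f = (p ^ f - 1) + 1 := by
    have := Nat.one_le_pow f p hp
    omega
  have h2 : ((p ^ f : ℕ) : ZMod (p ^ f - 1)) = ((p ^ f - 1 + 1 : ℕ) : ZMod (p ^ f - 1)) :=
    congrArg _ h1
  rwa [Nat.cast_add, ZMod.natCast_self, zero_add, Nat.cast_pow, Nat.cast_one] at h2

variable [NeZero f]

theorem zmod_val_self_sub (j : ZMod f) : (j - (j + 1)).val + 1 = f := by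
  obtain ⟨g, rfl⟩ : ∃ g, f = g + 1 := ⟨f - 1, by have := NeZero.pos f; omega⟩
  have h1 : j - (j + 1) = -1 := by ring
  rw [h1, ZMod.val_neg_one]

/-- The numerator of the vector of carries belonging to the digit counts `c`. -/
def carryNum (p : ℕ) (c : ZMod f → ℤ) (j : ZMod f) : ℤ := ∑ i, c i * (p : ℤ) ^ (i - j).val

theorem mul_carryNum (c : ZMod f → ℤ) (j : ZMod f) :
    p * carryNum p c (j + 1) = carryNum p c j + ((p : ℤ) ^ f - 1) * c j := by
  have : ∀ i, (p : ℤ) * (c i * (p : ℤ) ^ (i - (j + 1)).val) =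
      c i * (p : ℤ) ^ (i - j).val + if i = j then ((p : ℤ) ^ f - 1) * c i else 0 := by
    intro i
    split_ifs with h
    · subst h
      have h1 := zmod_val_self_sub i
      rw [sub_self, ZMod.val_zero, pow_zero]
      conv_rhs => rw [← h1]
      ring
    · rw [zmod_val_sub_eq h]; ring
  rw [carryNum, Finset.mul_sum, Finset.sum_congr rfl fun i _ => this i, Finset.sum_add_distrib,
    Finset.sum_ite_eq']
  simp [carryNum]

theorem dvd_carryNum {c : ZMod f → ℤ} (h : (p : ℤ) ^ f - 1 ∣ carryNum p c 0) (j : ZMod f) :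
    (p : ℤ) ^ f - 1 ∣ carryNum p c j := by
  refine zmod_cycle_induction (P := fun j => (p : ℤ) ^ f - 1 ∣ carryNum p c j) 0 h
    (fun i _ hi => ?_) j
  have h1 := mul_carryNum (p := p) c i
  rw [eq_sub_of_add_eq h1.symm]
  exact (hi.mul_left _).sub (dvd_mul_right _ _)

/-- The vector of carries of a number `N < p ^ K` divisible by `p ^ f - 1`: the vector whose digit
counts are the sums of the digits of `N` in each class of places modulo `f`. -/
def carryVec (p f : ℕ) [NeZero f] (K N : ℕ) (j : ZMod f) : ℤ :=
  carryNum p (fun i : ZMod f => (digitCount (digit p N) i K : ℤ)) j / ((p : ℤ) ^ f - 1)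

theorem dvd_selectedValue (hp : 0 < p) {y : ℕ → ℕ} (hε : IsPool p (digitPool y : ZMod f → ℕ → ℕ))
    {l : ZMod f → ℤ} (hl : ∀ j, 0 ≤ mult p l j) : p ^ f - 1 ∣ selectedValue p y l := by
  rw [← ZMod.natCast_eq_zero_iff]
  have h1 : ((selectedValue p y l : ℕ) : ZMod (p ^ f - 1)) =
      ∑ j : ZMod f, ((mult p l j : ℤ) : ZMod (p ^ f - 1)) * (p : ZMod (p ^ f - 1)) ^ j.val := by
    rw [selectedValue, Nat.cast_sum]
    refine Finset.sum_congr rfl fun j _ => ?_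
    rw [Nat.cast_sum, Finset.sum_congr rfl (g := fun _ => (p : ZMod (p ^ f - 1)) ^ j.val),
      Finset.sum_const, Finset.card_range, nsmul_eq_mul]
    · congr 1
      conv_rhs => rw [← Int.toNat_of_nonneg (hl j)]
      exact (Int.cast_natCast _).symm
    · intro r _
      rw [Nat.cast_pow, pow_eq_pow_val hp, hε.cls]
  have h2 : ∀ j : ZMod f, (p : ZMod (p ^ f - 1)) * (p : ZMod (p ^ f - 1)) ^ j.val =
      (p : ZMod (p ^ f - 1)) ^ (j + 1).val := fun j => by
    rw [← pow_succ', pow_eq_pow_val hp, Nat.cast_add, ZMod.natCast_zmod_val, Nat.cast_one]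
  rw [h1]
  have h3 : ∀ j : ZMod f,
      ((mult p l j : ℤ) : ZMod (p ^ f - 1)) * (p : ZMod (p ^ f - 1)) ^ j.val =
      (l (j + 1) : ZMod (p ^ f - 1)) * (p : ZMod (p ^ f - 1)) ^ (j + 1).val -
        (l j : ZMod (p ^ f - 1)) * (p : ZMod (p ^ f - 1)) ^ j.val := fun j => by
    rw [← h2, mult]; push_cast; ring
  rw [Finset.sum_congr rfl fun j _ => h3 j, Finset.sum_sub_distrib, sub_eq_zero]
  exact Equiv.sum_comp (Equiv.addRight (1 : ZMod f))
    fun j => (l j : ZMod (p ^ f - 1)) * (p : ZMod (p ^ f - 1)) ^ j.val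

theorem dvd_carryNum_digitCount (hp : 2 ≤ p) {K N : ℕ} (hN : N < p ^ K) (hd : p ^ f - 1 ∣ N) :
    (p : ℤ) ^ f - 1 ∣ carryNum p (fun i : ZMod f => (digitCount (digit p N) i K : ℤ)) 0 := by
  have h0 : ((p ^ f - 1 : ℕ) : ℤ) = (p : ℤ) ^ f - 1 := by
    rw [Nat.cast_sub (Nat.one_le_pow f p (by omega))]; push_cast; ring
  rw [← h0, ← ZMod.intCast_zmod_eq_zero_iff_dvd, ← (ZMod.natCast_eq_zero_iff _ _).2 hd]
  conv_rhs => rw [← sum_digit hN, ← sum_class (f := f)]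
  rw [carryNum]
  push_cast
  refine Finset.sum_congr rfl fun j _ => ?_
  rw [digitCount, Nat.cast_sum, Finset.sum_mul]
  refine Finset.sum_congr rfl fun e _ => ?_
  split_ifs with h
  · subst h
    rw [pow_eq_pow_val (by omega) e, sub_zero]
  · simp

theorem carryVec_mul (hp : 2 ≤ p) {K N : ℕ} (hN : N < p ^ K) (hd : p ^ f - 1 ∣ N) (j : ZMod f) :
    ((p : ℤ) ^ f - 1) * carryVec p f K N j =
      carryNum p (fun i : ZMod f => (digitCount (digit p N) i K : ℤ)) j :=
  Int.mul_ediv_cancel' (dvd_carryNum (dvd_carryNum_digitCount hp hN hd) j)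

theorem one_lt_pow_of_two_le (hp : 2 ≤ p) : (1 : ℤ) < (p : ℤ) ^ f :=
  one_lt_pow₀ (by exact_mod_cast (by omega : 1 < p)) (NeZero.ne f)

theorem mult_carryVec (hp : 2 ≤ p) {K N : ℕ} (hN : N < p ^ K) (hd : p ^ f - 1 ∣ N) (j : ZMod f) :
    mult p (carryVec p f K N) j = digitCount (digit p N) j K := by
  have h1 := mul_carryNum (p := p) (fun i : ZMod f => (digitCount (digit p N) i K : ℤ)) j
  rw [← carryVec_mul hp hN hd, ← carryVec_mul hp hN hd] at h1
  have hq := one_lt_pow_of_two_le (f := f) hp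
  refine mul_left_cancel₀ (show (p : ℤ) ^ f - 1 ≠ 0 by omega) ?_
  rw [mult]
  linear_combination h1

theorem carryVec_add_one_le (hp : 2 ≤ p) {K N N' : ℕ} (hN : N < p ^ K) (hd : p ^ f - 1 ∣ N)
    (hd' : p ^ f - 1 ∣ N') (hlt : N' < N) (hle : DigitLE p N' N) (j : ZMod f) :
    carryVec p f K N' j + 1 ≤ carryVec p f K N j := by
  have hN' := hlt.trans hN
  have hq := one_lt_pow_of_two_le (f := f) hp
  have h1 : carryNum p (fun i : ZMod f => (digitCount (digit p N') i K : ℤ)) j <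
      carryNum p (fun i : ZMod f => (digitCount (digit p N) i K : ℤ)) j := by
    refine Finset.sum_lt_sum (fun i _ => mul_le_mul_of_nonneg_right
      (Nat.cast_le.2 (digitCount_le hle i K)) (by positivity)) ?_
    by_contra hcon
    push Not at hcon
    have heq : ∀ i : ZMod f, digitCount (digit p N') i K = digitCount (digit p N) i K := by
      intro i
      refine le_antisymm (digitCount_le hle i K) ?_
      have := le_of_mul_le_mul_right (hcon i (Finset.mem_univ _)) (by positivity)
      exact_mod_cast this
    have h2 : ∑ e ∈ Finset.range K, digit p N' e = ∑ e ∈ Finset.range K, digit p N e := by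
      rw [← sum_class (f := f), ← sum_class (f := f) (digit p N)]
      exact Finset.sum_congr rfl fun i _ => heq i
    have h3 := (Finset.sum_eq_sum_iff_of_le fun e _ => hle e).1 h2
    refine hlt.ne ?_
    rw [← sum_digit hN, ← sum_digit hN']
    exact Finset.sum_congr rfl fun e he => by rw [h3 e he]
  rw [← carryVec_mul hp hN hd, ← carryVec_mul hp hN' hd'] at h1
  have := lt_of_mul_lt_mul_left h1 (by omega)
  omega

theorem carryVec_zero (K : ℕ) (j : ZMod f) : carryVec p f K 0 j = 0 := by
  simp [carryVec, carryNum, digitCount, digit_zero_left]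

/-- A number is at least as large as the cheapest selection with its digit counts. -/
theorem cost_carryVec_le (hp : 2 ≤ p) {y : ℕ → ℕ} {M : ℕ} (hM : ∀ e, M ≤ e → y e = p - 1)
    {K N : ℕ} (hN : N < p ^ K) (hd : p ^ f - 1 ∣ N) (hy : ∀ e, digit p N e ≤ y e) :
    cost p (digitPool y) (carryVec p f K N) ≤ N := by
  rw [← natCast_selectedValue]
  conv_rhs => rw [← sum_digit hN, ← sum_class (f := f)]
  rw [Nat.cast_le, selectedValue]
  refine Finset.sum_le_sum fun j _ => ?_
  rw [mult_carryVec hp hN hd, Int.toNat_natCast]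
  exact sum_digitPool_le hp hM hy j K

/-- The cost is strictly increasing along nested chains. -/
theorem cost_lt_cost (hp : 2 ≤ p) (ε : ZMod f → ℕ → ℕ) {l l' : ZMod f → ℤ}
    (h0 : ∀ j, 0 ≤ mult p l j) (h : ∀ j, mult p l j ≤ mult p l' j) (hlt : ∀ i, l i + 1 ≤ l' i) :
    cost p ε l < cost p ε l' := by
  refine Finset.sum_lt_sum (fun j _ => partialCost_mono ε j (h j)) ?_
  have hsum : ∀ l : ZMod f → ℤ, ∑ j, mult p l j = (p - 1) * ∑ j, l j := by
    intro l
    have : ∑ j, l (j + 1) = ∑ j, l j := Equiv.sum_comp (Equiv.addRight (1 : ZMod f)) l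
    simp only [mult]
    rw [Finset.sum_sub_distrib, ← Finset.mul_sum, this]
    ring
  have h1 : ∑ j, mult p l j < ∑ j, mult p l' j := by
    rw [hsum, hsum]
    have hp' : (2 : ℤ) ≤ p := by exact_mod_cast hp
    refine mul_lt_mul_of_pos_left ?_ (by omega)
    exact Finset.sum_lt_sum_of_nonempty Finset.univ_nonempty fun i _ => by linarith [hlt i]
  obtain ⟨j, -, hj⟩ := Finset.exists_lt_of_sum_lt h1
  refine ⟨j, Finset.mem_univ _, ?_⟩
  have h2 := partialCost_succ (p := p) ε j (h0 j)
  have h3 := partialCost_mono (p := p) ε j (show mult p l j + 1 ≤ mult p l' j by omega)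
  have h4 : (0 : ℤ) < (p : ℤ) ^ ε j (mult p l j).toNat := by positivity
  linarith

end Carries

/-! ### Digit chains -/

section DigitChains

variable {p f : ℕ}

/-- `IsDigitChain p q d N c`: there is a chain `0 < N₁ < ⋯ < N_d = N` of multiples of `q - 1` with
the digits of each of them bounded by those of the next, and `c = N₁ + ⋯ + N_d`. -/
inductive IsDigitChain (p q : ℕ) : ℕ → ℕ → ℕ → Prop
  | zero : IsDigitChain p q 0 0 0
  | step {d N' N c : ℕ} : IsDigitChain p q d N' c → N' < N → DigitLE p N' N → q - 1 ∣ N →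
      IsDigitChain p q (d + 1) N (c + N)

/-- The digits of `Y` at the places below `K`, followed by digits `p - 1`. The padding makes the pool
infinite; it is harmless as long as only numbers below `p ^ K` occur. -/
def paddedDigit (p Y K e : ℕ) : ℕ := if e < K then digit p Y e else p - 1

theorem paddedDigit_lt (hp : 2 ≤ p) (Y K e : ℕ) : paddedDigit p Y K e < p := by
  rw [paddedDigit]
  split_ifs
  · exact digit_lt hp Y e
  · omega

theorem paddedDigit_of_le (p Y K : ℕ) : ∀ e, K ≤ e → paddedDigit p Y K e = p - 1 := fun e he => by
  rw [paddedDigit, if_neg (by omega)]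

theorem DigitLE.le_paddedDigit (hp : 2 ≤ p) {N Y : ℕ} (h : DigitLE p N Y) (K e : ℕ) :
    digit p N e ≤ paddedDigit p Y K e := by
  rw [paddedDigit]
  split_ifs
  · exact h e
  · have := digit_lt hp N e
    omega

theorem digitLE_of_le_paddedDigit (hp : 2 ≤ p) {N Y K : ℕ} (hN : N < p ^ K)
    (h : ∀ e, digit p N e ≤ paddedDigit p Y K e) : DigitLE p N Y := by
  intro e
  have h1 := h e
  rw [paddedDigit] at h1
  split_ifs at h1 with h2
  · exact h1
  · rw [digit_eq_zero (hN.trans_le (Nat.pow_le_pow_right (by omega) (by omega)))]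
    exact Nat.zero_le _

theorem IsDigitChain.dvd {q d N c : ℕ} (h : IsDigitChain p q d N c) : q - 1 ∣ N := by
  cases h with
  | zero => exact dvd_zero _
  | step _ _ _ h => exact h

theorem IsNestedChain.mult_nonneg {d : ℕ} {r : ℕ → ZMod f → ℤ} (h : IsNestedChain p d r) {a : ℕ}
    (ha : a < d) (j : ZMod f) : 0 ≤ mult p (r a) j := by
  induction a with
  | zero => exact h.2.1 ha j
  | succ a ih => exact (ih (by omega)).trans (h.2.2 a ha j)

theorem mult_zero (p : ℕ) (j : ZMod f) : mult p (0 : ZMod f → ℤ) j = 0 := by simp [mult]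

variable [NeZero f] {y : ℕ → ℕ} {M : ℕ}

/-- The vectors of carries of a digit chain form a strict chain. -/
theorem IsDigitChain.exists_isStrictChain (hp : 2 ≤ p) (hM : ∀ e, M ≤ e → y e = p - 1) {K d : ℕ}
    {N c : ℕ} (h : IsDigitChain p (p ^ f) (d + 1) N c) (hN : N < p ^ K)
    (hy : ∀ e, digit p N e ≤ y e) :
    ∃ r : ℕ → ZMod f → ℤ, IsStrictChain (d + 1) r ∧ r d = carryVec p f K N ∧
      chainCost p (digitPool y) (d + 1) r + (N - cost p (digitPool y) (carryVec p f K N)) ≤ c := by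
  induction d generalizing N c with
  | zero =>
    cases h with
    | step h' hlt hle hd =>
      cases h' with
      | zero =>
        refine ⟨fun _ => carryVec p f K N, ⟨fun i => ?_, fun a ha => by omega⟩, rfl, ?_⟩
        · have := carryVec_add_one_le hp hN hd (dvd_zero _) hlt hle i
          rwa [carryVec_zero, zero_add] at this
        · simp [chainCost]
  | succ d ih =>
    cases h with
    | @step _ N' _ c' h' hlt hle hd =>
      obtain ⟨r, hr, hrd, hrc⟩ := ih h' (hlt.trans hN) fun e => (hle e).trans (hy e)
      have h1 := cost_carryVec_le hp hM (hlt.trans hN) h'.dvd fun e => (hle e).trans (hy e)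
      refine ⟨Function.update r (d + 1) (carryVec p f K N), ⟨?_, ?_⟩, by simp, ?_⟩
      · rw [Function.update_of_ne (by omega)]
        exact hr.1
      · intro a ha i
        rw [Function.update_of_ne (show a ≠ d + 1 by omega)]
        rcases eq_or_ne a d with rfl | had
        · rw [Function.update_self, hrd]
          exact carryVec_add_one_le hp hN hd h'.dvd hlt hle i
        · rw [Function.update_of_ne (by omega)]
          exact hr.2 a (by omega) i
      · have h2 : ∑ a ∈ Finset.range (d + 1), cost p (digitPool y)
            (Function.update r (d + 1) (carryVec p f K N) a) =
              chainCost p (digitPool y) (d + 1) r := by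
          refine Finset.sum_congr rfl fun a ha => ?_
          rw [Function.update_of_ne (Finset.mem_range.1 ha).ne]
        rw [chainCost, Finset.sum_range_succ, h2, Function.update_self]
        push_cast
        linarith

theorem chainCost_eq_natCast (n : ℕ) (r : ℕ → ZMod f → ℤ) :
    chainCost p (digitPool y) n r = ((∑ a ∈ Finset.range n, selectedValue p y (r a) : ℕ) : ℤ) := by
  rw [chainCost, Nat.cast_sum]
  exact Finset.sum_congr rfl fun a _ => (natCast_selectedValue y _).symm

theorem digit_selectedValue_le (hp : 2 ≤ p) (hy : ∀ e, y e < p)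
    (hM : ∀ e, M ≤ e → y e = p - 1) (l : ZMod f → ℤ) (e : ℕ) :
    digit p (selectedValue p y l) e ≤ y e := by
  rw [digit_selectedValue hp hy hM]
  exact selectedDigit_le y _ e

theorem selectedValue_zero (p : ℕ) (y : ℕ → ℕ) : selectedValue p y (0 : ZMod f → ℤ) = 0 := by
  simp [selectedValue, mult_zero]

theorem selectedValue_lt (hp : 2 ≤ p) {l l' : ZMod f → ℤ}
    (h0 : ∀ j, 0 ≤ mult p l j) (h : ∀ j, mult p l j ≤ mult p l' j) (hlt : ∀ i, l i + 1 ≤ l' i) :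
    selectedValue p y l < selectedValue p y l' := by
  have := cost_lt_cost hp (digitPool y) h0 h hlt
  rw [← natCast_selectedValue, ← natCast_selectedValue] at this
  exact_mod_cast this

/-- The values of the vectors of a nested chain form a digit chain. -/
theorem IsNestedChain.isDigitChain (hp : 2 ≤ p) (hy : ∀ e, y e < p)
    (hM : ∀ e, M ≤ e → y e = p - 1) {d : ℕ} {r : ℕ → ZMod f → ℤ} (h : IsNestedChain p d r) {a : ℕ}
    (ha : a < d) :
    IsDigitChain p (p ^ f) (a + 1) (selectedValue p y (r a))
      (∑ b ∈ Finset.range (a + 1), selectedValue p y (r b)) := by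
  have hε := isPool_digitPool (f := f) hp hy hM
  induction a with
  | zero =>
    rw [zero_add, Finset.sum_range_one]
    conv => arg 5; rw [← zero_add (selectedValue p y (r 0))]
    refine .step .zero ?_ (fun e => by simp [digit_zero_left])
      (dvd_selectedValue (by omega) hε (h.2.1 ha))
    have h1 := selectedValue_lt (y := y) hp (l := 0) (l' := r 0) (fun j => (mult_zero p j).ge)
      (fun j => by rw [mult_zero]; exact h.2.1 ha j) fun i => by simpa using h.1.1 i
    rwa [selectedValue_zero] at h1
  | succ a ih =>
    rw [Finset.sum_range_succ]
    refine .step (ih (by omega)) ?_ (fun e => ?_)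
      (dvd_selectedValue (by omega) hε (h.mult_nonneg ha))
    · exact selectedValue_lt hp (h.mult_nonneg (by omega)) (h.2.2 a ha) (h.1.2 a ha)
    · rw [digit_selectedValue hp hy hM, digit_selectedValue hp hy hM]
      exact selectedDigit_mono y (fun j => Int.toNat_le_toNat (h.2.2 a ha j)) e

/-- A strict chain of small cost yields a digit chain below `Y` that is not more expensive. -/
theorem IsStrictChain.exists_isDigitChain (hp : 2 ≤ p) {Y K n c : ℕ} (hK : c < p ^ K)
    {r : ℕ → ZMod f → ℤ} (hr : IsStrictChain (n + 1) r)
    (hc : chainCost p (digitPool (paddedDigit p Y K)) (n + 1) r ≤ c) :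
    ∃ N c', IsDigitChain p (p ^ f) (n + 1) N c' ∧ DigitLE p N Y ∧ c' ≤ c := by
  have hy := paddedDigit_lt hp Y K
  have hM := paddedDigit_of_le p Y K
  obtain ⟨r', h1, h2⟩ := hr.exists_nested hp (isPool_digitPool (f := f) hp hy hM)
  have h3 := h2.trans hc
  rw [chainCost_eq_natCast, Nat.cast_le] at h3
  refine ⟨_, _, h1.isDigitChain hp hy hM (Nat.lt_succ_self n), ?_, h3⟩
  refine digitLE_of_le_paddedDigit hp (K := K) ?_ (digit_selectedValue_le hp hy hM _)
  rw [Finset.sum_range_succ] at h3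
  omega

/-- The last number of a cheapest digit chain of length `d` below `Y` is the least number that ends
any such chain. -/
theorem IsDigitChain.top_le (hp : 2 ≤ p) {Y d N c : ℕ} (h : IsDigitChain p (p ^ f) d N c)
    (hN : DigitLE p N Y)
    (hmin : ∀ N' c', IsDigitChain p (p ^ f) d N' c' → DigitLE p N' Y → c ≤ c') {N' c' : ℕ}
    (h' : IsDigitChain p (p ^ f) d N' c') (hN' : DigitLE p N' Y) : N ≤ N' := by
  cases d with
  | zero => cases h; exact Nat.zero_le _
  | succ n =>
    set K := Y + c with hK
    have hYK : Y < p ^ K := (Nat.lt_pow_self hp).trans_le (Nat.pow_le_pow_right (by omega) (by omega))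
    have hcK : c < p ^ K := (Nat.lt_pow_self hp).trans_le (Nat.pow_le_pow_right (by omega) (by omega))
    have hy := paddedDigit_lt hp Y K
    have hM := paddedDigit_of_le p Y K
    have hε := isPool_digitPool (f := f) hp hy hM
    have hNK : N < p ^ K := (hN.le hp).trans_lt hYK
    have hNK' : N' < p ^ K := (hN'.le hp).trans_lt hYK
    -- no strict chain is cheaper than `c`
    have hcheap : ∀ r : ℕ → ZMod f → ℤ, IsStrictChain (n + 1) r →
        c ≤ chainCost p (digitPool (paddedDigit p Y K)) (n + 1) r := by
      intro r hr
      by_contra hlt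
      push Not at hlt
      have h0 := chainCost_nonneg (p := p) (digitPool (paddedDigit p Y K)) (n + 1) r
      obtain ⟨N'', c'', h1, h2, h3⟩ := hr.exists_isDigitChain hp (Y := Y) (K := K) (c := c - 1)
        (by omega) (by omega)
      have := hmin _ _ h1 h2
      omega
    obtain ⟨t, ht⟩ := exists_isOptimalTop (f := f) hp (digitPool (paddedDigit p Y K))
      (d := (n : ℤ) + 1) (by omega)
    obtain ⟨r, hr, hrn, hrc⟩ := h.exists_isStrictChain hp hM hNK (hN.le_paddedDigit hp K)
    have hcN := cost_carryVec_le hp hM hNK h.dvd (hN.le_paddedDigit hp K)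
    have hrt : r n = t := by
      by_contra hne
      obtain ⟨g, hg, hgc⟩ := hr.exists_cheaper hp hε ht (fun j => by
        rw [hrn, mult_carryVec hp hNK h.dvd]; positivity) hne
      have := hcheap g hg
      linarith
    have h1 := hcheap r hr
    obtain ⟨r', hr', hrn', -⟩ := h'.exists_isStrictChain hp hM hNK' (hN'.le_paddedDigit hp K)
    have h2 := cost_carryVec_le hp hM hNK' h'.dvd (hN'.le_paddedDigit hp K)
    have h3 := (ht.2.2 (carryVec p f K N') (fun j => by
      rw [mult_carryVec hp hNK' h'.dvd]; positivity) (fun i => by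
        rw [← hrn']; exact_mod_cast hr'.le n (by omega) i)).1
    rw [hrn] at hrt
    rw [hrt] at hrc
    have : (N : ℤ) ≤ N' := by linarith
    exact_mod_cast this

/-- The last number of a digit chain exceeds the cost of some chain of length one less: lowering the
vector of carries by `s` divides the cost by `q ^ s` at least. -/
theorem IsDigitChain.exists_lt (hp : 2 ≤ p) {Y d N c : ℕ}
    (h : IsDigitChain p (p ^ f) (d + 1) N c) (hN : DigitLE p N Y) :
    ∃ N' c', IsDigitChain p (p ^ f) d N' c' ∧ DigitLE p N' Y ∧ c' < N := by
  have hN0 : 0 < N := by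
    cases h with
    | step _ hlt _ _ => omega
  cases d with
  | zero => exact ⟨0, 0, .zero, fun e => by simp [digit_zero_left], hN0⟩
  | succ n =>
    have hYK : Y < p ^ Y := Nat.lt_pow_self hp
    have hy := paddedDigit_lt hp Y Y
    have hM := paddedDigit_of_le p Y Y
    have hε := isPool_digitPool (f := f) hp hy hM
    have hNK : N < p ^ Y := (hN.le hp).trans_lt hYK
    obtain ⟨r, hr, hrn, -⟩ := h.exists_isStrictChain hp hM hNK (hN.le_paddedDigit hp Y)
    have hcN := cost_carryVec_le hp hM hNK h.dvd (hN.le_paddedDigit hp Y)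
    set l := carryVec p f Y N
    set ε : ZMod f → ℕ → ℕ := digitPool (paddedDigit p Y Y)
    have hl : ∀ i, (n : ℤ) + 2 ≤ l i := fun i => by
      rw [← hrn]
      have := hr.le (n + 1) (by omega) i
      push_cast at this
      linarith
    have hml : ∀ j, 0 ≤ mult p l j := fun j => by
      rw [mult_carryVec hp hNK h.dvd]; positivity
    -- the vector of `N` has coordinates at least `n + 2`, so subtracting constants gives a chain
    let g : ℕ → ZMod f → ℤ := fun a i => l i - ((n : ℤ) + 1 - a)
    have hg : IsStrictChain (n + 1) g := by
      refine ⟨fun i => ?_, fun a ha i => ?_⟩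
      · have := hl i
        simp only [g, Nat.cast_zero]
        omega
      · simp only [g]
        push_cast
        omega
    have hpos : 0 < cost p ε l := by
      have := cost_lt_cost hp ε (l := 0) (l' := l) (fun j => (mult_zero p j).ge)
        (fun j => by rw [mult_zero]; exact hml j) fun i => by
          have := hl i
          simp only [Pi.zero_apply]
          omega
      exact (cost_nonneg ε _).trans_lt this
    have hq := one_lt_pow_of_two_le (f := f) hp
    have hstep : ∀ s < n + 1, ((p : ℤ) ^ f) ^ (s + 1) * cost p ε (g (n + 1 - 1 - s)) ≤
        cost p ε l := by
      intro s hs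
      have h1 : ((n : ℤ) + 1 - (n + 1 - 1 - s : ℕ)) = (s + 1 : ℕ) := by omega
      rw [cost, cost, Finset.mul_sum]
      refine Finset.sum_le_sum fun j _ => ?_
      simp only [g]
      rw [mult_sub_const, h1]
      exact hε.pow_mul_partialCost_le hp j (s + 1) _
    have hsum := mul_geom_sum_lt (by omega) hpos (n + 1) hstep
    rw [Finset.sum_range_reflect (fun a => cost p ε (g a)) (n + 1)] at hsum
    have hgc : chainCost p ε (n + 1) g < N := by
      have h0 := chainCost_nonneg (p := p) ε (n + 1) g
      rw [chainCost] at h0 ⊢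
      nlinarith
    obtain ⟨N', c', h1, h2, h3⟩ := hg.exists_isDigitChain hp (Y := Y) (K := Y) (c := N - 1)
      (by omega) (by change chainCost p ε (n + 1) g ≤ _; omega)
    exact ⟨N', c', h1, h2, by omega⟩

end DigitChains

/-! ### Power sums of polynomials over a finite field -/

section Lucas

variable {p : ℕ}

/-- Lucas's theorem in characteristic `p`. -/
theorem natCast_choose_ne_zero_iff [Fact p.Prime] {R : Type*} [Ring R] [CharP R p] {N M : ℕ} :
    ((M.choose N : ℕ) : R) ≠ 0 ↔ DigitLE p N M := by
  have hp := (Fact.out : p.Prime)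
  set a := M + N
  have h1 : M < p ^ a := (Nat.lt_pow_self hp.one_lt).trans_le
    (Nat.pow_le_pow_right hp.pos (by omega))
  have h2 : N < p ^ a := (Nat.lt_pow_self hp.one_lt).trans_le
    (Nat.pow_le_pow_right hp.pos (by omega))
  have h3 := Choose.choose_modEq_prod_range_choose_nat (p := p) h1 h2
  rw [Ne, CharP.cast_eq_zero_iff R p, h3.dvd_iff dvd_rfl, hp.prime.dvd_finsetProd_iff]
  constructor
  · intro h e
    by_contra hlt
    push Not at hlt
    rcases lt_or_ge e a with he | he
    · refine h ⟨e, Finset.mem_range.2 he, ?_⟩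
      change p ∣ (digit p M e).choose (digit p N e)
      rw [Nat.choose_eq_zero_of_lt hlt]
      exact dvd_zero _
    · rw [digit_eq_zero (h2.trans_le (Nat.pow_le_pow_right hp.pos he))] at hlt
      omega
  · rintro h ⟨e, -, he⟩
    have h4 : M / p ^ e % p < p := Nat.mod_lt _ hp.pos
    have h5 := Nat.choose_pos (h e)
    have h6 := Nat.choose_mul_factorial_mul_factorial (h e)
    have h7 : p ∣ (digit p M e).factorial := by
      rw [← h6, mul_assoc]
      exact he.mul_right _
    rw [hp.dvd_factorial] at h7
    simp only [digit] at h7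
    omega

end Lucas

section PowerSums

variable {F : Type*} [Field F] [Fintype F]

theorem sum_pow_eq_ite (k : ℕ) :
    ∑ c : F, c ^ k = if 0 < k ∧ Fintype.card F - 1 ∣ k then -1 else 0 := by
  classical
  rcases Nat.eq_zero_or_pos k with rfl | hk
  · simp
  · have h1 := FiniteField.sum_pow_units F k
    rw [Finset.sum_eq_sum_sdiff_singleton_add (Finset.mem_univ (0 : F)), zero_pow hk.ne', add_zero]
    have h2 : ∑ x : Fˣ, (x : F) ^ k = ∑ c ∈ Finset.univ \ {(0 : F)}, c ^ k := by
      refine Finset.sum_nbij (fun x : Fˣ => (x : F)) (fun x _ => by simp)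
        (Units.val_injective.injOn) (fun c hc => ?_) fun _ _ => rfl
      have hc0 : c ≠ 0 := by simpa using hc
      exact ⟨Units.mk0 c hc0, by simp, rfl⟩
    rw [← h2, h1]
    simp [hk]

variable (F)

open Classical in
/-- The polynomials of degree less than `d` over a finite field. -/
def lowDegree : ℕ → Finset F[X]
  | 0 => {0}
  | d + 1 => (Finset.univ ×ˢ lowDegree d).image fun x : F × F[X] => C x.1 + X * x.2

variable {F}

theorem mem_lowDegree {d : ℕ} {w : F[X]} : w ∈ lowDegree F d ↔ ∀ i, d ≤ i → w.coeff i = 0 := by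
  induction d generalizing w with
  | zero => simp [lowDegree, Polynomial.ext_iff]
  | succ d ih =>
    simp only [lowDegree, Finset.mem_image, Finset.mem_product, Finset.mem_univ, true_and,
      Prod.exists]
    constructor
    · rintro ⟨c, u, hu, rfl⟩ i hi
      obtain ⟨i, rfl⟩ : ∃ k, i = k + 1 := ⟨i - 1, by omega⟩
      rw [coeff_add, coeff_C_succ, coeff_X_mul, zero_add]
      exact ih.1 hu i (by omega)
    · intro h
      refine ⟨w.coeff 0, w.divX, ih.2 fun i hi => ?_, by rw [add_comm, X_mul_divX_add]⟩
      rw [coeff_divX]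
      exact h _ (by omega)

theorem lowDegree_mono {d : ℕ} : lowDegree F d ⊆ lowDegree F (d + 1) := fun w hw =>
  mem_lowDegree.2 fun i hi => mem_lowDegree.1 hw i (by omega)

theorem sum_lowDegree_succ {R : Type*} [AddCommMonoid R] (d : ℕ) (g : F[X] → R) :
    ∑ w ∈ lowDegree F (d + 1), g w = ∑ w ∈ lowDegree F d, ∑ c : F, g (C c + X * w) := by
  classical
  rw [lowDegree, Finset.sum_image, Finset.sum_product_right]
  rintro ⟨c, w⟩ - ⟨c', w'⟩ - h
  simp only at h
  have h0 : c = c' := by simpa using congrArg (fun u => u.coeff 0) h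
  subst h0
  rw [add_right_inj] at h
  rw [mul_left_cancel₀ X_ne_zero h]

/-- The contribution `X ^ N ∑ w ^ N`, the sum being over all polynomials `w` of degree less than
`d`, of the `N`-th binomial term to the sum of the powers of the polynomials `1 + X w`. -/
def binomialTerm (F : Type*) [Field F] [Fintype F] (d N : ℕ) : F[X] :=
  X ^ N * ∑ w ∈ lowDegree F d, w ^ N

theorem binomialTerm_zero (N : ℕ) : binomialTerm F 0 N = if N = 0 then 1 else 0 := by
  rw [binomialTerm, lowDegree, Finset.sum_singleton]
  split_ifs with h
  · simp [h]
  · simp [h]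

/-- The recursion comes from writing a polynomial of degree at most `d` as `c + X w` and summing over
the constant term `c` first. -/
theorem binomialTerm_succ (d N : ℕ) :
    binomialTerm F (d + 1) N = -(X ^ N * ∑ N' ∈ (Finset.range N).filter
      (fun N' => Fintype.card F - 1 ∣ N - N'), ((N.choose N' : ℕ) : F[X]) * binomialTerm F d N') := by
  have h1 : ∀ w : F[X], ∑ c : F, (C c + X * w) ^ N =
      -∑ N' ∈ (Finset.range N).filter (fun N' => Fintype.card F - 1 ∣ N - N'),
        ((N.choose N' : ℕ) : F[X]) * (X ^ N' * w ^ N') := by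
    intro w
    simp_rw [add_comm (C _) (X * w), add_pow]
    rw [Finset.sum_comm, ← Finset.sum_neg_distrib, Finset.sum_filter, Finset.sum_range_succ]
    have h2 : ∀ N', ∑ c : F, (X * w) ^ N' * C c ^ (N - N') * ((N.choose N' : ℕ) : F[X]) =
        ((N.choose N' : ℕ) : F[X]) * (X ^ N' * w ^ N') *
          C (if 0 < N - N' ∧ Fintype.card F - 1 ∣ N - N' then -1 else 0) := by
      intro N'
      rw [← sum_pow_eq_ite, map_sum, Finset.mul_sum]
      refine Finset.sum_congr rfl fun c _ => ?_
      rw [map_pow, mul_pow]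
      ring
    rw [h2 N, if_neg (by simp), map_zero, mul_zero, add_zero]
    refine Finset.sum_congr rfl fun N' hN' => ?_
    rw [h2]
    have := Finset.mem_range.1 hN'
    by_cases h3 : Fintype.card F - 1 ∣ N - N'
    · rw [if_pos h3, if_pos ⟨by omega, h3⟩, map_neg, map_one, mul_neg_one]
    · rw [if_neg h3, if_neg fun h => h3 h.2, map_zero, mul_zero]
  rw [binomialTerm, sum_lowDegree_succ, Finset.sum_congr rfl fun w _ => h1 w,
    Finset.sum_neg_distrib, Finset.sum_comm, mul_neg]
  congr 2
  refine Finset.sum_congr rfl fun N' _ => ?_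
  rw [← Finset.mul_sum, ← Finset.mul_sum, binomialTerm]

/-- The sum of the `Y`-th powers of all polynomials with constant term `1` and degree at most
`d`. -/
def unitPowerSum (F : Type*) [Field F] [Fintype F] (d Y : ℕ) : F[X] :=
  ∑ w ∈ lowDegree F d, (1 + X * w) ^ Y

theorem unitPowerSum_zero (Y : ℕ) : unitPowerSum F 0 Y = 1 := by
  simp [unitPowerSum, lowDegree]

theorem unitPowerSum_eq (d Y : ℕ) :
    unitPowerSum F d Y =
      ∑ N ∈ Finset.range (Y + 1), ((Y.choose N : ℕ) : F[X]) * binomialTerm F d N := by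
  rw [unitPowerSum]
  simp_rw [add_comm (1 : F[X]), add_pow, one_pow, mul_one]
  rw [Finset.sum_comm]
  refine Finset.sum_congr rfl fun N _ => ?_
  rw [binomialTerm, Finset.mul_sum, Finset.mul_sum]
  refine Finset.sum_congr rfl fun w _ => ?_
  rw [mul_pow, mul_comm]

variable {p f : ℕ} [Fact p.Prime] [CharP F p]

theorem exists_ne_zero_of_coeff_sum_ne_zero {S : Finset ℕ} {Y m d : ℕ}
    (h : (∑ N ∈ S, ((Y.choose N : ℕ) : F[X]) * binomialTerm F d N).coeff m ≠ 0) :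
    ∃ N ∈ S, DigitLE p N Y ∧ (binomialTerm F d N).coeff m ≠ 0 := by
  rw [finsetSum_coeff] at h
  obtain ⟨N, hN, h1⟩ := Finset.exists_ne_zero_of_sum_ne_zero h
  rw [coeff_natCast_mul] at h1
  exact ⟨N, hN, natCast_choose_ne_zero_iff.1 (left_ne_zero_of_mul h1), right_ne_zero_of_mul h1⟩

/-- Every monomial in a binomial term comes from a digit chain. -/
theorem isDigitChain_of_coeff_ne_zero (hF : Fintype.card F = p ^ f) {d N m : ℕ}
    (h : (binomialTerm F d N).coeff m ≠ 0) : IsDigitChain p (p ^ f) d N m := by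
  induction d generalizing N m with
  | zero =>
    rw [binomialTerm_zero] at h
    split_ifs at h with h0
    · rw [coeff_one] at h
      split_ifs at h with h1
      · subst h0 h1
        exact .zero
      · exact absurd rfl h
    · simp at h
  | succ d ih =>
    rw [binomialTerm_succ, coeff_neg, coeff_X_pow_mul'] at h
    split_ifs at h with hm
    · obtain ⟨N', hN', hle, h1⟩ := exists_ne_zero_of_coeff_sum_ne_zero (p := p)
        (neg_ne_zero.1 h)
      rw [Finset.mem_filter, Finset.mem_range, hF] at hN'
      have h2 := ih h1
      have h3 := IsDigitChain.step h2 hN'.1 hle ((Nat.dvd_sub_iff_left hN'.1.le h2.dvd).1 hN'.2)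
      rwa [Nat.sub_add_cancel hm] at h3
    · simp at h

variable [NeZero f]

/-- The monomials of least degree do not cancel, as only one of them comes from a cheapest chain. -/
theorem coeff_sum_ne_zero (hF : Fintype.card F = p ^ f) {S : Finset ℕ} {Y d N c : ℕ} (hN : N ∈ S)
    (hNY : DigitLE p N Y) (h : IsDigitChain p (p ^ f) d N c)
    (hmin : ∀ N' c', IsDigitChain p (p ^ f) d N' c' → DigitLE p N' Y → c ≤ c')
    (hcoeff : (binomialTerm F d N).coeff c ≠ 0) :
    (∑ N ∈ S, ((Y.choose N : ℕ) : F[X]) * binomialTerm F d N).coeff c ≠ 0 := by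
  have hp := (Fact.out : p.Prime).two_le
  rw [finsetSum_coeff, Finset.sum_eq_single N]
  · rw [coeff_natCast_mul]
    exact mul_ne_zero (natCast_choose_ne_zero_iff.2 hNY) hcoeff
  · intro N' _ hne
    by_contra h1
    rw [coeff_natCast_mul] at h1
    have h2 := natCast_choose_ne_zero_iff.1 (left_ne_zero_of_mul h1)
    have h3 := isDigitChain_of_coeff_ne_zero hF (right_ne_zero_of_mul h1)
    exact hne (le_antisymm (h3.top_le hp h2 hmin h hNY) (h.top_le hp hNY hmin h3 h2))
  · exact fun h => absurd hN h

/-- The cheapest digit chain ending in `N` gives a monomial that does occur in the binomial term. -/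
theorem coeff_binomialTerm_ne_zero (hF : Fintype.card F = p ^ f) {d N c : ℕ}
    (h : IsDigitChain p (p ^ f) d N c) (hmin : ∀ c', IsDigitChain p (p ^ f) d N c' → c ≤ c') :
    (binomialTerm F d N).coeff c ≠ 0 := by
  have hp := (Fact.out : p.Prime).two_le
  induction d generalizing N c with
  | zero =>
    cases h
    simp [binomialTerm_zero]
  | succ d ih =>
    cases h with
    | @step _ N₀ _ c₀ h₀ hlt hle hd =>
      -- the cheapest chain below `N` ends before `N`
      have hmin₀ : ∀ N' c', IsDigitChain p (p ^ f) d N' c' → DigitLE p N' N → c₀ ≤ c' := by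
        classical
        have hex : ∃ c', ∃ N', IsDigitChain p (p ^ f) d N' c' ∧ DigitLE p N' N := ⟨c₀, N₀, h₀, hle⟩
        obtain ⟨N₁, h₁, hle₁⟩ := Nat.find_spec hex
        have hmin₁ : ∀ N' c', IsDigitChain p (p ^ f) d N' c' → DigitLE p N' N →
            Nat.find hex ≤ c' := fun N' c' h' hle' => Nat.find_min' hex ⟨N', h', hle'⟩
        have h2 : N₁ ≤ N₀ := h₁.top_le hp hle₁ hmin₁ h₀ hle
        have h3 := hmin _ (h₁.step (h2.trans_lt hlt) hle₁ hd)
        intro N' c' h' hle'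
        have := hmin₁ N' c' h' hle'
        omega
      rw [binomialTerm_succ, coeff_neg, coeff_X_pow_mul', if_pos (Nat.le_add_left _ _),
        Nat.add_sub_cancel]
      refine neg_ne_zero.2 (coeff_sum_ne_zero hF ?_ hle h₀ hmin₀ (ih h₀ fun c' h' =>
        hmin₀ N₀ c' h' hle))
      rw [Finset.mem_filter, Finset.mem_range, hF]
      exact ⟨hlt, Nat.dvd_sub hd h₀.dvd⟩

/-- The orders of vanishing at `0` of the sums of powers of one-units more than double from one
degree to the next. -/
theorem unitPowerSum_order (hF : Fintype.card F = p ^ f) {d Y : ℕ}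
    (h : unitPowerSum F (d + 1) Y ≠ 0) :
    unitPowerSum F d Y ≠ 0 ∧ 2 * (unitPowerSum F d Y).natTrailingDegree + 1 ≤
      (unitPowerSum F (d + 1) Y).natTrailingDegree := by
  classical
  have hp := (Fact.out : p.Prime).two_le
  set m := (unitPowerSum F (d + 1) Y).natTrailingDegree with hm
  have h1 : (unitPowerSum F (d + 1) Y).coeff m ≠ 0 := by
    rw [hm, ← trailingCoeff]
    exact trailingCoeff_nonzero_iff_nonzero.2 h
  rw [unitPowerSum_eq] at h1
  obtain ⟨N, -, hNY, h2⟩ := exists_ne_zero_of_coeff_sum_ne_zero (p := p) h1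
  have h3 := isDigitChain_of_coeff_ne_zero hF h2
  obtain ⟨N₂, c₂, h4, h5, h6⟩ := h3.exists_lt hp hNY
  have hex : ∃ c', ∃ N', IsDigitChain p (p ^ f) d N' c' ∧ DigitLE p N' Y := ⟨c₂, N₂, h4, h5⟩
  obtain ⟨N₁, h₁, hle₁⟩ := Nat.find_spec hex
  have hmin₁ : ∀ N' c', IsDigitChain p (p ^ f) d N' c' → DigitLE p N' Y →
      Nat.find hex ≤ c' := fun N' c' h' hle' => Nat.find_min' hex ⟨N', h', hle'⟩
  have h7 : (unitPowerSum F d Y).coeff (Nat.find hex) ≠ 0 := by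
    rw [unitPowerSum_eq]
    refine coeff_sum_ne_zero hF (Finset.mem_range.2 (Nat.lt_succ_of_le (hle₁.le hp))) hle₁ h₁ hmin₁
      (coeff_binomialTerm_ne_zero hF h₁ fun c' h' => hmin₁ N₁ c' h' hle₁)
  refine ⟨fun h0 => h7 (by rw [h0, coeff_zero]), ?_⟩
  have h8 := natTrailingDegree_le_of_ne_zero h7
  have h9 := hmin₁ _ _ h4 h5
  clear_value m
  cases h3 with
  | @step _ N' _ c' h' _ hle _ =>
    have h10 := hmin₁ _ _ h' (hle.trans hNY)
    omega

end PowerSums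

/-! ### Primes of degree one and the coefficients of the zeta function -/

theorem norm_sub_le_max_norm {S : Type*} [SeminormedAddCommGroup S] [IsUltrametricDist S]
    (x y : S) : ‖x - y‖ ≤ max ‖x‖ ‖y‖ := by
  rw [sub_eq_add_neg, ← norm_neg y]
  exact IsUltrametricDist.norm_add_le_max x (-y)

section DegreeOne

variable {F : Type*} [Field F] {v : HeightOneSpectrum F[X]}

theorem exists_asIdeal_eq_span (hv : degree v = 1) : ∃ α : F, v.asIdeal = Ideal.span {X - C α} := by
  obtain ⟨g, hg⟩ := (IsPrincipalIdealRing.principal v.asIdeal).principal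
  have hg' : v.asIdeal = Ideal.span {g} := hg
  have h1 : g.natDegree = 1 := by
    rw [← finrank_quotient_span_eq_natDegree, ← hg', ← degree, hv]
  have h2 : g.degree = 1 := by
    rw [degree_eq_natDegree (by rintro rfl; simp at h1), h1, Nat.cast_one]
  obtain ⟨α, hα⟩ := exists_root_of_degree_eq_one h2
  refine ⟨α, (v.isMaximal.eq_of_le ?_ ?_)⟩
  · rw [Ne, Ideal.span_singleton_eq_top]
    exact (irreducible_X_sub_C α).not_isUnit
  · rw [hg', Ideal.span_singleton_le_span_singleton]
    exact dvd_iff_isRoot.2 hα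

theorem valued_algebraMap (n : F[X]) :
    Valued.v (algebraMap F[X] (LocalField v) n) = v.intValuation n := by
  rw [← v.valuation_of_algebraMap (K := RatFunc F) n]
  exact HeightOneSpectrum.valuedAdicCompletion_eq_valuation' v _

variable {α : F} (hα : v.asIdeal = Ideal.span {X - C α})
include hα

theorem mem_asIdeal_iff {n : F[X]} : n ∈ v.asIdeal ↔ n.eval α = 0 := by
  rw [hα, Ideal.mem_span_singleton, dvd_iff_isRoot, IsRoot]

theorem card_pow_degree : Nat.card F ^ degree v = Nat.card F := by
  rw [degree, hα, finrank_quotient_span_eq_natDegree, natDegree_X_sub_C, pow_one]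

variable [Fintype F]

/-- The monic polynomials of degree `d + 1` prime to `X - α` are, up to constants, the polynomials
`1 + (X - α) w` with `w` of exact degree `d` in the variable `X - α`. -/
theorem sum_pow_monic {d e : ℕ} (he : Fintype.card F - 1 ∣ e) :
    ∑ n ∈ (finite_monic_natDegree_eq v (d + 1)).toFinset, n ^ e =
      taylor (-α) (unitPowerSum F (d + 1) e - unitPowerSum F d e) := by
  classical
  rw [unitPowerSum, unitPowerSum, ← Finset.sum_sdiff (lowDegree_mono (d := d)), add_sub_cancel_right,
    map_sum]
  have hc : ∀ a : F, a ≠ 0 → a ^ e = 1 := fun a ha => by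
    obtain ⟨k, rfl⟩ := he
    rw [pow_mul, FiniteField.pow_card_sub_one_eq_one a ha, one_pow]
  have hmem : ∀ w : F[X], w ∈ lowDegree F (d + 1) \ lowDegree F d ↔
      (∀ i, d + 1 ≤ i → w.coeff i = 0) ∧ w.coeff d ≠ 0 := by
    intro w
    rw [Finset.mem_sdiff, mem_lowDegree, mem_lowDegree]
    refine and_congr_right fun h => not_congr ⟨fun h' => h' d le_rfl, fun h' i hi => ?_⟩
    rcases hi.eq_or_lt with rfl | hi
    · exact h'
    · exact h i hi
  symm
  refine Finset.sum_nbij (fun w => taylor (-α) (C (w.coeff d)⁻¹ * (1 + X * w))) ?_ ?_ ?_ ?_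
  · intro w hw
    obtain ⟨h1, h2⟩ := (hmem w).1 hw
    set u := C (w.coeff d)⁻¹ * (1 + X * w) with hu
    have hcoeff : ∀ i, u.coeff (i + 1) = (w.coeff d)⁻¹ * w.coeff i := fun i => by
      rw [hu, coeff_C_mul, coeff_add, coeff_X_mul, coeff_one, if_neg (by omega), zero_add]
    have h3 : u.natDegree = d + 1 := by
      refine natDegree_eq_of_le_of_coeff_ne_zero (natDegree_le_iff_coeff_eq_zero.2 fun i hi => ?_) ?_
      · obtain ⟨i, rfl⟩ : ∃ k, i = k + 1 := ⟨i - 1, by omega⟩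
        rw [hcoeff, h1 i (by omega), mul_zero]
      · rw [hcoeff, inv_mul_cancel₀ h2]
        exact one_ne_zero
    rw [Set.Finite.mem_toFinset]
    refine ⟨?_, by rw [natDegree_taylor, h3], ?_⟩
    · rw [Monic, leadingCoeff_taylor, leadingCoeff, h3, hcoeff, inv_mul_cancel₀ h2]
    · rw [mem_asIdeal_iff hα, taylor_eval, add_neg_cancel]
      simpa [u] using h2
  · intro w hw w' hw' h
    obtain ⟨h1, h2⟩ := (hmem w).1 hw
    obtain ⟨h1', h2'⟩ := (hmem w').1 hw'
    have h3 := taylor_injective _ h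
    have h4 : (w.coeff d)⁻¹ = (w'.coeff d)⁻¹ := by
      simpa using congrArg (fun u => u.coeff 0) h3
    rw [h4] at h3
    have h5 := mul_left_cancel₀ (C_ne_zero.2 (inv_ne_zero h2')) h3
    rw [add_right_inj] at h5
    exact mul_left_cancel₀ X_ne_zero h5
  · intro n hn
    rw [Set.Finite.coe_toFinset] at hn
    obtain ⟨h1, h2, h3⟩ := hn
    rw [mem_asIdeal_iff hα] at h3
    set u := taylor α n with hu
    have h0 : u.coeff 0 = n.eval α := taylor_coeff_zero ..
    have hd : u.coeff (d + 1) = 1 := by rw [← h2, hu, coeff_taylor_natDegree]; exact h1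
    have hw : (C (n.eval α)⁻¹ * u.divX).coeff d = (n.eval α)⁻¹ := by
      rw [coeff_C_mul, coeff_divX, hd, mul_one]
    refine ⟨C (n.eval α)⁻¹ * u.divX, ?_, ?_⟩
    · rw [Finset.mem_coe, hmem, hw]
      refine ⟨fun i hi => ?_, inv_ne_zero h3⟩
      rw [coeff_C_mul, coeff_divX, coeff_eq_zero_of_natDegree_lt, mul_zero]
      rw [hu, natDegree_taylor]
      omega
    · simp only [hw, inv_inv]
      have h4 : C (n.eval α) * (1 + X * (C (n.eval α)⁻¹ * u.divX)) = u := by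
        have h5 : C (n.eval α) * C (n.eval α)⁻¹ = 1 := by
          rw [← C_mul, mul_inv_cancel₀ h3, C_1]
        conv_rhs => rw [← X_mul_divX_add u, h0]
        linear_combination (X * u.divX) * h5
      rw [h4, hu, taylor_taylor, neg_add_cancel, taylor_zero]
  · intro w hw
    rw [← taylor_pow, mul_pow, ← C_pow, hc _ (inv_ne_zero ((hmem w).1 hw).2), C_1, one_mul]

end DegreeOne

section LocalField

variable {F : Type*} [Field F] [Finite F] {v : HeightOneSpectrum F[X]}

theorem finite_monic_natDegree_zero_toFinset :
    (finite_monic_natDegree_eq v 0).toFinset = {1} := by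
  ext n
  rw [Set.Finite.mem_toFinset, Finset.mem_singleton, Set.mem_ofPred_eq]
  constructor
  · rintro ⟨h1, h2, -⟩
    exact h1.natDegree_eq_zero.1 h2
  · rintro rfl
    exact ⟨monic_one, natDegree_one, fun h => v.isPrime.ne_top ((Ideal.eq_top_iff_one _).2 h)⟩

theorem norm_algebraMap_le_one (n : F[X]) : ‖algebraMap F[X] (LocalField v) n‖ ≤ 1 := by
  have h := v.intValuation_le_one n
  rw [← valued_algebraMap] at h
  exact Valued.toNormedField.norm_le_one_iff.2 h

theorem norm_algebraMap_lt_one_iff (n : F[X]) :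
    ‖algebraMap F[X] (LocalField v) n‖ < 1 ↔ n ∈ v.asIdeal := by
  rw [← v.intValuation_lt_one_iff_mem, ← valued_algebraMap]
  exact Valued.toNormedField.norm_lt_one_iff

theorem norm_algebraMap_eq_one_iff (n : F[X]) :
    ‖algebraMap F[X] (LocalField v) n‖ = 1 ↔ n ∉ v.asIdeal := by
  rw [← norm_algebraMap_lt_one_iff, not_lt, ← ge_iff_le]
  exact ⟨fun h => h.ge, fun h => (norm_algebraMap_le_one n).antisymm h⟩

theorem norm_algebraMap_le_of_dvd {m n : F[X]} (h : m ∣ n) :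
    ‖algebraMap F[X] (LocalField v) n‖ ≤ ‖algebraMap F[X] (LocalField v) m‖ := by
  obtain ⟨k, rfl⟩ := h
  rw [map_mul, norm_mul]
  exact mul_le_of_le_one_right (norm_nonneg _) (norm_algebraMap_le_one k)

variable {α : F} (hα : v.asIdeal = Ideal.span {X - C α})
include hα

theorem norm_uniformizer_lt_one : ‖algebraMap F[X] (LocalField v) (X - C α)‖ < 1 := by
  rw [norm_algebraMap_lt_one_iff, mem_asIdeal_iff hα]
  simp

/-- The absolute value of a polynomial in `X - α` is determined by its order of vanishing. -/
theorem norm_algebraMap_taylor {u : F[X]} (hu : u ≠ 0) :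
    ‖algebraMap F[X] (LocalField v) (taylor (-α) u)‖ =
      ‖algebraMap F[X] (LocalField v) (X - C α)‖ ^ u.natTrailingDegree := by
  obtain ⟨w, hw⟩ : X ^ u.natTrailingDegree ∣ u :=
    X_pow_dvd_iff.2 fun d hd => coeff_eq_zero_of_lt_natTrailingDegree hd
  have h1 : w.coeff 0 ≠ 0 := by
    have h2 : u.coeff u.natTrailingDegree ≠ 0 := trailingCoeff_nonzero_iff_nonzero.2 hu
    have h3 : u.coeff u.natTrailingDegree = w.coeff 0 := by
      generalize u.natTrailingDegree = n at hw
      rw [hw, coeff_X_pow_mul', if_pos le_rfl, Nat.sub_self]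
    rwa [h3] at h2
  have h3 : ‖algebraMap F[X] (LocalField v) (taylor (-α) w)‖ = 1 := by
    rw [norm_algebraMap_eq_one_iff, mem_asIdeal_iff hα, taylor_eval, add_neg_cancel,
      ← coeff_zero_eq_eval_zero]
    exact h1
  conv_lhs => rw [hw]
  rw [taylor_mul, taylor_X_pow, map_mul, norm_mul, h3, mul_one, map_pow, norm_pow, C_neg,
    ← sub_eq_add_neg]

variable [Fintype F]

theorem norm_unitPowerSum_succ_le (d Y : ℕ) :
    ‖algebraMap F[X] (LocalField v) (taylor (-α) (unitPowerSum F (d + 1) Y))‖ ≤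
      ‖algebraMap F[X] (LocalField v) (X - C α)‖ *
        ‖algebraMap F[X] (LocalField v) (taylor (-α) (unitPowerSum F d Y))‖ ^ 2 := by
  obtain ⟨p, _, f, hp, hf⟩ := FiniteField.card' F
  by_cases h : unitPowerSum F (d + 1) Y = 0
  · rw [h, map_zero, map_zero, norm_zero]
    positivity
  · have : NeZero (f : ℕ) := ⟨f.pos.ne'⟩
    have : Fact p.Prime := ⟨hp⟩
    obtain ⟨h1, h2⟩ := unitPowerSum_order (p := p) hf h
    rw [norm_algebraMap_taylor hα h, norm_algebraMap_taylor hα h1, ← pow_mul, ← pow_succ']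
    exact pow_le_pow_of_le_one (norm_nonneg _) (norm_uniformizer_lt_one hα).le (by omega)

/-- In the difference of two consecutive sums of powers the one of lower degree dominates. -/
theorem norm_sum_pow_monic {e : ℕ} (he : Nat.card F - 1 ∣ e) (d : ℕ) :
    ‖algebraMap F[X] (LocalField v)
        (∑ n ∈ (finite_monic_natDegree_eq v (d + 1)).toFinset, n ^ e)‖ =
      ‖algebraMap F[X] (LocalField v) (taylor (-α) (unitPowerSum F d e))‖ := by
  rw [sum_pow_monic hα (by rwa [Nat.card_eq_fintype_card] at he), map_sub, map_sub]
  have h1 := norm_unitPowerSum_succ_le hα d e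
  set a := algebraMap F[X] (LocalField v) (taylor (-α) (unitPowerSum F (d + 1) e))
  set b := algebraMap F[X] (LocalField v) (taylor (-α) (unitPowerSum F d e)) with hb
  have h2 : ‖b‖ ≤ 1 := norm_algebraMap_le_one _
  have h3 := norm_uniformizer_lt_one hα
  set c := ‖algebraMap F[X] (LocalField v) (X - C α)‖
  rcases eq_or_ne b 0 with h0 | h0
  · rw [h0, norm_zero] at h1 ⊢
    have h4 : a = 0 := norm_le_zero_iff.1 (h1.trans (by simp))
    rw [h4, sub_zero, norm_zero]
  · have h4 : 0 < ‖b‖ := norm_pos_iff.2 h0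
    have h5 : ‖a‖ < ‖b‖ := by
      have h6 : c * ‖b‖ ^ 2 < 1 * ‖b‖ ^ 2 := mul_lt_mul_of_pos_right h3 (by positivity)
      nlinarith
    rw [sub_eq_add_neg, IsUltrametricDist.norm_add_eq_max_of_norm_ne_norm (by
      rw [norm_neg]; exact h5.ne),
      norm_neg, max_eq_right h5.le]

end LocalField

section Limits

variable {F : Type*} [Field F] {p : ℕ} [Fact p.Prime] {v : HeightOneSpectrum F[X]}

/-- The filter of natural numbers tending to `s` in the exponent space. -/
def exponentFilter (p : ℕ) [Fact p.Prime] (v : HeightOneSpectrum F[X]) (s : Exponent p v) :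
    Filter ℕ := comap (fun e : ℕ => (e : Exponent p v)) (𝓝 s)

theorem eventually_exponentFilter (s : Exponent p v) (k : ℕ) :
    ∀ᶠ e : ℕ in exponentFilter p v s,
      (e : ZMod (Nat.card F ^ degree v - 1)) = s.1 ∧ ‖(e : ℤ_[p]) - s.2‖ ≤ (p : ℝ) ^ (-k : ℤ) := by
  have hp := (Fact.out : p.Prime)
  have h1 : {a : ZMod (Nat.card F ^ degree v - 1) | a = s.1} ×ˢ
      Metric.closedBall s.2 ((p : ℝ) ^ (-k : ℤ)) ∈ 𝓝 s := by
    refine prod_mem_nhds ?_ (Metric.closedBall_mem_nhds _ (zpow_pos (by exact_mod_cast hp.pos) _))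
    exact (isOpen_discrete _).mem_nhds rfl
  refine ⟨_, h1, fun e he => ⟨he.1, ?_⟩⟩
  have := he.2
  rwa [Metric.mem_closedBall, dist_eq_norm] at this

variable [Finite F]

/-- The elements of the ideal `(r - 1)` have first component `0`. -/
theorem eventually_dvd {α : F} (hα : v.asIdeal = Ideal.span {X - C α}) {s : Exponent p v}
    (hs : s ∈ Ideal.span {(Nat.card F : Exponent p v) - 1}) :
    ∀ᶠ e in exponentFilter p v (-s), Nat.card F - 1 ∣ e := by
  obtain ⟨a, rfl⟩ := Ideal.mem_span_singleton.1 hs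
  refine (eventually_exponentFilter _ 0).mono fun e he => ?_
  have h1 := he.1
  have h2 : ((Nat.card F : ℕ) : ZMod (Nat.card F ^ degree v - 1)) = 1 := by
    have : Nat.card F = Nat.card F ^ degree v - 1 + 1 := by
      have := card_pow_degree hα
      have := Finite.one_lt_card (α := F)
      omega
    have h3 := congrArg (fun n : ℕ => (n : ZMod (Nat.card F ^ degree v - 1))) this
    rwa [Nat.cast_add, ZMod.natCast_self, zero_add, Nat.cast_one] at h3
  rw [Prod.fst_neg, Prod.fst_mul, Prod.fst_sub, Prod.fst_natCast, Prod.fst_one, h2, sub_self,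
    zero_mul, neg_zero, ZMod.natCast_eq_zero_iff, card_pow_degree hα] at h1
  exact h1

variable [CharP F p]

theorem coprime_card (p : ℕ) [Fact p.Prime] [CharP F p] (d : ℕ) (hd : 0 < d) :
    p.Coprime (Nat.card F ^ d - 1) := by
  have hp := (Fact.out : p.Prime)
  have := Fintype.ofFinite F
  obtain ⟨n, -, hn⟩ := FiniteField.card F p
  rw [Nat.card_eq_fintype_card, hn, ← pow_mul, Nat.coprime_iff_gcd_eq_one]
  have h1 : 0 < (n : ℕ) * d := Nat.mul_pos n.pos hd
  rw [← Nat.coprime_iff_gcd_eq_one, hp.coprime_iff_not_dvd]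
  intro h2
  have h3 : p ∣ p ^ ((n : ℕ) * d) := dvd_pow_self p h1.ne'
  have h4 := (Nat.dvd_sub_iff_right (Nat.one_le_pow _ _ hp.pos) h3).1 h2
  exact hp.one_lt.ne' (Nat.dvd_one.1 h4)

/-- The natural numbers are dense in the exponent space, by the Chinese remainder theorem. -/
instance exponentFilter_neBot (s : Exponent p v) : (exponentFilter p v s).NeBot := by
  have hp := (Fact.out : p.Prime)
  rw [exponentFilter, comap_neBot_iff]
  intro t ht
  rw [nhds_prod_eq, mem_prod_iff] at ht
  obtain ⟨t₁, ht₁, t₂, ht₂, hsub⟩ := ht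
  obtain ⟨ε, hε, hball⟩ := Metric.mem_nhds_iff.1 ht₂
  obtain ⟨k, hk⟩ := PadicInt.exists_pow_neg_lt p hε
  have hq : 1 < Nat.card F ^ degree v :=
    one_lt_pow₀ Finite.one_lt_card (degree_pos v).ne'
  have : NeZero (Nat.card F ^ degree v - 1) := ⟨by omega⟩
  have hco : (Nat.card F ^ degree v - 1).Coprime (p ^ k) :=
    ((coprime_card (F := F) p _ (degree_pos v)).pow_left k).symm
  obtain ⟨e, he1, he2⟩ := Nat.chineseRemainder hco s.1.val (s.2.appr k)
  refine ⟨e, hsub ⟨?_, hball ?_⟩⟩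
  · have h1 : (e : ZMod (Nat.card F ^ degree v - 1)) = s.1 := by
      rw [(ZMod.natCast_eq_natCast_iff _ _ _).2 he1, ZMod.natCast_zmod_val]
    rw [Prod.fst_natCast, h1]
    exact mem_of_mem_nhds ht₁
  · rw [Prod.snd_natCast, Metric.mem_ball, dist_eq_norm]
    refine lt_of_le_of_lt ?_ hk
    have h1 : (e : ℤ_[p]) - s.2 = ((e : ℤ_[p]) - (s.2.appr k : ℕ)) - (s.2 - (s.2.appr k : ℕ)) := by
      ring
    have h2 : ‖s.2 - (s.2.appr k : ℕ)‖ ≤ (p : ℝ) ^ (-k : ℤ) :=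
      (PadicInt.norm_le_pow_iff_mem_span_pow _ _).2 (PadicInt.appr_spec k s.2)
    have h3 : ‖(e : ℤ_[p]) - (s.2.appr k : ℕ)‖ ≤ (p : ℝ) ^ (-k : ℤ) := by
      have h4 := (PadicInt.norm_int_le_pow_iff_dvd (p := p) (k := (e : ℤ) - (s.2.appr k : ℕ))
        (n := k)).2 (by exact_mod_cast (Nat.modEq_iff_dvd.1 he2.symm))
      push_cast at h4
      exact h4
    rw [h1]
    exact (norm_sub_le_max_norm _ _).trans (max_le h3 h2)

/-- Close to a point of the exponent space, all natural numbers are congruent modulo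
`(r ^ deg v - 1) * p ^ k`. -/
theorem exists_eventually_modEq (s : Exponent p v) (k : ℕ) :
    ∃ e₀ : ℕ, ∀ᶠ e in exponentFilter p v s,
      e ≡ e₀ [MOD (Nat.card F ^ degree v - 1) * p ^ k] := by
  obtain ⟨e₀, h1, h2⟩ := (eventually_exponentFilter s k).exists
  refine ⟨e₀, (eventually_exponentFilter s k).mono fun e he => ?_⟩
  have hco : (Nat.card F ^ degree v - 1).Coprime (p ^ k) :=
    ((coprime_card (F := F) p _ (degree_pos v)).pow_left k).symm
  refine (Nat.modEq_and_modEq_iff_modEq_mul hco).1 ⟨?_, ?_⟩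
  · rw [← ZMod.natCast_eq_natCast_iff, he.1, h1]
  · have h3 : ‖(((e₀ : ℤ) - e : ℤ) : ℤ_[p])‖ ≤ (p : ℝ) ^ (-k : ℤ) := by
      have : (((e₀ : ℤ) - e : ℤ) : ℤ_[p]) = ((e₀ : ℤ_[p]) - s.2) - ((e : ℤ_[p]) - s.2) := by
        push_cast; ring
      rw [this]
      exact (norm_sub_le_max_norm _ _).trans (max_le h2 he.2)
    rw [Nat.modEq_iff_dvd]
    exact_mod_cast (PadicInt.norm_int_le_pow_iff_dvd).1 h3

variable {α : F} (hα : v.asIdeal = Ideal.span {X - C α})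
include hα

/-- Congruent exponents give close powers. -/
theorem norm_pow_sub_pow_le {n : F[X]} (hn : n ∉ v.asIdeal) {k e e' : ℕ}
    (h : e ≡ e' [MOD (Nat.card F ^ degree v - 1) * p ^ k]) :
    ‖algebraMap F[X] (LocalField v) n ^ e - algebraMap F[X] (LocalField v) n ^ e'‖ ≤
      ‖algebraMap F[X] (LocalField v) (X - C α)‖ ^ p ^ k := by
  wlog hle : e' ≤ e generalizing e e'
  · rw [norm_sub_rev]
    exact this h.symm (by omega)
  have := Fintype.ofFinite F
  obtain ⟨m, hm⟩ := (Nat.modEq_iff_dvd' hle).1 h.symm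
  rw [card_pow_degree hα, Nat.card_eq_fintype_card] at hm
  rw [← map_pow, ← map_pow, ← map_sub, ← norm_pow, ← map_pow]
  refine norm_algebraMap_le_of_dvd ?_
  have h1 : n ^ e - n ^ e' = n ^ e' * (n ^ ((Fintype.card F - 1) * p ^ k * m) - 1) := by
    rw [mul_sub, ← pow_add, ← hm, mul_one, Nat.add_sub_cancel' hle]
  rw [h1]
  refine Dvd.dvd.mul_left ?_ _
  rw [pow_mul]
  refine dvd_trans ?_ (sub_one_dvd_pow_sub_one _ m)
  rw [pow_mul]
  have h2 : (n ^ (Fintype.card F - 1)) ^ p ^ k - 1 = (n ^ (Fintype.card F - 1) - 1) ^ p ^ k := by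
    rw [sub_pow_char_pow, one_pow]
  rw [h2]
  refine pow_dvd_pow_of_dvd ?_ _
  rw [dvd_iff_isRoot, IsRoot, eval_sub, eval_pow, eval_one, FiniteField.pow_card_sub_one_eq_one,
    sub_self]
  exact fun h => hn ((mem_asIdeal_iff hα).2 h)

theorem tendsto_vadicPow {n : F[X]} (hn : n ∉ v.asIdeal) (s : Exponent p v) :
    Tendsto (fun e => algebraMap F[X] (LocalField v) n ^ e) (exponentFilter p v s)
      (𝓝 (vadicPow p v n s)) := by
  have hp := (Fact.out : p.Prime)
  have hC : Cauchy (map (fun e => algebraMap F[X] (LocalField v) n ^ e) (exponentFilter p v s)) := by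
    refine Metric.cauchy_iff.2 ⟨inferInstance, fun ε hε => ?_⟩
    obtain ⟨k, hk⟩ := exists_pow_lt_of_lt_one hε (norm_uniformizer_lt_one hα)
    obtain ⟨e₀, he₀⟩ := exists_eventually_modEq s k
    refine ⟨_, image_mem_map he₀, ?_⟩
    rintro _ ⟨e, he, rfl⟩ _ ⟨e', he', rfl⟩
    rw [dist_eq_norm]
    refine (norm_pow_sub_pow_le hα hn (he.trans he'.symm)).trans_lt (lt_of_le_of_lt ?_ hk)
    exact pow_le_pow_of_le_one (norm_nonneg _) (norm_uniformizer_lt_one hα).le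
      (Nat.lt_pow_self hp.one_lt).le
  exact tendsto_nhds_limUnder (CompleteSpace.complete hC)

theorem tendsto_zetaCoeff (s : Exponent p v) (d : ℕ) :
    Tendsto (fun e => algebraMap F[X] (LocalField v)
        (∑ n ∈ (finite_monic_natDegree_eq v d).toFinset, n ^ e))
      (exponentFilter p v (-s)) (𝓝 (zetaCoeff p v s d)) := by
  simp_rw [map_sum, map_pow]
  refine tendsto_finsetSum _ fun n hn => ?_
  rw [Set.Finite.mem_toFinset] at hn
  exact tendsto_vadicPow hα hn.2.2 _

theorem zetaCoeff_zero (s : Exponent p v) : zetaCoeff p v s 0 = 1 := by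
  refine tendsto_nhds_unique (tendsto_zetaCoeff hα s 0) ?_
  rw [finite_monic_natDegree_zero_toFinset]
  simp

variable {s : Exponent p v} (hs : s ∈ Ideal.span {(Nat.card F : Exponent p v) - 1})
include hs

theorem norm_zetaCoeff_one : ‖zetaCoeff p v s 1‖ = 1 := by
  have := Fintype.ofFinite F
  refine tendsto_nhds_unique (tendsto_zetaCoeff hα s 1).norm (tendsto_const_nhds.congr' ?_)
  filter_upwards [eventually_dvd hα hs] with e he
  rw [norm_sum_pow_monic hα he, unitPowerSum_zero]
  simp

/-- The coefficients of the zeta function decrease more than quadratically. -/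
theorem norm_zetaCoeff_succ_le (d : ℕ) :
    ‖zetaCoeff p v s (d + 2)‖ ≤
      ‖algebraMap F[X] (LocalField v) (X - C α)‖ * ‖zetaCoeff p v s (d + 1)‖ ^ 2 := by
  have := Fintype.ofFinite F
  refine le_of_tendsto_of_tendsto (tendsto_zetaCoeff hα s (d + 2)).norm
    (((tendsto_zetaCoeff hα s (d + 1)).norm.pow 2).const_mul _) ?_
  filter_upwards [eventually_dvd hα hs] with e he
  rw [norm_sum_pow_monic hα he, norm_sum_pow_monic hα he]
  exact norm_unitPowerSum_succ_le hα d e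

end Limits

/-! ### Zeros of power series with quickly decreasing coefficients -/

section PowerSeries

/-- A log-concave sequence tending to zero is maximal at one index, or at two consecutive ones. -/
theorem exists_max_of_logConcave {t : ℕ → ℝ} (h0 : 0 < t 0) (hpos : ∀ d, 0 ≤ t d)
    (hz : ∀ d, t (d + 1) = 0 → t (d + 2) = 0)
    (hlog : ∀ d, t (d + 1) ≠ 0 → t (d + 2) * t d < t (d + 1) ^ 2)
    (hlim : Tendsto t atTop (𝓝 0)) :
    ∃ (n : ℕ) (B : ℝ), 0 ≤ B ∧ B < t n ∧ t (n + 1) ≤ t n ∧ ∀ d, d ≠ n → d ≠ n + 1 → t d ≤ B := by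
  classical
  have hex : ∃ n, t (n + 1) ≤ t n := by
    by_contra hcon
    push Not at hcon
    have h1 : ∀ n, t 0 ≤ t n := fun n => (strictMono_nat_of_lt_succ hcon).monotone (Nat.zero_le n)
    exact h0.not_ge (ge_of_tendsto' hlim h1)
  set n := Nat.find hex with hn
  have hn1 : t (n + 1) ≤ t n := Nat.find_spec hex
  have hlt : ∀ k < n, t k < t (k + 1) := fun k hk => not_le.1 (Nat.find_min hex hk)
  have hmono : ∀ k, k ≤ n → ∀ j, j ≤ k → t j ≤ t k := by
    intro k
    induction k with
    | zero => intro _ j hj; rw [Nat.le_zero.1 hj]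
    | succ k ih =>
      intro hk j hj
      rcases hj.eq_or_lt with rfl | hj
      · exact le_rfl
      · exact (ih (by omega) j (by omega)).trans (hlt k (by omega)).le
  have hn0 : 0 < t n := h0.trans_le (hmono n le_rfl 0 (Nat.zero_le n))
  have hstep : ∀ d, t (d + 1) ≤ t d → t (d + 2) ≤ t (d + 1) := by
    intro d hd
    by_cases h1 : t (d + 1) = 0
    · rw [hz d h1, h1]
    · have h2 := hlog d h1
      have h3 : 0 < t (d + 1) := (hpos _).lt_of_ne (Ne.symm h1)
      by_contra h4
      push Not at h4
      nlinarith
  have hdec : ∀ k, t (n + k + 1) ≤ t (n + k) := by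
    intro k
    induction k with
    | zero => exact hn1
    | succ k ih => exact hstep (n + k) ih
  have hanti : ∀ k, t (n + 2 + k) ≤ t (n + 2) := by
    intro k
    induction k with
    | zero => exact le_rfl
    | succ k ih =>
      refine le_trans ?_ ih
      have := hdec (k + 2)
      rwa [show n + (k + 2) + 1 = n + 2 + (k + 1) by omega, show n + (k + 2) = n + 2 + k by omega]
        at this
  have hn2 : t (n + 2) < t n := by
    by_cases h1 : t (n + 1) = 0
    · rw [hz n h1]; exact hn0
    · have h2 := hlog n h1
      have h3 : 0 < t (n + 1) := (hpos _).lt_of_ne (Ne.symm h1)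
      by_contra h4
      push Not at h4
      nlinarith
  refine ⟨n, max (if n = 0 then 0 else t (n - 1)) (t (n + 2)), (hpos _).trans (le_max_right _ _),
    max_lt ?_ hn2, hn1, fun d hd hd' => ?_⟩
  · split_ifs with h1
    · exact hn0
    · have := hlt (n - 1) (by omega)
      rwa [show n - 1 + 1 = n by omega] at this
  · rcases lt_or_gt_of_ne hd with h1 | h1
    · refine le_trans ?_ (le_max_left _ _)
      rw [if_neg (by omega)]
      exact hmono (n - 1) (by omega) d (by omega)
    · refine le_trans ?_ (le_max_right _ _)
      have := hanti (d - (n + 2))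
      rwa [show n + 2 + (d - (n + 2)) = d by omega] at this

variable {K L : Type*} [NormedField K] [NontriviallyNormedField L] [NormedAlgebra K L]

/-- The norms of the coefficients `z d` start with `1, 1` and then decrease more than
quadratically. -/
structure IsQuadDecreasing (z : ℕ → K) (c : ℝ) : Prop where
  lt_one : c < 1
  norm_coeff_zero : ‖z 0‖ = 1
  norm_coeff_one : ‖z 1‖ = 1
  norm_succ : ∀ d, ‖z (d + 2)‖ ≤ c * ‖z (d + 1)‖ ^ 2

namespace IsQuadDecreasing

variable {z : ℕ → K} {c : ℝ}

theorem nonneg (h : IsQuadDecreasing z c) : 0 ≤ c := by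
  have := h.norm_succ 0
  rw [zero_add, h.norm_coeff_one, one_pow, mul_one] at this
  exact (norm_nonneg _).trans this

theorem norm_succ_le_pow (h : IsQuadDecreasing z c) (d : ℕ) : ‖z (d + 1)‖ ≤ c ^ d := by
  have hc := h.nonneg
  induction d with
  | zero => rw [zero_add, h.norm_coeff_one, pow_zero]
  | succ d ih =>
    refine (h.norm_succ d).trans ?_
    rw [pow_succ' c]
    refine mul_le_mul_of_nonneg_left (le_trans ?_ ih) hc
    have h1 : ‖z (d + 1)‖ ≤ 1 := ih.trans (pow_le_one₀ hc h.lt_one.le)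
    nlinarith [norm_nonneg (z (d + 1))]

theorem norm_le_one (h : IsQuadDecreasing z c) (d : ℕ) : ‖z d‖ ≤ 1 := by
  cases d with
  | zero => exact h.norm_coeff_zero.le
  | succ d => exact (h.norm_succ_le_pow d).trans (pow_le_one₀ h.nonneg h.lt_one.le)

theorem summable_norm (h : IsQuadDecreasing z c) {ρ : ℝ} (hρ : 0 ≤ ρ) :
    Summable fun d => ‖z d‖ * ρ ^ d := by
  have hc := h.nonneg
  have h1 : Tendsto (fun d : ℕ => c * c ^ d * ρ) atTop (𝓝 (c * 0 * ρ)) :=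
    ((tendsto_pow_atTop_nhds_zero_of_lt_one hc h.lt_one).const_mul c).mul_const ρ
  rw [mul_zero, zero_mul] at h1
  rw [← summable_nat_add_iff 1]
  refine summable_of_ratio_norm_eventually_le (r := 1 / 2) (by norm_num) ?_
  filter_upwards [h1.eventually (ge_mem_nhds (show (0 : ℝ) < 1 / 2 by norm_num))] with d hd
  rw [Real.norm_of_nonneg (by positivity), Real.norm_of_nonneg (by positivity)]
  calc ‖z (d + 2)‖ * ρ ^ (d + 2) ≤ c * ‖z (d + 1)‖ ^ 2 * ρ ^ (d + 2) :=
        mul_le_mul_of_nonneg_right (h.norm_succ d) (by positivity)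
    _ = (c * ‖z (d + 1)‖ * ρ) * (‖z (d + 1)‖ * ρ ^ (d + 1)) := by ring
    _ ≤ 1 / 2 * (‖z (d + 1)‖ * ρ ^ (d + 1)) := by
        refine mul_le_mul_of_nonneg_right (le_trans ?_ hd) (by positivity)
        exact mul_le_mul_of_nonneg_right
          (mul_le_mul_of_nonneg_left (h.norm_succ_le_pow d) hc) hρ

theorem exists_max (h : IsQuadDecreasing z c) {ρ : ℝ} (hρ : 0 < ρ) :
    ∃ (n : ℕ) (B : ℝ), 0 ≤ B ∧ B < ‖z n‖ * ρ ^ n ∧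
      ‖z (n + 1)‖ * ρ ^ (n + 1) ≤ ‖z n‖ * ρ ^ n ∧
      ∀ d, d ≠ n → d ≠ n + 1 → ‖z d‖ * ρ ^ d ≤ B := by
  have hc := h.nonneg
  refine exists_max_of_logConcave (t := fun d => ‖z d‖ * ρ ^ d) (by simp [h.norm_coeff_zero])
    (fun d => by positivity) (fun d hd => ?_) (fun d hd => ?_)
    (h.summable_norm hρ.le).tendsto_atTop_zero
  · have h1 : ‖z (d + 1)‖ = 0 := by
      rcases mul_eq_zero.1 hd with h1 | h1
      · exact h1
      · exact absurd h1 (by positivity)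
    have h2 := h.norm_succ d
    rw [h1] at h2
    have h3 : ‖z (d + 2)‖ = 0 := le_antisymm (h2.trans (by simp)) (norm_nonneg _)
    simp only [h3, zero_mul]
  · have h1 : 0 < ‖z (d + 1)‖ := (norm_nonneg _).lt_of_ne fun h0 => hd (by rw [← h0, zero_mul])
    have h2 : ‖z (d + 2)‖ * ‖z d‖ < ‖z (d + 1)‖ ^ 2 := by
      calc ‖z (d + 2)‖ * ‖z d‖ ≤ ‖z (d + 2)‖ * 1 :=
            mul_le_mul_of_nonneg_left (h.norm_le_one d) (norm_nonneg _)
        _ ≤ c * ‖z (d + 1)‖ ^ 2 := by rw [mul_one]; exact h.norm_succ d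
        _ < 1 * ‖z (d + 1)‖ ^ 2 := mul_lt_mul_of_pos_right h.lt_one (by positivity)
        _ = ‖z (d + 1)‖ ^ 2 := one_mul _
    have h3 : 0 < ρ ^ (2 * d + 2) := by positivity
    calc ‖z (d + 2)‖ * ρ ^ (d + 2) * (‖z d‖ * ρ ^ d)
        = ‖z (d + 2)‖ * ‖z d‖ * ρ ^ (2 * d + 2) := by ring
      _ < ‖z (d + 1)‖ ^ 2 * ρ ^ (2 * d + 2) := mul_lt_mul_of_pos_right h2 h3
      _ = (‖z (d + 1)‖ * ρ ^ (d + 1)) ^ 2 := by ring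

end IsQuadDecreasing

/-- The power series with coefficients `z d` in `K`, as a function on `L`. -/
def seriesSum (L : Type*) [NontriviallyNormedField L] [NormedAlgebra K L] (z : ℕ → K) (X : L) : L :=
  ∑' d, X ^ d * algebraMap K L (z d)

namespace IsQuadDecreasing

variable {z : ℕ → K} {c : ℝ} [CompleteSpace L]

theorem summable (h : IsQuadDecreasing z c) (X : L) :
    Summable fun d => X ^ d * algebraMap K L (z d) := by
  refine Summable.of_norm ?_
  simp_rw [norm_mul, norm_algebraMap', norm_pow, mul_comm (‖X‖ ^ _)]
  exact h.summable_norm (norm_nonneg X)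

theorem analyticAt (h : IsQuadDecreasing z c) (X : L) : AnalyticAt L (seriesSum L z) X := by
  set P := FormalMultilinearSeries.ofScalars L fun d => algebraMap K L (z d)
  have hP : P.radius = ⊤ := by
    refine P.radius_eq_top_of_summable_norm fun r => ?_
    simp_rw [P, FormalMultilinearSeries.ofScalars_norm, norm_algebraMap']
    exact h.summable_norm r.2
  have h1 := P.hasFPowerSeriesOnBall (by rw [hP]; exact ENNReal.zero_lt_top)
  have h2 : P.sum = seriesSum L z := by
    funext Y
    rw [FormalMultilinearSeries.sum, seriesSum]
    refine tsum_congr fun d => ?_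
    rw [FormalMultilinearSeries.ofScalars_apply_eq, smul_eq_mul, mul_comm]
  rw [← h2]
  refine h1.analyticAt_of_mem ?_
  rw [hP]
  simp

end IsQuadDecreasing

/-- An ultrametric series is close to a finite sum if the terms in a finite set are close to those of
the sum and all others are small. -/
theorem norm_tsum_sub_sum_le [IsUltrametricDist L] {f g : ℕ → L} (hf : Summable f) (s : Finset ℕ)
    {B : ℝ} (hB : 0 ≤ B) (hs : ∀ d ∈ s, ‖f d - g d‖ ≤ B) (hs' : ∀ d, d ∉ s → ‖f d‖ ≤ B) :
    ‖∑' d, f d - ∑ d ∈ s, g d‖ ≤ B := by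
  classical
  have h0 : ∀ d, d ∉ s → (if d ∈ s then g d else 0) = 0 := fun d hd => if_neg hd
  have h1 : HasSum (fun d => if d ∈ s then g d else 0) (∑ d ∈ s, if d ∈ s then g d else 0) :=
    hasSum_sum_of_ne_finset_zero h0
  rw [Finset.sum_congr rfl fun d hd => if_pos hd] at h1
  rw [← h1.tsum_eq, ← hf.tsum_sub h1.summable]
  refine IsUltrametricDist.norm_tsum_le_of_forall_le_of_nonneg hB fun d => ?_
  split_ifs with hd
  · exact hs d hd
  · rw [sub_zero]; exact hs' d hd

section GeomSum

variable [IsUltrametricDist L] {x y a : L} {ρ θ : ℝ}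

theorem norm_geomSum_mul_le (hx : ‖x‖ ≤ ρ) (hy : ‖y‖ ≤ ρ) (d : ℕ) :
    ‖∑ i ∈ Finset.range d, x ^ i * y ^ (d - 1 - i)‖ * ρ ≤ ρ ^ d := by
  have hρ : 0 ≤ ρ := (norm_nonneg x).trans hx
  cases d with
  | zero => simp
  | succ e =>
    rw [pow_succ]
    refine mul_le_mul_of_nonneg_right ?_ hρ
    refine IsUltrametricDist.norm_sum_le_of_forall_le_of_nonneg (by positivity) fun i hi => ?_
    have := Finset.mem_range.1 hi
    calc ‖x ^ i * y ^ (e + 1 - 1 - i)‖ = ‖x‖ ^ i * ‖y‖ ^ (e - i) := by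
          rw [norm_mul, norm_pow, norm_pow, Nat.add_sub_cancel]
      _ ≤ ρ ^ i * ρ ^ (e - i) := by gcongr
      _ = ρ ^ e := by rw [← pow_add, Nat.add_sub_cancel' (by omega)]

theorem norm_pow_sub_pow_le_mul (hθ : 0 ≤ θ) (hx : ‖x‖ ≤ ρ) (ha : ‖a‖ ≤ ρ)
    (hxa : ‖x - a‖ ≤ θ * ρ) (d : ℕ) : ‖x ^ d - a ^ d‖ ≤ θ * ρ ^ d := by
  rw [← geom_sum₂_mul, norm_mul]
  calc _ ≤ ‖∑ i ∈ Finset.range d, x ^ i * a ^ (d - 1 - i)‖ * (θ * ρ) :=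
        mul_le_mul_of_nonneg_left hxa (norm_nonneg _)
    _ = θ * (‖∑ i ∈ Finset.range d, x ^ i * a ^ (d - 1 - i)‖ * ρ) := by ring
    _ ≤ θ * ρ ^ d := mul_le_mul_of_nonneg_left (norm_geomSum_mul_le hx ha d) hθ

theorem norm_geomSum_sub_mul_le (hθ : 0 ≤ θ) (hx : ‖x‖ ≤ ρ) (hy : ‖y‖ ≤ ρ) (ha : ‖a‖ ≤ ρ)
    (hxa : ‖x - a‖ ≤ θ * ρ) (hya : ‖y - a‖ ≤ θ * ρ) (d : ℕ) :
    ‖∑ i ∈ Finset.range d, x ^ i * y ^ (d - 1 - i) - d * a ^ (d - 1)‖ * ρ ≤ θ * ρ ^ d := by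
  have hρ : 0 ≤ ρ := (norm_nonneg x).trans hx
  cases d with
  | zero => simpa using hθ
  | succ e =>
    rw [pow_succ, ← mul_assoc]
    refine mul_le_mul_of_nonneg_right ?_ hρ
    have h1 : ((e + 1 : ℕ) : L) * a ^ (e + 1 - 1) = ∑ _i ∈ Finset.range (e + 1), a ^ e := by
      rw [Finset.sum_const, Finset.card_range, nsmul_eq_mul, Nat.add_sub_cancel]
    rw [h1, ← Finset.sum_sub_distrib]
    refine IsUltrametricDist.norm_sum_le_of_forall_le_of_nonneg (by positivity) fun i hi => ?_
    have hi' := Finset.mem_range.1 hi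
    have h2 : x ^ i * y ^ (e + 1 - 1 - i) - a ^ e =
        x ^ i * (y ^ (e - i) - a ^ (e - i)) + (x ^ i - a ^ i) * a ^ (e - i) := by
      have : a ^ e = a ^ i * a ^ (e - i) := by rw [← pow_add, Nat.add_sub_cancel' (by omega)]
      rw [Nat.add_sub_cancel, this]
      ring
    have h3 : ρ ^ e = ρ ^ i * ρ ^ (e - i) := by rw [← pow_add, Nat.add_sub_cancel' (by omega)]
    rw [h2]
    refine (IsUltrametricDist.norm_add_le_max _ _).trans (max_le ?_ ?_)
    · rw [norm_mul, norm_pow, h3]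
      calc ‖x‖ ^ i * ‖y ^ (e - i) - a ^ (e - i)‖ ≤ ρ ^ i * (θ * ρ ^ (e - i)) := by
            gcongr
            exact norm_pow_sub_pow_le_mul hθ hy ha hya _
        _ = _ := by ring
    · rw [norm_mul, norm_pow, h3]
      calc ‖x ^ i - a ^ i‖ * ‖a‖ ^ (e - i) ≤ θ * ρ ^ i * ρ ^ (e - i) := by
            gcongr
            exact norm_pow_sub_pow_le_mul hθ hx ha hxa _
        _ = _ := by ring

end GeomSum

/-- On the circle of radius `ρ` the terms of index `n` and `n + 1` of the series have the same norm
and dominate all others, which are bounded by `B`. -/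
structure IsCritical (z : ℕ → K) (ρ : ℝ) (n : ℕ) (B : ℝ) : Prop where
  pos : 0 < ρ
  bound_pos : 0 < B
  lt : B < ‖z n‖ * ρ ^ n
  eq : ‖z (n + 1)‖ * ρ ^ (n + 1) = ‖z n‖ * ρ ^ n
  le : ∀ d, d ≠ n → d ≠ n + 1 → ‖z d‖ * ρ ^ d ≤ B

/-- The quotient `(f X - f Y) / (X - Y)` for the sum `f` of the power series with coefficients `z`,
written as a series that makes sense for `X = Y`. -/
def dividedDifference (z : ℕ → K) (X Y : L) : L :=
  ∑' d, algebraMap K L (z d) * ∑ i ∈ Finset.range d, X ^ i * Y ^ (d - 1 - i)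

section Zeros

variable {z : ℕ → K} {c : ℝ} [CompleteSpace L] [IsUltrametricDist L]

/-- On a circle that contains a zero, the maximal term cannot be unique. -/
theorem IsQuadDecreasing.exists_isCritical (h : IsQuadDecreasing z c) {X : L} (hX : X ≠ 0)
    (h0 : seriesSum L z X = 0) : ∃ n B, IsCritical z ‖X‖ n B := by
  have hρ := norm_pos_iff.2 hX
  obtain ⟨n, B, hB, hlt, hle, hother⟩ := h.exists_max hρ
  -- enlarging the bound makes it positive, which leaves room around a zero
  refine ⟨n, (B + ‖z n‖ * ‖X‖ ^ n) / 2, hρ, by linarith, by linarith, ?_,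
    fun d hd hd' => (hother d hd hd').trans (by linarith)⟩
  by_contra hne
  have hlt' := lt_of_le_of_ne hle hne
  have h1 := norm_tsum_sub_sum_le (h.summable X) {n} (g := fun d => X ^ d * algebraMap K L (z d))
    (B := max B (‖z (n + 1)‖ * ‖X‖ ^ (n + 1))) (hB.trans (le_max_left _ _))
    (fun d _ => by rw [sub_self, norm_zero]; exact hB.trans (le_max_left _ _)) fun d hd => by
      rw [norm_mul, norm_pow, norm_algebraMap', mul_comm]
      rcases eq_or_ne d (n + 1) with rfl | hd'
      · exact le_max_right _ _
      · exact (hother d (by simpa using hd) hd').trans (le_max_left _ _)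
  have h2 : ∑' d, X ^ d * algebraMap K L (z d) = 0 := h0
  rw [h2, Finset.sum_singleton, zero_sub, norm_neg, norm_mul, norm_pow, norm_algebraMap',
    mul_comm] at h1
  exact absurd h1 (not_le.2 (max_lt hlt hlt'))

namespace IsCritical

variable {ρ : ℝ} {n : ℕ} {B : ℝ}

theorem nonneg (hc : IsCritical z ρ n B) : 0 ≤ B := hc.bound_pos.le

theorem term_pos (hc : IsCritical z ρ n B) : 0 < ‖z n‖ * ρ ^ n := hc.nonneg.trans_lt hc.lt

theorem ne_zero (hc : IsCritical z ρ n B) : z (n + 1) ≠ 0 := by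
  intro h
  have h1 := hc.eq
  rw [h, norm_zero, zero_mul] at h1
  exact hc.term_pos.ne h1

theorem norm_center (hc : IsCritical z ρ n B) : ‖-z n / z (n + 1)‖ = ρ := by
  have h1 := hc.eq
  have h2 : 0 < ρ ^ n := pow_pos hc.pos n
  rw [norm_div, norm_neg, div_eq_iff (norm_ne_zero_iff.2 hc.ne_zero)]
  refine mul_right_cancel₀ h2.ne' ?_
  rw [← h1]
  ring

/-- The zeros on a critical circle are close to `-z n / z (n + 1)`. -/
theorem norm_sub_center_le (hc : IsCritical z ρ n B) (h : IsQuadDecreasing z c) {X : L}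
    (hX : ‖X‖ = ρ) (h0 : seriesSum L z X = 0) :
    ‖X - algebraMap K L (-z n / z (n + 1))‖ ≤ B / (‖z n‖ * ρ ^ n) * ρ := by
  have h1 := norm_tsum_sub_sum_le (h.summable X) {n, n + 1}
    (g := fun d => X ^ d * algebraMap K L (z d)) hc.nonneg
    (fun d _ => by rw [sub_self, norm_zero]; exact hc.nonneg) fun d hd => by
      simp only [Finset.mem_insert, Finset.mem_singleton, not_or] at hd
      rw [norm_mul, norm_pow, norm_algebraMap', mul_comm, hX]
      exact hc.le d hd.1 hd.2
  have h2 : ∑' d, X ^ d * algebraMap K L (z d) = 0 := h0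
  have hz : algebraMap K L (z (n + 1)) ≠ 0 := by
    rw [Ne, FaithfulSMul.algebraMap_eq_zero_iff]
    exact hc.ne_zero
  have h3 : X ^ n * algebraMap K L (z n) + X ^ (n + 1) * algebraMap K L (z (n + 1)) =
      X ^ n * algebraMap K L (z (n + 1)) * (X - algebraMap K L (-z n / z (n + 1))) := by
    rw [map_div₀, map_neg]
    field_simp
    ring
  rw [h2, Finset.sum_pair (by omega), zero_sub, norm_neg, h3, norm_mul, norm_mul, norm_pow,
    norm_algebraMap', hX] at h1
  rw [div_mul_eq_mul_div, le_div_iff₀ hc.term_pos, ← hc.eq]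
  calc _ = ρ ^ n * ‖z (n + 1)‖ * ‖X - algebraMap K L (-z n / z (n + 1))‖ * ρ := by ring
    _ ≤ B * ρ := mul_le_mul_of_nonneg_right h1 hc.pos.le

theorem summable_dividedDifference (h : IsQuadDecreasing z c) (hρ : 0 < ρ) {X Y : L}
    (hX : ‖X‖ ≤ ρ) (hY : ‖Y‖ ≤ ρ) :
    Summable fun d => algebraMap K L (z d) * ∑ i ∈ Finset.range d, X ^ i * Y ^ (d - 1 - i) := by
  refine Summable.of_norm_bounded ((h.summable_norm hρ.le).div_const ρ) fun d => ?_
  rw [norm_mul, norm_algebraMap', le_div_iff₀ hρ, mul_assoc]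
  exact mul_le_mul_of_nonneg_left (norm_geomSum_mul_le hX hY d) (norm_nonneg _)

theorem seriesSum_sub (h : IsQuadDecreasing z c) (hρ : 0 < ρ) {X Y : L}
    (hX : ‖X‖ ≤ ρ) (hY : ‖Y‖ ≤ ρ) :
    seriesSum L z X - seriesSum L z Y = dividedDifference z X Y * (X - Y) := by
  rw [seriesSum, seriesSum, ← (h.summable X).tsum_sub (h.summable Y), dividedDifference,
    ← (summable_dividedDifference h hρ hX hY).tsum_mul_right]
  refine tsum_congr fun d => ?_
  rw [mul_assoc, geom_sum₂_mul]
  ring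

/-- Near the center `a = -z n / z (n + 1)` the divided difference is nearly constant: its terms of
index `n` and `n + 1` are nearly `n z n a ^ (n - 1)` and `(n + 1) z (n + 1) a ^ n`, with sum
`z (n + 1) a ^ n`. -/
theorem norm_dividedDifference_sub_le (hc : IsCritical z ρ n B) (h : IsQuadDecreasing z c)
    {X Y : L} (hX : ‖X‖ ≤ ρ) (hY : ‖Y‖ ≤ ρ)
    (hXa : ‖X - algebraMap K L (-z n / z (n + 1))‖ ≤ B / (‖z n‖ * ρ ^ n) * ρ)
    (hYa : ‖Y - algebraMap K L (-z n / z (n + 1))‖ ≤ B / (‖z n‖ * ρ ^ n) * ρ) :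
    ‖dividedDifference z X Y - algebraMap K L (z (n + 1) * (-z n / z (n + 1)) ^ n)‖ ≤ B / ρ := by
  have hρ := hc.pos
  set a := algebraMap K L (-z n / z (n + 1)) with ha
  have haρ : ‖a‖ = ρ := by rw [ha, norm_algebraMap', hc.norm_center]
  have hθ : 0 ≤ B / (‖z n‖ * ρ ^ n) := div_nonneg hc.nonneg hc.term_pos.le
  have hz : algebraMap K L (z (n + 1)) ≠ 0 := by
    rw [Ne, FaithfulSMul.algebraMap_eq_zero_iff]
    exact hc.ne_zero
  have h1 : ∑ d ∈ {n, n + 1}, algebraMap K L (z d) * (d * a ^ (d - 1)) =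
      algebraMap K L (z (n + 1) * (-z n / z (n + 1)) ^ n) := by
    have h2 : algebraMap K L (z n) = -(algebraMap K L (z (n + 1)) * a) := by
      rw [ha, map_div₀, map_neg]
      field_simp
    have h3 : a * ((n : L) * a ^ (n - 1)) = n * a ^ n := by
      cases n with
      | zero => simp
      | succ k => rw [Nat.add_sub_cancel]; ring
    rw [Finset.sum_pair (by omega), map_mul, map_pow, ← ha, h2, Nat.add_sub_cancel]
    push_cast
    linear_combination (-algebraMap K L (z (n + 1))) * h3
  rw [← h1]
  refine norm_tsum_sub_sum_le (summable_dividedDifference h hρ hX hY) {n, n + 1}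
    (div_nonneg hc.nonneg hρ.le) (fun d hd => ?_) fun d hd => ?_
  · have h4 : ‖z d‖ * ρ ^ d = ‖z n‖ * ρ ^ n := by
      simp only [Finset.mem_insert, Finset.mem_singleton] at hd
      rcases hd with rfl | rfl
      · rfl
      · exact hc.eq
    rw [← mul_sub, norm_mul, norm_algebraMap', le_div_iff₀ hρ, mul_assoc]
    calc _ ≤ ‖z d‖ * (B / (‖z n‖ * ρ ^ n) * ρ ^ d) := mul_le_mul_of_nonneg_left
          (norm_geomSum_sub_mul_le hθ hX hY haρ.le hXa hYa d) (norm_nonneg _)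
      _ = B / (‖z n‖ * ρ ^ n) * (‖z d‖ * ρ ^ d) := by ring
      _ = B := by rw [h4, div_mul_cancel₀ _ hc.term_pos.ne']
  · simp only [Finset.mem_insert, Finset.mem_singleton, not_or] at hd
    rw [norm_mul, norm_algebraMap', le_div_iff₀ hρ, mul_assoc]
    exact (mul_le_mul_of_nonneg_left (norm_geomSum_mul_le hX hY d) (norm_nonneg _)).trans
      (hc.le d hd.1 hd.2)

theorem norm_leading (hc : IsCritical z ρ n B) :
    ‖z (n + 1) * (-z n / z (n + 1)) ^ n‖ = ‖z n‖ * ρ ^ n / ρ := by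
  rw [norm_mul, norm_pow, hc.norm_center, ← hc.eq, pow_succ, ← mul_assoc,
    mul_div_cancel_right₀ _ hc.pos.ne']

theorem norm_dividedDifference (hc : IsCritical z ρ n B) (h : IsQuadDecreasing z c)
    {X Y : L} (hX : ‖X‖ ≤ ρ) (hY : ‖Y‖ ≤ ρ)
    (hXa : ‖X - algebraMap K L (-z n / z (n + 1))‖ ≤ B / (‖z n‖ * ρ ^ n) * ρ)
    (hYa : ‖Y - algebraMap K L (-z n / z (n + 1))‖ ≤ B / (‖z n‖ * ρ ^ n) * ρ) :
    ‖dividedDifference z X Y‖ = ‖z n‖ * ρ ^ n / ρ := by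
  have h1 := hc.norm_dividedDifference_sub_le h hX hY hXa hYa
  have h2 : B / ρ < ‖z n‖ * ρ ^ n / ρ := div_lt_div_of_pos_right hc.lt hc.pos
  have h3 := hc.norm_leading
  rw [← norm_algebraMap' L] at h3
  rw [← sub_add_cancel (dividedDifference z X Y)
    (algebraMap K L (z (n + 1) * (-z n / z (n + 1)) ^ n)),
    IsUltrametricDist.norm_add_eq_max_of_norm_ne_norm, max_eq_right, h3]
  · rw [h3]; exact h1.trans h2.le
  · rw [h3]; exact (h1.trans_lt h2).ne

end IsCritical

/-- Zeros are determined by their norm. -/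
theorem IsQuadDecreasing.eq_of_norm_eq (h : IsQuadDecreasing z c) {X Y : L} (hX : X ≠ 0)
    (hX0 : seriesSum L z X = 0) (hY0 : seriesSum L z Y = 0) (hXY : ‖X‖ = ‖Y‖) : X = Y := by
  obtain ⟨n, B, hc⟩ := h.exists_isCritical hX hX0
  have h1 := hc.norm_dividedDifference h le_rfl hXY.ge (hc.norm_sub_center_le h rfl hX0)
    (hc.norm_sub_center_le h hXY.symm hY0)
  have h2 := IsCritical.seriesSum_sub h hc.pos le_rfl hXY.ge
  rw [hX0, hY0, sub_zero] at h2
  rcases mul_eq_zero.1 h2.symm with h3 | h3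
  · rw [h3, norm_zero] at h1
    exact absurd h1 (div_pos hc.term_pos hc.pos).ne
  · exact sub_eq_zero.1 h3

/-- Zeros lie in the field of the coefficients, by Newton iteration with a constant slope. -/
theorem IsQuadDecreasing.mem_range_of_zero [CompleteSpace K] (h : IsQuadDecreasing z c) {X : L}
    (hX : X ≠ 0) (hX0 : seriesSum L z X = 0) : X ∈ Set.range (algebraMap K L) := by
  obtain ⟨n, B, hc⟩ := h.exists_isCritical hX hX0
  have hclosed : IsClosed (Set.range (algebraMap K L)) :=
    (algebraMap_isometry K L).isClosedEmbedding.isClosed_range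
  set ρ := ‖X‖ with hρ
  set a := -z n / z (n + 1) with ha
  set θ := B / (‖z n‖ * ρ ^ n) with hθdef
  set s := z (n + 1) * a ^ n with hs
  have hθ0 : 0 ≤ θ := div_nonneg hc.nonneg hc.term_pos.le
  have hθ1 : θ < 1 := (div_lt_one hc.term_pos).2 hc.lt
  have hXa : ‖X - algebraMap K L a‖ ≤ θ * ρ := hc.norm_sub_center_le h rfl hX0
  have haρ : ‖algebraMap K L a‖ = ρ := by rw [norm_algebraMap']; exact hc.norm_center
  have hsn : ‖algebraMap K L s‖ = ‖z n‖ * ρ ^ n / ρ := by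
    rw [norm_algebraMap']; exact hc.norm_leading
  have hs0 : algebraMap K L s ≠ 0 := by
    rw [← norm_pos_iff, hsn]
    exact div_pos hc.term_pos hc.pos
  have key : ∀ m : ℕ, ∃ x : K, ‖algebraMap K L x - algebraMap K L a‖ ≤ θ * ρ ∧
      ‖algebraMap K L x - X‖ ≤ θ ^ m * (θ * ρ) := by
    intro m
    induction m with
    | zero => exact ⟨a, by rw [sub_self, norm_zero]; exact mul_nonneg hθ0 hc.pos.le, by
        rw [pow_zero, one_mul, norm_sub_rev]; exact hXa⟩
    | succ m ih =>
      obtain ⟨x, hx1, hx2⟩ := ih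
      have hxρ : ‖algebraMap K L x‖ ≤ ρ := by
        rw [← sub_add_cancel (algebraMap K L x) (algebraMap K L a)]
        refine (IsUltrametricDist.norm_add_le_max _ _).trans (max_le ?_ haρ.le)
        exact hx1.trans (mul_le_of_le_one_left hc.pos.le hθ1.le)
      -- the value of the series at a point of `K` lies in `K`
      obtain ⟨w, hw⟩ : seriesSum L z (algebraMap K L x) ∈ Set.range (algebraMap K L) := by
        refine hclosed.mem_of_tendsto (h.summable (algebraMap K L x)).hasSum
          (Eventually.of_forall fun t => ⟨∑ d ∈ t, x ^ d * z d, ?_⟩)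
        simp
      have h1 := IsCritical.seriesSum_sub h hc.pos hxρ (le_refl ‖X‖)
      rw [hX0, sub_zero, ← hw] at h1
      have h2 := hc.norm_dividedDifference_sub_le h hxρ le_rfl hx1 hXa
      have h3 : algebraMap K L (x - w / s) - X =
          -((dividedDifference z (algebraMap K L x) X - algebraMap K L s) / algebraMap K L s) *
            (algebraMap K L x - X) := by
        rw [map_sub, map_div₀, h1]
        field_simp
        ring
      have h4 : ‖algebraMap K L (x - w / s) - X‖ ≤ θ ^ (m + 1) * (θ * ρ) := by
        rw [h3, norm_mul, norm_neg, norm_div, hsn, pow_succ', mul_assoc]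
        refine mul_le_mul ?_ hx2 (norm_nonneg _) hθ0
        rw [div_le_iff₀ (div_pos hc.term_pos hc.pos)]
        refine h2.trans (le_of_eq ?_)
        have := hc.term_pos.ne'
        rw [hθdef, ← mul_div_assoc, div_mul_cancel₀ _ this]
      refine ⟨x - w / s, ?_, h4⟩
      rw [← sub_add_sub_cancel _ X]
      refine (IsUltrametricDist.norm_add_le_max _ _).trans (max_le (h4.trans ?_) hXa)
      exact mul_le_of_le_one_left (mul_nonneg hθ0 hc.pos.le) (pow_le_one₀ hθ0 hθ1.le)
  rw [← hclosed.closure_eq, Metric.mem_closure_iff]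
  intro ε hε
  have hlim : Tendsto (fun m : ℕ => θ ^ m * (θ * ρ)) atTop (𝓝 (0 * (θ * ρ))) :=
    (tendsto_pow_atTop_nhds_zero_of_lt_one hθ0 hθ1).mul_const _
  rw [zero_mul] at hlim
  obtain ⟨m, hm⟩ := (hlim.eventually (gt_mem_nhds hε)).exists
  obtain ⟨x, -, hx⟩ := key m
  exact ⟨_, ⟨x, rfl⟩, by rw [dist_comm, dist_eq_norm]; exact hx.trans_lt hm⟩

/-- Zeros of the series in the inverse variable are simple. -/
theorem IsQuadDecreasing.analyticOrderAt_eq_one (h : IsQuadDecreasing z c) {x : L} (hx : x ≠ 0)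
    (h0 : seriesSum L z x⁻¹ = 0) : analyticOrderAt (fun y => seriesSum L z y⁻¹) x = 1 := by
  have hX : x⁻¹ ≠ 0 := inv_ne_zero hx
  obtain ⟨n, B, hc⟩ := h.exists_isCritical hX h0
  have han : AnalyticAt L (fun y => seriesSum L z y⁻¹) x :=
    (h.analyticAt x⁻¹).comp (analyticAt_inv hx)
  have h1 : (1 : ℕ∞) ≤ analyticOrderAt (fun y => seriesSum L z y⁻¹) x :=
    Order.one_le_iff_ne_zero.2 (han.analyticOrderAt_ne_zero.2 h0)
  refine le_antisymm (not_lt.1 fun hlt => ?_) h1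
  have h2 : ((2 : ℕ) : ℕ∞) ≤ analyticOrderAt (fun y => seriesSum L z y⁻¹) x := by
    have := Order.add_one_le_of_lt hlt
    rwa [one_add_one_eq_two] at this
  obtain ⟨g, hg, hfg⟩ := (natCast_le_analyticOrderAt han).1 h2
  set ρ := ‖x⁻¹‖ with hρ
  set θ := B / (‖z n‖ * ρ ^ n)
  set a := algebraMap K L (-z n / z (n + 1))
  have hXa : ‖x⁻¹ - a‖ ≤ θ * ρ := hc.norm_sub_center_le h rfl h0
  have hθ0 : 0 < θ := div_pos hc.bound_pos hc.term_pos
  have hθ1 : θ < 1 := (div_lt_one hc.term_pos).2 hc.lt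
  have hinv : Tendsto (fun y : L => y⁻¹) (𝓝 x) (𝓝 x⁻¹) := (continuousAt_inv₀ hx).tendsto
  have hnear : ∀ᶠ y in 𝓝 x, ‖y⁻¹ - x⁻¹‖ < θ * ρ := by
    have h3 := (tendsto_iff_norm_sub_tendsto_zero.1 hinv).eventually
      (gt_mem_nhds (mul_pos hθ0 hc.pos))
    exact h3
  -- comparing the double zero with the divided difference
  have heq : ∀ᶠ y in 𝓝[≠] x, ‖y - x‖ * ‖g y‖ = ‖z n‖ * ρ ^ n / ρ * (‖y⁻¹‖ * ρ) := by
    have hne : ∀ᶠ y in 𝓝[≠] x, y ≠ x := eventually_mem_nhdsWithin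
    have hne0 : ∀ᶠ y in 𝓝[≠] x, y ≠ 0 := nhdsWithin_le_nhds (isOpen_ne.mem_nhds hx)
    filter_upwards [hne, hne0, nhdsWithin_le_nhds hnear, nhdsWithin_le_nhds hfg] with y hy hy0 hy1 hy2
    have hyρ : ‖y⁻¹‖ ≤ ρ := by
      rw [← sub_add_cancel y⁻¹ x⁻¹]
      refine (IsUltrametricDist.norm_add_le_max _ _).trans (max_le ?_ le_rfl)
      exact hy1.le.trans (mul_le_of_le_one_left hc.pos.le hθ1.le)
    have hya : ‖y⁻¹ - a‖ ≤ θ * ρ := by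
      rw [← sub_add_sub_cancel _ x⁻¹]
      exact (IsUltrametricDist.norm_add_le_max _ _).trans (max_le hy1.le hXa)
    have h3 := IsCritical.seriesSum_sub h hc.pos hyρ (le_refl ‖x⁻¹‖)
    rw [h0, sub_zero, hy2, smul_eq_mul] at h3
    have h4 := hc.norm_dividedDifference h hyρ le_rfl hya hXa
    have h5 : (y - x) * ((y - x) * g y) =
        (y - x) * -(dividedDifference z y⁻¹ x⁻¹ * (y⁻¹ * x⁻¹)) := by
      rw [← mul_assoc, ← sq, h3]
      field_simp
      ring
    have h6 := congrArg norm (mul_left_cancel₀ (sub_ne_zero.2 hy) h5)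
    rwa [norm_neg, norm_mul, norm_mul, norm_mul, h4] at h6
  have hl1 : Tendsto (fun y => ‖y - x‖ * ‖g y‖) (𝓝[≠] x) (𝓝 (0 * ‖g x‖)) := by
    refine Tendsto.mul ?_ ?_
    · exact (tendsto_iff_norm_sub_tendsto_zero.1 tendsto_id).mono_left nhdsWithin_le_nhds
    · exact hg.continuousAt.norm.tendsto.mono_left nhdsWithin_le_nhds
  have hl2 : Tendsto (fun y : L => ‖z n‖ * ρ ^ n / ρ * (‖y⁻¹‖ * ρ)) (𝓝[≠] x)
      (𝓝 (‖z n‖ * ρ ^ n / ρ * (ρ * ρ))) :=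
    ((hinv.norm.mul_const ρ).const_mul _).mono_left nhdsWithin_le_nhds
  have h7 := tendsto_nhds_unique (hl1.congr' heq) hl2
  rw [zero_mul] at h7
  exact (mul_pos (div_pos hc.term_pos hc.pos) (mul_pos hc.pos hc.pos)).ne h7

end Zeros

end PowerSeries

/-! ### The zeta function -/

section Zeta

theorem isUltrametricDist_completion (E : Type*) [NormedAddCommGroup E] [IsUltrametricDist E] :
    IsUltrametricDist (UniformSpace.Completion E) := by
  refine IsUltrametricDist.isUltrametricDist_of_isNonarchimedean_norm fun x y => ?_
  refine UniformSpace.Completion.induction_on₂ x y ?_ fun a b => ?_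
  · exact isClosed_le (by fun_prop) (by fun_prop)
  · rw [← UniformSpace.Completion.coe_add]
    simp only [UniformSpace.Completion.norm_coe]
    exact IsUltrametricDist.norm_add_le_max a b

variable {F : Type*} [Field F] [Finite F] (v : HeightOneSpectrum F[X])

instance : IsUltrametricDist (AlgClosure v) :=
  IsUltrametricDist.isUltrametricDist_of_isNonarchimedean_norm
    (isNonarchimedean_spectralNorm (K := LocalField v) (L := AlgClosure v))

instance : IsUltrametricDist (CompletedClosure v) := isUltrametricDist_completion _

variable {v} {p : ℕ} [Fact p.Prime] [CharP F p]

theorem isQuadDecreasing_zetaCoeff {α : F} (hα : v.asIdeal = Ideal.span {X - C α})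
    {s : Exponent p v} (hs : s ∈ Ideal.span {(Nat.card F : Exponent p v) - 1}) :
    IsQuadDecreasing (zetaCoeff p v s) ‖algebraMap F[X] (LocalField v) (X - C α)‖ where
  lt_one := norm_uniformizer_lt_one hα
  norm_coeff_zero := by rw [zetaCoeff_zero hα, norm_one]
  norm_coeff_one := norm_zetaCoeff_one hα hs
  norm_succ := norm_zetaCoeff_succ_le hα hs

end Zeta

end GossZeta

end

theorem proposition3p10 {F : Type*} [Field F] [Finite F] (p : ℕ) [Fact p.Prime] [CharP F p]
    (v : HeightOneSpectrum F[X]) (hv : GossZeta.degree v = 1)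
    (j : GossZeta.Exponent p v)
    (hj : j ∈ Ideal.span {(Nat.card F : GossZeta.Exponent p v) - 1}) :
    (∀ x : GossZeta.CompletedClosure v, x ≠ 0 → Summable (GossZeta.zetaTerm p v x j)) ∧
    (∀ x : GossZeta.CompletedClosure v, x ≠ 0 → GossZeta.zeta p v x j = 0 →
      analyticOrderAt (fun z => GossZeta.zeta p v z j) x = 1 ∧
      x ∈ Set.range (algebraMap (GossZeta.LocalField v) (GossZeta.CompletedClosure v))) ∧
    (∀ x y : GossZeta.CompletedClosure v, x ≠ 0 → y ≠ 0 →
      GossZeta.zeta p v x j = 0 → GossZeta.zeta p v y j = 0 → ‖x‖ = ‖y‖ → x = y) := by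
  obtain ⟨α, hα⟩ := GossZeta.exists_asIdeal_eq_span hv
  have h := GossZeta.isQuadDecreasing_zetaCoeff hα hj
  refine ⟨fun x _ => h.summable x⁻¹, fun x hx h0 => ⟨h.analyticOrderAt_eq_one hx h0, ?_⟩,
    fun x y hx hy hx0 hy0 hxy => ?_⟩
  · obtain ⟨w, hw⟩ := h.mem_range_of_zero (inv_ne_zero hx) h0
    exact ⟨w⁻¹, by rw [map_inv₀, hw, inv_inv]⟩
  · exact inv_injective (h.eq_of_norm_eq (inv_ne_zero hx) hx0 hy0 (by rw [norm_inv, norm_inv, hxy]))
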